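/- Setting. Let $(I,\mathcal A,\mu)$ be a probability space with $|A|:=\mu(A)$, and let $\mathcal P=(\mathcal P^k)_{k\ge 0}$ be a good grid: finite measurable partitions of $I$ (up to null sets) with $\mathcal P^0=\{I\}$, such that every $Q\in\mathcal P^{k+1}$ is contained in some $P\in\mathcal P^{k}$, there are $\lambda_*,\lambda\in(0,1)$ with $\lambda_*\le |Q|/|P|\le\lambda$ whenever $Q\in\mathcal P^{k+1}$, $P\in\mathcal P^k$, $Q\subset P$, and $\bigcup_k\mathcal P^k$ generates $\mathcal A$. For $Q\in\mathcal P^k$ let $\Omega_Q=\{R\in\mathcal P^{k+1}: R\subset Q\}$ be the set of its children, and fix a total order on each $\Omega_Q$. Let $\mathcal H_Q$ be the finite set of pairs $(S_1,S_2)$ obtained by halving recursively: the ordered list $\Omega_Q$ is split into its first $\lfloor n/2\rfloor$ elements $S_1$ and the remaining ones $S_2$ (where $n$ is its length), and then each of $S_1,S_2$ that has at least two elements is split in the same way, and so on. For $(S_1,S_2)\in\mathcal H_Q$ put $$\phi_{(S_1,S_2)}=\frac{\sum_{P\in S_1}1_P}{\sum_{P\in S_1}|P|}-\frac{\sum_{R\in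 S_2}1_R}{\sum_{R\in S_2}|R|}.$$ Fix $s>0$. All sums below run over $k\ge 0$, $Q\in\mathcal P^k$ and $(S_1,S_2)\in\mathcal H_Q$, and infinite series are summed over the levels $k$. $B^s_{\infty,\infty}$ is the space of $\psi\in L^\infty(I)$ of the form $\psi=c_I1_I+\sum |Q|^{1+s}c_{(S_1,S_2)}\phi_{(S_1,S_2)}$ (convergence in $L^\infty$), with $|\psi|_{B^s_{\infty,\infty}}=|c_I|+\sup|c_{(S_1,S_2)}|<\infty$. The space $V_0$ of test functions is formed by those $\psi$ with only finitely many non-zero coefficients, and a distribution is a linear functional $V_0\to\mathbb C$. $B^{-s}_{1,1}$ is the space of all $\varphi\in(B^s_{\infty,\infty})^\star$ of the form $\varphi(\psi)=d_I\int\psi\,d\mu+\sum d_{(S_1,S_2)}|Q|^{-s}\int\psi\,\phi_{(S_1,S_2)}\,d\mu$ with $|\varphi|_{B^{-s}_{1,1}}=|d_I|+\sum|d_{(S_1,S_2)}|<\infty$. Let $\hat I$ be the set of sequences $x=(Q_0,Q_1,\dots)$ with $Q_0=I$ and $Q_{j+1}\in\Omega_{Q_j}$. The Dirac mass of $x\in\hat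 I$ is $\delta_x=\lim_j 1_{Q_j}/|Q_j|$. $PS^s$ is the set of limits, in the norm of $(B^s_{\infty,\infty})^\star$, of sequences of finite linear combinations of Dirac masses. Let $\mathcal F$ consist of $\{I\}$ and of all components $S_1,S_2$ of pairs in $\bigcup_Q\mathcal H_Q$; a member of $\mathcal F$ is identified with the union of its cells, and $x\in S$ means that some $Q_j$ belongs to $S$. A dipole basis is given by a choice of $x_S\in\hat I$ for $S\in\mathcal F$ such that $x_S\in S$, and $x_S=x_T$ whenever $S\subset T$ and $x_T\in S$; it consists of $\delta_I:=\delta_{x_I}$ and the dipoles $\delta_{x_{S_1}}-\delta_{x_{S_2}}$. $DC^s$ is the space of distributions of the form $$\gamma=m_0\,\delta_I+\sum m_{(S_1,S_2)}\big(\delta_{x_{S_1}}-\delta_{x_{S_2}}\big)\quad\text{on } V_0,\qquad |\gamma|_{DC^s}=|m_0|+\sum|Q|^s|m_{(S_1,S_2)}|<\infty .$$ Theorem. The limits defining the Dirac masses exist in the norm of $B^{-s}_{1,1}$, and $$B^{-s}_{1,1}=PS^s=DC^s$$ for every dipole basis. Here the first equality is one of subsets of $(B^s_{\infty,\infty})^\star$;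 in the second, $\varphi\in B^{-s}_{1,1}$ is identified with its restriction to $V_0$, which determines $\varphi$, and the dipole series of this restriction converges to $\varphi$ also in the norm of $(B^s_{\infty,\infty})^\star$. Moreover there is $C>0$, which does not depend on the chosen dipole basis, such that for every dipole basis and all $\varphi\in B^{-s}_{1,1}$ $$\frac1C|\varphi|_{DC^s}\le|\varphi|_{B^{-s}_{1,1}}\le C|\varphi|_{DC^s}.$$ -/

import Mathlib

open MeasureTheory Filter Topology
open scoped ENNReal BigOperators

noncomputable section

/-- A good grid on the probability space `(I, μ)`: a nested sequence of finite measurable partitions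
(up to sets of measure zero) in which each cell has a definite proportion of the measure of the
cell of the previous level that contains it. -/
structure GoodGrid {I : Type*} [mI : MeasurableSpace I] (μ : Measure I) where
  /-- the cells of the partition of level `k` -/
  cells : ℕ → Finset (Set I)
  measurable_cells : ∀ k, ∀ Q ∈ cells k, MeasurableSet Q
  aedisjoint_cells : ∀ k, ∀ Q ∈ cells k, ∀ R ∈ cells k, Q ≠ R → AEDisjoint μ Q R
  cover_cells : ∀ k, ∀ᵐ t ∂μ, ∃ Q ∈ cells k, t ∈ Q
  cells_zero : cells 0 = {Set.univ}
  nested : ∀ k, ∀ Q ∈ cells (k + 1), ∃ P ∈ cells k, Q ⊆ P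
  ratio : ∃ lamStar ∈ Set.Ioo (0 : ℝ) 1, ∃ lam ∈ Set.Ioo (0 : ℝ) 1,
    ∀ k, ∀ P ∈ cells k, ∀ Q ∈ cells (k + 1), Q ⊆ P →
      lamStar * μ.real P ≤ μ.real Q ∧ μ.real Q ≤ lam * μ.real P
  generate : mI = MeasurableSpace.generateFrom {A | ∃ k, A ∈ cells k}

/-- Recursive halving of a list: the pair (first half, second half), followed by the pairs that
come from the first half and those that come from the second half. A list with fewer than two
entries gives no pair. -/
def haarPairs {α : Type*} (l : List α) : List (List α × List α) :=
  if _h : 2 ≤ l.length then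
    (l.take (l.length / 2), l.drop (l.length / 2)) ::
      (haarPairs (l.take (l.length / 2)) ++ haarPairs (l.drop (l.length / 2)))
  else []
termination_by l.length
decreasing_by
  · simp only [List.length_take]; omega
  · simp only [List.length_drop]; omega

theorem mem_of_mem_haarPairs {α : Type*} (l : List α) :
    ∀ p ∈ haarPairs l, (∀ a ∈ p.1, a ∈ l) ∧ (∀ a ∈ p.2, a ∈ l) := by
  induction l using haarPairs.induct with
  | case1 l h ih1 ih2 =>
    intro p hp
    rw [haarPairs, dif_pos h] at hp
    simp only [List.mem_cons, List.mem_append] at hp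
    rcases hp with rfl | hp | hp
    · exact ⟨fun a ha => List.mem_of_mem_take ha, fun a ha => List.mem_of_mem_drop ha⟩
    · exact ⟨fun a ha => List.mem_of_mem_take ((ih1 p hp).1 a ha),
        fun a ha => List.mem_of_mem_take ((ih1 p hp).2 a ha)⟩
    · exact ⟨fun a ha => List.mem_of_mem_drop ((ih2 p hp).1 a ha),
        fun a ha => List.mem_of_mem_drop ((ih2 p hp).2 a ha)⟩
  | case2 l h =>
    intro p hp
    rw [haarPairs, dif_neg h] at hp
    simp at hp

theorem length_haarPairs_le {α : Type*} (l : List α) :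
    (haarPairs l).length ≤ l.length - 1 := by
  induction l using haarPairs.induct with
  | case1 l h ih1 ih2 =>
    rw [haarPairs, dif_pos h]
    simp only [List.length_cons, List.length_append, List.length_take, List.length_drop] at *
    omega
  | case2 l h =>
    rw [haarPairs, dif_neg h]
    simp

namespace GoodGrid

variable {I : Type*} [MeasurableSpace I] {μ : Measure I}

/-- A choice, for every cell `Q` of level `k`, of a total order on the set of its children, given
as the list of all children in increasing order. -/
structure ChildOrder (G : GoodGrid μ) where
  children : ℕ → Set I → List (Set I)
  nodup : ∀ k, ∀ Q ∈ G.cells k, (children k Q).Nodup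
  mem_children : ∀ k, ∀ Q ∈ G.cells k, ∀ R, R ∈ children k Q ↔ R ∈ G.cells (k + 1) ∧ R ⊆ Q

/-- The points of `Î`: sequences of cells `I = Q₀ ⊇ Q₁ ⊇ …` in which `Q_{j+1}` is a child
of `Q_j`. -/
structure Path (G : GoodGrid μ) where
  cell : ℕ → Set I
  cell_zero : cell 0 = Set.univ
  cell_mem : ∀ j, cell j ∈ G.cells j
  cell_succ_subset : ∀ j, cell (j + 1) ⊆ cell j

/-- `x ∈ Ŝ` for a family `S` of cells: the sequence `x` passes through one of the cells of `S`. -/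
def Path.InFamily {G : GoodGrid μ} (x : G.Path) (S : List (Set I)) : Prop :=
  ∃ j, x.cell j ∈ S

variable {G : GoodGrid μ}

/-- The pairs `(S₁, S₂) ∈ H_Q` with `Q` a cell of level `k`. -/
def LevelPair (o : G.ChildOrder) (k : ℕ) : Type _ :=
  Σ Q : {Q : Set I // Q ∈ G.cells k},
    {p : List (Set I) × List (Set I) // p ∈ haarPairs (o.children k Q)}

instance (o : G.ChildOrder) (k : ℕ) : Fintype (LevelPair o k) := by
  classical
  exact inferInstanceAs (Fintype (Σ Q : {Q : Set I // Q ∈ G.cells k},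
    {p : List (Set I) × List (Set I) // p ∈ haarPairs (o.children k Q)}))

/-- All pairs `(S₁, S₂) ∈ H_Q`, over all levels `k` and all cells `Q` of level `k`. -/
def HaarIndex (o : G.ChildOrder) : Type _ := Σ k : ℕ, LevelPair o k

/-- The cell `Q` such that the pair belongs to `H_Q`. -/
def HaarIndex.cell {o : G.ChildOrder} (i : HaarIndex o) : Set I := i.2.1.1

/-- The first component `S₁` of the pair. -/
def HaarIndex.left {o : G.ChildOrder} (i : HaarIndex o) : List (Set I) := i.2.2.1.1

/-- The second component `S₂` of the pair. -/
def HaarIndex.right {o : G.ChildOrder} (i : HaarIndex o) : List (Set I) := i.2.2.1.2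

/-- `∑_{P ∈ S} 1_P / ∑_{P ∈ S} |P|`. -/
def familyDensity (μ : Measure I) (S : List (Set I)) (t : I) : ℂ :=
  (S.map fun P => P.indicator (fun _ => (1 : ℂ)) t).sum /
    (((S.map fun P => μ.real P).sum : ℝ) : ℂ)

/-- The unbalanced Haar wavelet of a pair `(S₁, S₂)`. -/
def haar {o : G.ChildOrder} (i : HaarIndex o) (t : I) : ℂ :=
  familyDensity μ i.left t - familyDensity μ i.right t

/-- The sum of the levels `k < N` of the series
`c₀ 1_I + ∑_k ∑_{Q ∈ P^k} ∑_{(S₁,S₂) ∈ H_Q} |Q|^{1+s} c_{(S₁,S₂)} φ_{(S₁,S₂)}`. -/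
def haarPartialSum (o : G.ChildOrder) (s : ℝ) (c₀ : ℂ) (c : HaarIndex o → ℂ) (N : ℕ) (t : I) : ℂ :=
  c₀ + ∑ k ∈ Finset.range N, ∑ i : LevelPair o k,
    ((μ.real (HaarIndex.cell ⟨k, i⟩) ^ (1 + s) : ℝ) : ℂ) * c ⟨k, i⟩ * haar ⟨k, i⟩ t

/-- `ψ` is the sum in `L^∞` of the Haar series with the bounded coefficients `c₀, c`. -/
def IsHaarRep (o : G.ChildOrder) (s : ℝ) (c₀ : ℂ) (c : HaarIndex o → ℂ) (ψ : Lp ℂ ∞ μ) : Prop :=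
  BddAbove (Set.range fun i => ‖c i‖) ∧
    Tendsto (fun N => eLpNorm (fun t => ψ t - haarPartialSum o s c₀ c N t) ∞ μ) atTop (𝓝 0)

/-! ### Auxiliary facts -/

theorem HaarIndex.measurableSet_left {o : G.ChildOrder} (i : HaarIndex o) :
    ∀ P ∈ i.left, MeasurableSet P := fun P hP =>
  G.measurable_cells (i.1 + 1) P
    (((o.mem_children i.1 i.2.1.1 i.2.1.2 P).1
      ((mem_of_mem_haarPairs _ _ i.2.2.2).1 P hP)).1)

theorem HaarIndex.measurableSet_right {o : G.ChildOrder} (i : HaarIndex o) :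
    ∀ P ∈ i.right, MeasurableSet P := fun P hP =>
  G.measurable_cells (i.1 + 1) P
    (((o.mem_children i.1 i.2.1.1 i.2.1.2 P).1
      ((mem_of_mem_haarPairs _ _ i.2.2.2).2 P hP)).1)

theorem measurable_indicator_sum (S : List (Set I)) (hS : ∀ P ∈ S, MeasurableSet P) :
    Measurable fun t => (S.map fun P => P.indicator (fun _ => (1 : ℂ)) t).sum := by
  induction S with
  | nil => simp
  | cons P S ih =>
    simp only [List.map_cons, List.sum_cons]
    exact (measurable_const.indicator (hS P (by simp))).add
      (ih fun R hR => hS R (by simp [hR]))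

theorem measurable_haar {o : G.ChildOrder} (i : HaarIndex o) : Measurable (haar i) :=
  ((measurable_indicator_sum _ i.measurableSet_left).div_const _).sub
    ((measurable_indicator_sum _ i.measurableSet_right).div_const _)

theorem measurable_haarPartialSum (o : G.ChildOrder) (s : ℝ) (c₀ : ℂ) (c : HaarIndex o → ℂ)
    (N : ℕ) : Measurable (haarPartialSum o s c₀ c N) := by
  refine measurable_const.add ?_
  refine Finset.measurable_fun_sum _ fun k _ => ?_
  refine Finset.measurable_fun_sum _ fun i _ => ?_
  exact (measurable_haar _).const_mul _

theorem haarPartialSum_add (o : G.ChildOrder) (s : ℝ) (c₀ d₀ : ℂ) (c d : HaarIndex o → ℂ)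
    (N : ℕ) (t : I) :
    haarPartialSum o s (c₀ + d₀) (fun i => c i + d i) N t =
      haarPartialSum o s c₀ c N t + haarPartialSum o s d₀ d N t := by
  simp only [haarPartialSum, mul_add, add_mul, Finset.sum_add_distrib]
  ring

theorem haarPartialSum_smul (o : G.ChildOrder) (s : ℝ) (a c₀ : ℂ) (c : HaarIndex o → ℂ)
    (N : ℕ) (t : I) :
    haarPartialSum o s (a * c₀) (fun i => a * c i) N t = a * haarPartialSum o s c₀ c N t := by
  simp only [haarPartialSum, mul_add, Finset.mul_sum]
  congr 1
  refine Finset.sum_congr rfl fun k _ => Finset.sum_congr rfl fun i _ => ?_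
  ring

theorem IsHaarRep.zero (o : G.ChildOrder) (s : ℝ) : IsHaarRep o s 0 (fun _ => 0) 0 := by
  refine ⟨⟨0, by rintro _ ⟨i, rfl⟩; simp⟩, ?_⟩
  have h : ∀ N, eLpNorm (fun t => (0 : Lp ℂ ∞ μ) t - haarPartialSum o s 0 (fun _ => 0) N t) ∞ μ
      = 0 := by
    intro N
    refine (eLpNorm_congr_ae (g := fun _ => (0 : ℂ)) ?_).trans eLpNorm_zero'
    filter_upwards [Lp.coeFn_zero ℂ ∞ μ] with t ht
    rw [ht]
    simp [haarPartialSum]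
  simp only [h]
  exact tendsto_const_nhds

theorem IsHaarRep.add {o : G.ChildOrder} {s : ℝ} {c₀ d₀ : ℂ} {c d : HaarIndex o → ℂ}
    {ψ χ : Lp ℂ ∞ μ} (hc : IsHaarRep o s c₀ c ψ) (hd : IsHaarRep o s d₀ d χ) :
    IsHaarRep o s (c₀ + d₀) (fun i => c i + d i) (ψ + χ) := by
  obtain ⟨⟨A, hA⟩, hc⟩ := hc
  obtain ⟨⟨B, hB⟩, hd⟩ := hd
  refine ⟨⟨A + B, ?_⟩, ?_⟩
  · rintro _ ⟨i, rfl⟩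
    exact (norm_add_le _ _).trans (add_le_add (hA ⟨i, rfl⟩) (hB ⟨i, rfl⟩))
  · have h0 := hc.add hd
    rw [add_zero] at h0
    refine tendsto_of_tendsto_of_tendsto_of_le_of_le tendsto_const_nhds h0 (fun _ => zero_le)
      fun N => ?_
    have : eLpNorm (fun t => (ψ + χ) t -
        haarPartialSum o s (c₀ + d₀) (fun i => c i + d i) N t) ∞ μ =
        eLpNorm ((fun t => ψ t - haarPartialSum o s c₀ c N t) +
          fun t => χ t - haarPartialSum o s d₀ d N t) ∞ μ := by
      refine eLpNorm_congr_ae ?_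
      filter_upwards [Lp.coeFn_add ψ χ] with t ht
      simp only [ht, Pi.add_apply, haarPartialSum_add]
      ring
    simp only [this]
    exact eLpNorm_add_le
      ((Lp.aestronglyMeasurable ψ).sub (measurable_haarPartialSum o s c₀ c N).aestronglyMeasurable)
      ((Lp.aestronglyMeasurable χ).sub (measurable_haarPartialSum o s d₀ d N).aestronglyMeasurable)
      le_top

theorem IsHaarRep.smul {o : G.ChildOrder} {s : ℝ} {c₀ : ℂ} {c : HaarIndex o → ℂ}
    {ψ : Lp ℂ ∞ μ} (a : ℂ) (hc : IsHaarRep o s c₀ c ψ) :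
    IsHaarRep o s (a * c₀) (fun i => a * c i) (a • ψ) := by
  obtain ⟨⟨A, hA⟩, hc⟩ := hc
  refine ⟨⟨‖a‖ * A, ?_⟩, ?_⟩
  · rintro _ ⟨i, rfl⟩
    simp only [norm_mul]
    exact mul_le_mul_of_nonneg_left (hA ⟨i, rfl⟩) (norm_nonneg _)
  · have h0 : Tendsto (fun N => ‖a‖ₑ *
        eLpNorm (fun t => ψ t - haarPartialSum o s c₀ c N t) ∞ μ) atTop (𝓝 (‖a‖ₑ * 0)) :=
      ENNReal.Tendsto.const_mul hc (Or.inr enorm_ne_top)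
    rw [mul_zero] at h0
    refine h0.congr fun N => ?_
    rw [← eLpNorm_const_smul]
    refine eLpNorm_congr_ae ?_
    filter_upwards [Lp.coeFn_smul a ψ] with t ht
    simp only [ht, Pi.smul_apply, haarPartialSum_smul, smul_eq_mul]
    ring

/-- The vector space of all `ψ ∈ L^∞` that have a Haar series with bounded coefficients. -/
def besovInfSubmodule (o : G.ChildOrder) (s : ℝ) : Submodule ℂ (Lp ℂ ∞ μ) where
  carrier := {ψ | ∃ c₀ c, IsHaarRep o s c₀ c ψ}
  zero_mem' := ⟨0, _, IsHaarRep.zero o s⟩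
  add_mem' := by
    rintro ψ χ ⟨c₀, c, hc⟩ ⟨d₀, d, hd⟩
    exact ⟨_, _, hc.add hd⟩
  smul_mem' := by
    rintro a ψ ⟨c₀, c, hc⟩
    exact ⟨_, _, hc.smul a⟩

theorem measureReal_cell_pos [IsProbabilityMeasure μ] (G : GoodGrid μ) :
    ∀ k, ∀ Q ∈ G.cells k, 0 < μ.real Q := by
  obtain ⟨a, ha, b, hb, h⟩ := G.ratio
  intro k
  induction k with
  | zero => intro Q hQ; rw [G.cells_zero, Finset.mem_singleton] at hQ; simp [hQ]
  | succ k ih =>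
    intro Q hQ
    obtain ⟨P, hP, hQP⟩ := G.nested k Q hQ
    exact (mul_pos ha.1 (ih P hP)).trans_le (h k P hP Q hQ hQP).1

theorem sum_measureReal_le [IsProbabilityMeasure μ] (G : GoodGrid μ) (k : ℕ)
    (F : Finset (Set I)) (hF : F ⊆ G.cells k) (A : Set I)
    (hA : ∀ Q ∈ F, Q ⊆ A) : ∑ Q ∈ F, μ.real Q ≤ μ.real A := by
  have h : μ.real (⋃ Q ∈ F, Q) = ∑ Q ∈ F, μ.real Q := by
    simp only [Measure.real]
    rw [measure_biUnion_finset₀, ENNReal.toReal_sum fun _ _ => measure_ne_top _ _]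
    · intro Q hQ R hR hQR
      exact G.aedisjoint_cells k Q (hF hQ) R (hF hR) hQR
    · intro Q hQ
      exact (G.measurable_cells k Q (hF hQ)).nullMeasurableSet
  rw [← h]
  exact measureReal_mono (Set.iUnion₂_subset hA)

theorem eLpNorm_indicator_sum_le [IsProbabilityMeasure μ] (S : List (Set I))
    (hS : ∀ P ∈ S, MeasurableSet P) :
    eLpNorm (fun t => (S.map fun P => P.indicator (fun _ => (1 : ℂ)) t).sum) 1 μ ≤
      ENNReal.ofReal (S.map fun P => μ.real P).sum := by
  induction S with
  | nil => simp
  | cons P S ih =>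
    have hP : MeasurableSet P := hS P (by simp)
    have hS' : ∀ R ∈ S, MeasurableSet R := fun R hR => hS R (by simp [hR])
    simp only [List.map_cons, List.sum_cons]
    refine (eLpNorm_add_le (measurable_const.indicator hP).aestronglyMeasurable
      (measurable_indicator_sum S hS').aestronglyMeasurable le_rfl).trans ?_
    rw [ENNReal.ofReal_add measureReal_nonneg (List.sum_nonneg (by
      intro x hx
      obtain ⟨R, _, rfl⟩ := List.mem_map.1 hx
      exact measureReal_nonneg))]
    refine add_le_add ?_ (ih hS')
    refine (eLpNorm_indicator_const_le (1 : ℂ) 1).trans ?_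
    simp [Measure.real]

theorem eLpNorm_familyDensity_le [IsProbabilityMeasure μ] (S : List (Set I))
    (hS : ∀ P ∈ S, MeasurableSet P) : eLpNorm (familyDensity μ S) 1 μ ≤ 1 := by
  set T : ℝ := (S.map fun P => μ.real P).sum with hT
  have hT0 : 0 ≤ T := List.sum_nonneg (by
    intro x hx
    obtain ⟨R, _, rfl⟩ := List.mem_map.1 hx
    exact measureReal_nonneg)
  have h1 : familyDensity μ S = ((T : ℂ)⁻¹) •
      fun t => (S.map fun P => P.indicator (fun _ => (1 : ℂ)) t).sum := by
    funext t
    simp only [familyDensity, Pi.smul_apply, smul_eq_mul, div_eq_inv_mul, hT]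
  rw [h1, eLpNorm_const_smul]
  refine (mul_le_mul_right (eLpNorm_indicator_sum_le S hS) _).trans ?_
  rw [← hT]
  have h2 : ‖((T : ℂ)⁻¹)‖ₑ = ENNReal.ofReal (T⁻¹) := by
    rw [← ofReal_norm]
    simp [abs_of_nonneg hT0]
  rw [h2, ← ENNReal.ofReal_mul (inv_nonneg.2 hT0), ENNReal.ofReal_le_one]
  exact inv_mul_le_one

theorem eLpNorm_haar_le [IsProbabilityMeasure μ] {o : G.ChildOrder} (i : HaarIndex o) :
    eLpNorm (haar i) 1 μ ≤ 2 := by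
  refine (eLpNorm_sub_le
    ((measurable_indicator_sum _ i.measurableSet_left).div_const _).aestronglyMeasurable
    ((measurable_indicator_sum _ i.measurableSet_right).div_const _).aestronglyMeasurable
    le_rfl).trans ?_
  refine (add_le_add (eLpNorm_familyDensity_le _ i.measurableSet_left)
    (eLpNorm_familyDensity_le _ i.measurableSet_right)).trans ?_
  norm_num

theorem level_sum_le [IsProbabilityMeasure μ] (o : G.ChildOrder) {s : ℝ} (hs : 0 < s) :
    ∃ A r : ℝ, 0 ≤ A ∧ 0 ≤ r ∧ r < 1 ∧ ∀ k,
      ∑ i : LevelPair o k, μ.real (HaarIndex.cell ⟨k, i⟩) ^ (1 + s) ≤ A * r ^ k := by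
  classical
  obtain ⟨a, ha, b, hb, h⟩ := G.ratio
  refine ⟨a⁻¹, b ^ s, inv_nonneg.2 ha.1.le, Real.rpow_nonneg hb.1.le _,
    Real.rpow_lt_one hb.1.le hb.2 hs, fun k => ?_⟩
  have hle : ∀ k, ∀ Q ∈ G.cells k, μ.real Q ≤ b ^ k := by
    intro k
    induction k with
    | zero => intro Q _; simp
    | succ k ih =>
      intro Q hQ
      obtain ⟨P, hP, hQP⟩ := G.nested k Q hQ
      refine (h k P hP Q hQ hQP).2.trans ?_
      rw [pow_succ']
      exact mul_le_mul_of_nonneg_left (ih P hP) hb.1.le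
  have hcard : ∀ Q : {Q : Set I // Q ∈ G.cells k},
      (Fintype.card {p : List (Set I) × List (Set I) // p ∈ haarPairs (o.children k Q)} : ℝ)
        ≤ a⁻¹ := by
    rintro ⟨Q, hQ⟩
    have h1 : Fintype.card {p : List (Set I) × List (Set I) // p ∈ haarPairs (o.children k Q)}
        ≤ (o.children k Q).toFinset.card := by
      rw [Fintype.card_of_subtype (haarPairs (o.children k Q)).toFinset (by simp),
        List.toFinset_card_of_nodup (o.nodup k Q hQ)]
      exact (List.toFinset_card_le _).trans ((length_haarPairs_le _).trans (Nat.sub_le _ _))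
    have h2 := sum_measureReal_le G (k + 1) (o.children k Q).toFinset
      (fun R hR => ((o.mem_children k Q hQ R).1 (by simpa using hR)).1) Q
      (fun R hR => ((o.mem_children k Q hQ R).1 (by simpa using hR)).2)
    have h3 : ((o.children k Q).toFinset.card : ℝ) * (a * μ.real Q) ≤ μ.real Q := by
      refine le_trans ?_ h2
      rw [← nsmul_eq_mul]
      refine Finset.card_nsmul_le_sum _ _ _ fun R hR => ?_
      have hR' := (o.mem_children k Q hQ R).1 (by simpa using hR)
      exact (h k Q hQ R hR'.1 hR'.2).1
    have hpos := measureReal_cell_pos G k Q hQ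
    have h4 : ((o.children k Q).toFinset.card : ℝ) * a ≤ 1 := by
      have : ((o.children k Q).toFinset.card : ℝ) * a * μ.real Q ≤ 1 * μ.real Q := by
        rw [one_mul, mul_assoc]; exact h3
      exact le_of_mul_le_mul_right this hpos
    refine le_trans (Nat.cast_le.2 h1) ?_
    rw [← one_div, le_div_iff₀ ha.1]
    exact h4
  have hsum : ∑ i : LevelPair o k, μ.real (HaarIndex.cell ⟨k, i⟩) ^ (1 + s) =
      ∑ Q : {Q : Set I // Q ∈ G.cells k}, ∑ _p :
        {p : List (Set I) × List (Set I) // p ∈ haarPairs (o.children k Q)},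
        μ.real Q.1 ^ (1 + s) :=
    Fintype.sum_sigma (fun i : (Σ Q : {Q : Set I // Q ∈ G.cells k},
      {p : List (Set I) × List (Set I) // p ∈ haarPairs (o.children k Q)}) =>
        μ.real i.1.1 ^ (1 + s))
  rw [hsum]
  have hterm : ∀ Q : {Q : Set I // Q ∈ G.cells k}, (∑ _p :
        {p : List (Set I) × List (Set I) // p ∈ haarPairs (o.children k Q)},
        μ.real Q.1 ^ (1 + s)) ≤ a⁻¹ * (b ^ s) ^ k * μ.real Q.1 := by
    intro Q
    have hpos := measureReal_cell_pos G k Q.1 Q.2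
    rw [Finset.sum_const, nsmul_eq_mul, Finset.card_univ, Real.rpow_add hpos, Real.rpow_one]
    have h5 : μ.real Q.1 ^ s ≤ (b ^ s) ^ k := by
      rw [← Real.rpow_natCast, ← Real.rpow_mul hb.1.le, mul_comm s, Real.rpow_mul hb.1.le,
        Real.rpow_natCast]
      exact Real.rpow_le_rpow hpos.le (hle k Q.1 Q.2) hs.le
    calc _ ≤ a⁻¹ * (μ.real Q.1 * (b ^ s) ^ k) :=
          mul_le_mul (hcard Q) (mul_le_mul_of_nonneg_left h5 hpos.le)
            (by positivity) (inv_nonneg.2 ha.1.le)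
      _ = _ := by ring
  refine (Finset.sum_le_sum fun Q _ => hterm Q).trans ?_
  rw [← Finset.mul_sum]
  have h6 : ∑ Q : {Q : Set I // Q ∈ G.cells k}, μ.real Q.1 ≤ 1 := by
    rw [Finset.sum_coe_sort (G.cells k) (fun Q => μ.real Q)]
    simpa using sum_measureReal_le G k (G.cells k) (Finset.Subset.refl _) Set.univ
      (fun Q _ => Set.subset_univ Q)
  have h7 : 0 ≤ a⁻¹ * (b ^ s) ^ k :=
    mul_nonneg (inv_nonneg.2 ha.1.le) (pow_nonneg (Real.rpow_nonneg hb.1.le _) _)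
  simpa using mul_le_mul_of_nonneg_left h6 h7

theorem eLpNorm_haarPartialSum_le [IsProbabilityMeasure μ] (o : G.ChildOrder) {s : ℝ}
    (hs : 0 < s) : ∃ C : ℝ, 0 ≤ C ∧ ∀ (c₀ : ℂ) (c : HaarIndex o → ℂ) (M : ℝ), 0 ≤ M →
      (∀ i, ‖c i‖ ≤ M) → ∀ N,
        eLpNorm (haarPartialSum o s c₀ c N) 1 μ ≤ ENNReal.ofReal (C * (‖c₀‖ + M)) := by
  obtain ⟨A, r, hA, hr, hr1, h⟩ := level_sum_le o hs
  have hr2 : 0 < 1 - r := by linarith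
  refine ⟨1 + 2 * (A * (1 - r)⁻¹), by positivity, fun c₀ c M hM hc N => ?_⟩
  have hterm : ∀ k (i : LevelPair o k), eLpNorm (fun t =>
      ((μ.real (HaarIndex.cell ⟨k, i⟩) ^ (1 + s) : ℝ) : ℂ) * c ⟨k, i⟩ * haar ⟨k, i⟩ t) 1 μ ≤
      ENNReal.ofReal (μ.real (HaarIndex.cell ⟨k, i⟩) ^ (1 + s) * M * 2) := by
    intro k i
    have h0 : 0 ≤ μ.real (HaarIndex.cell ⟨k, i⟩) ^ (1 + s) :=
      Real.rpow_nonneg measureReal_nonneg _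
    have h1 := eLpNorm_const_smul (((μ.real (HaarIndex.cell ⟨k, i⟩) ^ (1 + s) : ℝ) : ℂ) * c ⟨k, i⟩)
      (haar (o := o) ⟨k, i⟩) 1 μ
    refine (le_of_eq h1).trans ?_
    refine (mul_le_mul_right (eLpNorm_haar_le _) _).trans ?_
    rw [← ofReal_norm, ENNReal.ofReal_mul (mul_nonneg h0 hM)]
    refine mul_le_mul' (ENNReal.ofReal_le_ofReal ?_) (by simp)
    rw [norm_mul, Complex.norm_real, Real.norm_of_nonneg h0]
    exact mul_le_mul_of_nonneg_left (hc _) h0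
  have hlevel : ∀ k, eLpNorm (fun t => ∑ i : LevelPair o k,
      ((μ.real (HaarIndex.cell ⟨k, i⟩) ^ (1 + s) : ℝ) : ℂ) * c ⟨k, i⟩ * haar ⟨k, i⟩ t) 1 μ ≤
      ENNReal.ofReal (2 * M * A * r ^ k) := by
    intro k
    have h1 := eLpNorm_sum_le (μ := μ) (p := 1) (s := (Finset.univ : Finset (LevelPair o k)))
      (f := fun i t => ((μ.real (HaarIndex.cell ⟨k, i⟩) ^ (1 + s) : ℝ) : ℂ) * c ⟨k, i⟩ *
        haar ⟨k, i⟩ t) (fun i _ => ((measurable_haar _).const_mul _).aestronglyMeasurable) le_rfl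
    have h2 : (∑ i : LevelPair o k, fun t => ((μ.real (HaarIndex.cell ⟨k, i⟩) ^ (1 + s) : ℝ) : ℂ) *
        c ⟨k, i⟩ * haar ⟨k, i⟩ t) = fun t => ∑ i : LevelPair o k,
        ((μ.real (HaarIndex.cell ⟨k, i⟩) ^ (1 + s) : ℝ) : ℂ) * c ⟨k, i⟩ * haar ⟨k, i⟩ t := by
      funext t; simp
    rw [h2] at h1
    refine h1.trans ((Finset.sum_le_sum fun i _ => hterm k i).trans ?_)
    rw [← ENNReal.ofReal_sum_of_nonneg fun i _ => mul_nonneg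
      (mul_nonneg (Real.rpow_nonneg measureReal_nonneg _) hM) zero_le_two]
    refine ENNReal.ofReal_le_ofReal ?_
    rw [← Finset.sum_mul, ← Finset.sum_mul]
    have := mul_le_mul_of_nonneg_left (h k) (mul_nonneg zero_le_two hM)
    linarith
  have hgeom : ∑ k ∈ Finset.range N, r ^ k ≤ (1 - r)⁻¹ := by
    rw [← tsum_geometric_of_lt_one hr hr1]
    exact (summable_geometric_of_lt_one hr hr1).sum_le_tsum _ fun _ _ => pow_nonneg hr _
  have hsum : eLpNorm (fun t => ∑ k ∈ Finset.range N, ∑ i : LevelPair o k,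
      ((μ.real (HaarIndex.cell ⟨k, i⟩) ^ (1 + s) : ℝ) : ℂ) * c ⟨k, i⟩ * haar ⟨k, i⟩ t) 1 μ ≤
      ENNReal.ofReal (2 * M * A * (1 - r)⁻¹) := by
    have h1 := eLpNorm_sum_le (μ := μ) (p := 1) (s := Finset.range N)
      (f := fun k t => ∑ i : LevelPair o k,
        ((μ.real (HaarIndex.cell ⟨k, i⟩) ^ (1 + s) : ℝ) : ℂ) * c ⟨k, i⟩ * haar ⟨k, i⟩ t)
      (fun k _ => (Finset.measurable_fun_sum _ fun i _ =>
        (measurable_haar _).const_mul _).aestronglyMeasurable) le_rfl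
    have h2 : (∑ k ∈ Finset.range N, fun t => ∑ i : LevelPair o k,
        ((μ.real (HaarIndex.cell ⟨k, i⟩) ^ (1 + s) : ℝ) : ℂ) * c ⟨k, i⟩ * haar ⟨k, i⟩ t) =
        fun t => ∑ k ∈ Finset.range N, ∑ i : LevelPair o k,
        ((μ.real (HaarIndex.cell ⟨k, i⟩) ^ (1 + s) : ℝ) : ℂ) * c ⟨k, i⟩ * haar ⟨k, i⟩ t := by
      funext t; simp
    rw [h2] at h1
    refine h1.trans ((Finset.sum_le_sum fun k _ => hlevel k).trans ?_)
    rw [← ENNReal.ofReal_sum_of_nonneg fun i _ => by positivity]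
    refine ENNReal.ofReal_le_ofReal ?_
    rw [← Finset.mul_sum]
    exact mul_le_mul_of_nonneg_left hgeom (by positivity)
  have hconst : eLpNorm (fun _ : I => c₀) 1 μ ≤ ENNReal.ofReal ‖c₀‖ := by
    rw [eLpNorm_const _ one_ne_zero (IsProbabilityMeasure.ne_zero μ)]
    simp
  refine (eLpNorm_add_le (f := fun _ : I => c₀) measurable_const.aestronglyMeasurable
    (Finset.measurable_fun_sum _ fun k _ => Finset.measurable_fun_sum _ fun i _ =>
        (measurable_haar _).const_mul _).aestronglyMeasurable le_rfl).trans ?_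
  refine (add_le_add hconst hsum).trans ?_
  rw [← ENNReal.ofReal_add (norm_nonneg _) (by positivity)]
  refine ENNReal.ofReal_le_ofReal ?_
  have h8 : 0 ≤ A * (1 - r)⁻¹ := by positivity
  nlinarith [mul_nonneg h8 (norm_nonneg c₀), norm_nonneg c₀, hM]

theorem IsHaarRep.eLpNorm_le [IsProbabilityMeasure μ] (o : G.ChildOrder) {s : ℝ} (hs : 0 < s) :
    ∃ C : ℝ, 0 ≤ C ∧ ∀ (c₀ : ℂ) (c : HaarIndex o → ℂ) (ψ : Lp ℂ ∞ μ), IsHaarRep o s c₀ c ψ →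
      eLpNorm ψ 1 μ ≤ ENNReal.ofReal (C * (‖c₀‖ + ⨆ i, ‖c i‖)) := by
  obtain ⟨C, hC, h⟩ := eLpNorm_haarPartialSum_le o hs
  refine ⟨C, hC, fun c₀ c ψ hψ => ?_⟩
  have h1 := hψ.2.add_const (ENNReal.ofReal (C * (‖c₀‖ + ⨆ i, ‖c i‖)))
  rw [zero_add] at h1
  refine ge_of_tendsto h1 (Eventually.of_forall fun N => ?_)
  have hm := ((Lp.aestronglyMeasurable ψ).sub
    (measurable_haarPartialSum o s c₀ c N).aestronglyMeasurable)
  have h2 := eLpNorm_add_le hm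
    (measurable_haarPartialSum o s c₀ c N).aestronglyMeasurable (le_refl (1 : ℝ≥0∞))
  rw [sub_add_cancel] at h2
  refine h2.trans (add_le_add (eLpNorm_le_eLpNorm_of_exponent_le le_top hm) ?_)
  exact h c₀ c _ (Real.iSup_nonneg fun i => norm_nonneg _) (fun i => le_ciSup hψ.1 i) N

/-! ### The Besov space `B^s_{∞,∞}` -/

/-- The space `B^s_{∞,∞}`, `s > 0`, of all `ψ ∈ L^∞` that have a Haar series with bounded
coefficients. It is normed by `|c₀| + sup |c|`, not by the norm of `L^∞`. -/
def BesovInf (o : G.ChildOrder) {s : ℝ} (_hs : 0 < s) : Type _ := ↥(besovInfSubmodule o s)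

namespace BesovInf

variable {o : G.ChildOrder} {s : ℝ} {hs : 0 < s}

instance : AddCommGroup (BesovInf o hs) := inferInstanceAs (AddCommGroup ↥(besovInfSubmodule o s))

instance : Module ℂ (BesovInf o hs) := inferInstanceAs (Module ℂ ↥(besovInfSubmodule o s))

/-- The underlying element of `L^∞`, as a linear map. -/
def toLp (o : G.ChildOrder) {s : ℝ} (hs : 0 < s) : BesovInf o hs →ₗ[ℂ] Lp ℂ ∞ μ :=
  (besovInfSubmodule o s).subtype

theorem toLp_injective : Function.Injective (toLp o hs) :=
  Submodule.subtype_injective (besovInfSubmodule o s)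

theorem exists_rep (ψ : BesovInf o hs) : ∃ c₀ c, IsHaarRep o s c₀ c (toLp o hs ψ) := ψ.2

/-- `|ψ| = |c₀| + sup |c|` for the coefficients of the Haar series of `ψ`. As these are unique,
the infimum is over a single value. -/
instance : Norm (BesovInf o hs) where
  norm ψ := sInf {r : ℝ | ∃ c₀ c, IsHaarRep o s c₀ c (toLp o hs ψ) ∧ r = ‖c₀‖ + ⨆ i, ‖c i‖}

theorem norm_le {ψ : BesovInf o hs} {c₀ : ℂ} {c : HaarIndex o → ℂ}
    (h : IsHaarRep o s c₀ c (toLp o hs ψ)) : ‖ψ‖ ≤ ‖c₀‖ + ⨆ i, ‖c i‖ := by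
  refine csInf_le ⟨0, ?_⟩ ⟨c₀, c, h, rfl⟩
  rintro _ ⟨d₀, d, _, rfl⟩
  exact add_nonneg (norm_nonneg _) (Real.iSup_nonneg fun i => norm_nonneg _)

theorem le_norm {ψ : BesovInf o hs} {a : ℝ}
    (h : ∀ c₀ c, IsHaarRep o s c₀ c (toLp o hs ψ) → a ≤ ‖c₀‖ + ⨆ i, ‖c i‖) : a ≤ ‖ψ‖ := by
  obtain ⟨c₀, c, hc⟩ := exists_rep ψ
  refine le_csInf ⟨_, c₀, c, hc, rfl⟩ ?_
  rintro _ ⟨d₀, d, hd, rfl⟩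
  exact h d₀ d hd

theorem norm_nonneg' (ψ : BesovInf o hs) : 0 ≤ ‖ψ‖ :=
  le_norm fun _ _ _ => add_nonneg (norm_nonneg _) (Real.iSup_nonneg fun _ => norm_nonneg _)

theorem norm_add_le' (ψ χ : BesovInf o hs) : ‖ψ + χ‖ ≤ ‖ψ‖ + ‖χ‖ := by
  rw [← sub_le_iff_le_add]
  refine le_norm fun c₀ c hc => ?_
  rw [sub_le_comm]
  refine le_norm fun d₀ d hd => ?_
  rw [sub_le_iff_le_add']
  have h : IsHaarRep o s (c₀ + d₀) (fun i => c i + d i) (toLp o hs (ψ + χ)) := by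
    rw [map_add]; exact hc.add hd
  refine (norm_le h).trans ?_
  have h1 : (⨆ i, ‖c i + d i‖) ≤ (⨆ i, ‖c i‖) + ⨆ i, ‖d i‖ := by
    refine Real.iSup_le (fun i => (norm_add_le _ _).trans
      (add_le_add (le_ciSup hc.1 i) (le_ciSup hd.1 i))) ?_
    exact add_nonneg (Real.iSup_nonneg fun _ => norm_nonneg _)
      (Real.iSup_nonneg fun _ => norm_nonneg _)
  linarith [norm_add_le c₀ d₀]

theorem norm_smul_le' (a : ℂ) (ψ : BesovInf o hs) : ‖a • ψ‖ ≤ ‖a‖ * ‖ψ‖ := by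
  have key : ∀ c₀ c, IsHaarRep o s c₀ c (toLp o hs ψ) →
      ‖a • ψ‖ ≤ ‖a‖ * (‖c₀‖ + ⨆ i, ‖c i‖) := by
    intro c₀ c hc
    have h : IsHaarRep o s (a * c₀) (fun i => a * c i) (toLp o hs (a • ψ)) := by
      rw [map_smul]; exact hc.smul a
    refine (norm_le h).trans (le_of_eq ?_)
    simp only [norm_mul]
    rw [mul_add, Real.mul_iSup_of_nonneg (norm_nonneg a)]
  rcases (norm_nonneg a).eq_or_lt with h0 | h0
  · obtain ⟨c₀, c, hc⟩ := exists_rep ψ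
    have := key c₀ c hc
    rw [← h0, zero_mul] at this ⊢
    exact this
  · rw [← div_le_iff₀' h0]
    refine le_norm fun c₀ c hc => ?_
    rw [div_le_iff₀' h0]
    exact key c₀ c hc

theorem eLpNorm_le [IsProbabilityMeasure μ] (o : G.ChildOrder) {s : ℝ} (hs : 0 < s) :
    ∃ C : ℝ, 0 ≤ C ∧ ∀ ψ : BesovInf o hs,
      eLpNorm (toLp o hs ψ) 1 μ ≤ ENNReal.ofReal (C * ‖ψ‖) := by
  obtain ⟨C, hC, h⟩ := IsHaarRep.eLpNorm_le o hs
  refine ⟨C, hC, fun ψ => ?_⟩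
  have hfin : eLpNorm (toLp o hs ψ) 1 μ ≠ ∞ :=
    (((Lp.memLp (toLp o hs ψ)).mono_exponent le_top).eLpNorm_lt_top).ne
  rw [← ENNReal.ofReal_toReal hfin]
  refine ENNReal.ofReal_le_ofReal ?_
  have key : ∀ c₀ c, IsHaarRep o s c₀ c (toLp o hs ψ) →
      (eLpNorm (toLp o hs ψ) 1 μ).toReal ≤ C * (‖c₀‖ + ⨆ i, ‖c i‖) := fun c₀ c hc =>
    ENNReal.toReal_le_of_le_ofReal (mul_nonneg hC (add_nonneg (norm_nonneg _)
      (Real.iSup_nonneg fun _ => norm_nonneg _))) (h c₀ c _ hc)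
  rcases hC.eq_or_lt with h0 | h0
  · obtain ⟨c₀, c, hc⟩ := exists_rep ψ
    have := key c₀ c hc
    rw [← h0, zero_mul] at this ⊢
    exact this
  · rw [← div_le_iff₀' h0]
    refine le_norm fun c₀ c hc => ?_
    rw [div_le_iff₀' h0]
    exact key c₀ c hc

theorem normCore [IsProbabilityMeasure μ] (o : G.ChildOrder) {s : ℝ} (hs : 0 < s) :
    NormedSpace.Core ℂ (BesovInf o hs) where
  norm_nonneg := norm_nonneg'
  norm_triangle := norm_add_le'
  norm_smul a ψ := by
    refine le_antisymm (norm_smul_le' a ψ) ?_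
    rcases eq_or_ne a 0 with rfl | ha
    · simpa using norm_nonneg' ((0 : ℂ) • ψ)
    · have h1 := norm_smul_le' a⁻¹ (a • ψ)
      rw [smul_smul, inv_mul_cancel₀ ha, one_smul, norm_inv] at h1
      have h2 : 0 < ‖a‖ := norm_pos_iff.2 ha
      calc ‖a‖ * ‖ψ‖ ≤ ‖a‖ * (‖a‖⁻¹ * ‖a • ψ‖) := mul_le_mul_of_nonneg_left h1 h2.le
        _ = ‖a • ψ‖ := by rw [← mul_assoc, mul_inv_cancel₀ h2.ne', one_mul]
  norm_eq_zero_iff ψ := by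
    constructor
    · intro h
      obtain ⟨C, hC, hle⟩ := eLpNorm_le o hs
      have h1 := hle ψ
      rw [h, mul_zero, ENNReal.ofReal_zero, nonpos_iff_eq_zero,
        eLpNorm_eq_zero_iff (Lp.aestronglyMeasurable _) one_ne_zero] at h1
      refine toLp_injective ?_
      rw [map_zero]
      exact (Lp.eq_zero_iff_ae_eq_zero).2 h1
    · rintro rfl
      have h := norm_smul_le' (0 : ℂ) (0 : BesovInf o hs)
      rw [smul_zero, norm_zero, zero_mul] at h
      exact le_antisymm h (norm_nonneg' _)

instance [IsProbabilityMeasure μ] : NormedAddCommGroup (BesovInf o hs) :=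
  NormedAddCommGroup.ofCore (normCore o hs)

instance [IsProbabilityMeasure μ] : NormedSpace ℂ (BesovInf o hs) :=
  NormedSpace.ofCore (normCore o hs)

end BesovInf

variable [IsProbabilityMeasure μ]

/-- The functional `ψ ↦ ∫_A ψ dμ` on `B^s_{∞,∞}`, that is, `1_A` as a distribution. -/
def setIntegralFunctional (o : G.ChildOrder) {s : ℝ} (hs : 0 < s) (A : Set I) :
    StrongDual ℂ (BesovInf o hs) :=
  LinearMap.mkContinuousOfExistsBound
    { toFun := fun ψ => ∫ t in A, BesovInf.toLp o hs ψ t ∂μ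
      map_add' := fun ψ χ => by
        have h : ∀ ψ : BesovInf o hs, Integrable (BesovInf.toLp o hs ψ) μ := fun ψ =>
          (Lp.memLp (BesovInf.toLp o hs ψ)).integrable le_top
        rw [← integral_add (h ψ).integrableOn (h χ).integrableOn, map_add]
        exact integral_congr_ae (ae_restrict_of_ae (Lp.coeFn_add _ _))
      map_smul' := fun a ψ => by
        rw [RingHom.id_apply, ← integral_smul, map_smul]
        exact integral_congr_ae (ae_restrict_of_ae (Lp.coeFn_smul _ _)) }
    (by
      obtain ⟨C, hC, h⟩ := BesovInf.eLpNorm_le o hs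
      refine ⟨C, fun ψ => ?_⟩
      have hi : Integrable (BesovInf.toLp o hs ψ) μ :=
        (Lp.memLp (BesovInf.toLp o hs ψ)).integrable le_top
      have h1 : ‖∫ t in A, BesovInf.toLp o hs ψ t ∂μ‖ ≤ ∫ t, ‖BesovInf.toLp o hs ψ t‖ ∂μ :=
        (norm_integral_le_integral_norm _).trans
          (setIntegral_le_integral hi.norm (Eventually.of_forall fun _ => norm_nonneg _))
      refine h1.trans ?_
      rw [integral_norm_eq_lintegral_enorm hi.1, ← eLpNorm_one_eq_lintegral_enorm]
      exact ENNReal.toReal_le_of_le_ofReal (mul_nonneg hC (norm_nonneg _)) (h ψ))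

/-! ### The Besov space `B^{-s}_{1,1}` of distributions -/

/-- `φ` is given by the series
`d₀ 1_I + ∑_k ∑_{Q ∈ P^k} ∑_{(S₁,S₂) ∈ H_Q} d_{(S₁,S₂)} |Q|^{-s} φ_{(S₁,S₂)}`
with absolutely summable coefficients `d`. -/
def IsBesovRep {o : G.ChildOrder} {s : ℝ} {hs : 0 < s} (d₀ : ℂ) (d : HaarIndex o → ℂ)
    (φ : StrongDual ℂ (BesovInf o hs)) : Prop :=
  (Summable fun i => ‖d i‖) ∧
    ∀ ψ : BesovInf o hs, Tendsto (fun N => d₀ * ∫ t, BesovInf.toLp o hs ψ t ∂μ +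
      ∑ k ∈ Finset.range N, ∑ i : LevelPair o k,
        d ⟨k, i⟩ * ((μ.real (HaarIndex.cell ⟨k, i⟩) ^ (-s) : ℝ) : ℂ) *
          ∫ t, BesovInf.toLp o hs ψ t * haar ⟨k, i⟩ t ∂μ) atTop (𝓝 (φ ψ))

/-- The space `B^{-s}_{1,1}`, as a subset of the dual of `B^s_{∞,∞}`. -/
def besovOne (o : G.ChildOrder) {s : ℝ} (hs : 0 < s) : Set (StrongDual ℂ (BesovInf o hs)) :=
  {φ | ∃ d₀ d, IsBesovRep d₀ d φ}

/-- The norm of `B^{-s}_{1,1}`, which is `|d₀| + ∑ |d|`. As the coefficients of an element of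
`B^{-s}_{1,1}` are unique, the infimum is over a single value. -/
def besovOneNorm {o : G.ChildOrder} {s : ℝ} {hs : 0 < s}
    (φ : StrongDual ℂ (BesovInf o hs)) : ℝ :=
  sInf {r : ℝ | ∃ d₀ d, IsBesovRep d₀ d φ ∧ r = ‖d₀‖ + ∑' i, ‖d i‖}

/-! ### Dirac masses and particle systems -/

/-- `1_{Q_j} / |Q_j|` for the point `x = (Q₀, Q₁, …)` of `Î`, as a functional. -/
def cellAverage (o : G.ChildOrder) {s : ℝ} (hs : 0 < s) (x : G.Path) (j : ℕ) :
    StrongDual ℂ (BesovInf o hs) :=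
  (((μ.real (x.cell j))⁻¹ : ℝ) : ℂ) • setIntegralFunctional o hs (x.cell j)

/-- The Dirac mass `δ_x = lim_j 1_{Q_j} / |Q_j|` of `x ∈ Î`. -/
def dirac (o : G.ChildOrder) {s : ℝ} (hs : 0 < s) (x : G.Path) : StrongDual ℂ (BesovInf o hs) :=
  limUnder atTop (cellAverage o hs x)

/-- Finite configurations of particles `∑ m_i δ_{x_i}`. -/
def IsFiniteConfiguration {o : G.ChildOrder} {s : ℝ} {hs : 0 < s}
    (γ : StrongDual ℂ (BesovInf o hs)) : Prop :=
  ∃ (n : ℕ) (m : Fin n → ℂ) (x : Fin n → G.Path), γ = ∑ i, m i • dirac o hs (x i)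

/-- The set `PS^s` of `s`-particle systems: limits, in the norm of the dual of `B^s_{∞,∞}`, of
sequences of finite configurations of particles. -/
def particleSystems (o : G.ChildOrder) {s : ℝ} (hs : 0 < s) :
    Set (StrongDual ℂ (BesovInf o hs)) :=
  {γ | ∃ g : ℕ → StrongDual ℂ (BesovInf o hs),
    (∀ n, IsFiniteConfiguration (g n)) ∧ Tendsto g atTop (𝓝 γ)}

/-! ### Test functions, distributions and dipole configurations -/

/-- The space `V₀` of test functions: only finitely many Haar coefficients do not vanish. -/
def testFunctions (o : G.ChildOrder) {s : ℝ} (hs : 0 < s) : Submodule ℂ (BesovInf o hs) where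
  carrier := {ψ | ∃ c₀ c, IsHaarRep o s c₀ c (BesovInf.toLp o hs ψ) ∧
    (Function.support c).Finite}
  zero_mem' := ⟨0, fun _ => 0, by rw [map_zero]; exact IsHaarRep.zero o s, by simp⟩
  add_mem' := by
    rintro ψ χ ⟨c₀, c, hc, hc'⟩ ⟨d₀, d, hd, hd'⟩
    exact ⟨_, _, by rw [map_add]; exact hc.add hd,
      (hc'.union hd').subset (Function.support_add c d)⟩
  smul_mem' := by
    rintro a ψ ⟨c₀, c, hc, hc'⟩
    exact ⟨_, _, by rw [map_smul]; exact hc.smul a,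
      hc'.subset (Function.support_const_smul_subset a c)⟩

/-- Distributions: linear functionals on `V₀`. -/
abbrev Distribution (o : G.ChildOrder) {s : ℝ} (hs : 0 < s) : Type _ :=
  testFunctions o hs →ₗ[ℂ] ℂ

/-- The distribution given by a continuous linear functional on `B^s_{∞,∞}`. -/
def toDistribution {o : G.ChildOrder} {s : ℝ} {hs : 0 < s}
    (φ : StrongDual ℂ (BesovInf o hs)) : Distribution o hs :=
  φ.toLinearMap.domRestrict (testFunctions o hs)

/-- The family `F`, formed by `{I}` and the components of all pairs `(S₁, S₂)`. -/
def nodes (o : G.ChildOrder) : Set (List (Set I)) :=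
  {S | S = [Set.univ] ∨ ∃ i : HaarIndex o, S = i.left ∨ S = i.right}

/-- The choice of points that determines a dipole basis: `x_S ∈ S` for every `S ∈ F`, with
`x_S = x_T` whenever `⋃ S ⊆ ⋃ T` and `x_T ∈ S`. -/
structure DipoleBasis (o : G.ChildOrder) where
  point : List (Set I) → G.Path
  point_mem : ∀ S ∈ nodes o, (point S).InFamily S
  point_eq : ∀ S ∈ nodes o, ∀ T ∈ nodes o, (⋃ P ∈ S, P) ⊆ (⋃ P ∈ T, P) →
    (point T).InFamily S → point S = point T

namespace DipoleBasis

variable {o : G.ChildOrder} (b : DipoleBasis o) {s : ℝ} {hs : 0 < s}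

/-- The Dirac mass of a dipole basis. -/
def root (hs : 0 < s) : StrongDual ℂ (BesovInf o hs) := dirac o hs (b.point [Set.univ])

/-- The dipole `δ_{x_{S₁}} - δ_{x_{S₂}}` of a dipole basis. -/
def dipole (hs : 0 < s) (i : HaarIndex o) : StrongDual ℂ (BesovInf o hs) :=
  dirac o hs (b.point i.left) - dirac o hs (b.point i.right)

/-- The sum of the levels `k < N` of the series
`m₀ δ_I + ∑_k ∑_{P ∈ P^k} ∑_{(P₁,P₂) ∈ H_P} m_{(P₁,P₂)} (δ_{x_{P₁}} - δ_{x_{P₂}})`. -/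
def partialSum (hs : 0 < s) (m₀ : ℂ) (m : HaarIndex o → ℂ) (N : ℕ) :
    StrongDual ℂ (BesovInf o hs) :=
  m₀ • b.root hs + ∑ k ∈ Finset.range N, ∑ i : LevelPair o k, m ⟨k, i⟩ • b.dipole hs ⟨k, i⟩

/-- The distribution `γ` is the dipole configuration with coefficients `m₀, m`. On every test
function only finitely many terms of the series do not vanish. -/
def IsConfiguration (m₀ : ℂ) (m : HaarIndex o → ℂ) (γ : Distribution o hs) : Prop :=
  ∀ ψ : testFunctions o hs, Tendsto (fun N => b.partialSum hs m₀ m N ψ) atTop (𝓝 (γ ψ))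

/-- The weights `|P|^s |m_{(P₁,P₂)}|` have a finite sum. -/
def HasFiniteCost (_b : DipoleBasis o) (s : ℝ) (m : HaarIndex o → ℂ) : Prop :=
  Summable fun i : HaarIndex o => μ.real i.cell ^ s * ‖m i‖

/-- The space `DC^s` of distributions, for a given dipole basis. -/
def configurations (hs : 0 < s) : Set (Distribution o hs) :=
  {γ | ∃ m₀ m, b.IsConfiguration m₀ m γ ∧ b.HasFiniteCost s m}

/-- The norm of `DC^s`, which is `|m₀| + ∑_P |P|^s ∑_{(P₁,P₂) ∈ H_P} |m_{(P₁,P₂)}|`. As the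
coefficients are unique, the infimum is over a single value. -/
def configurationNorm (γ : Distribution o hs) : ℝ :=
  sInf {r : ℝ | ∃ m₀ m, b.IsConfiguration m₀ m γ ∧ b.HasFiniteCost s m ∧
    r = ‖m₀‖ + ∑' i : HaarIndex o, μ.real i.cell ^ s * ‖m i‖}

end DipoleBasis

end GoodGrid

end

noncomputable section

namespace GoodGrid

section Grid

variable {I : Type*} [MeasurableSpace I] {μ : Measure I}

/-- A lower bound for the proportion of a child in its parent. -/
def lower (G : GoodGrid μ) : ℝ := G.ratio.choose

/-- An upper bound for the proportion of a child in its parent. -/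
def upper (G : GoodGrid μ) : ℝ := G.ratio.choose_spec.2.choose

theorem lower_pos (G : GoodGrid μ) : 0 < G.lower := G.ratio.choose_spec.1.1

theorem upper_pos (G : GoodGrid μ) : 0 < G.upper := G.ratio.choose_spec.2.choose_spec.1.1

theorem upper_lt_one (G : GoodGrid μ) : G.upper < 1 := G.ratio.choose_spec.2.choose_spec.1.2

theorem lower_mul_le (G : GoodGrid μ) {k : ℕ} {P Q : Set I} (hP : P ∈ G.cells k)
    (hQ : Q ∈ G.cells (k + 1)) (h : Q ⊆ P) : G.lower * μ.real P ≤ μ.real Q :=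
  (G.ratio.choose_spec.2.choose_spec.2 k P hP Q hQ h).1

theorem le_upper_mul (G : GoodGrid μ) {k : ℕ} {P Q : Set I} (hP : P ∈ G.cells k)
    (hQ : Q ∈ G.cells (k + 1)) (h : Q ⊆ P) : μ.real Q ≤ G.upper * μ.real P :=
  (G.ratio.choose_spec.2.choose_spec.2 k P hP Q hQ h).2

theorem univ_mem_cells (G : GoodGrid μ) : Set.univ ∈ G.cells 0 := by
  rw [G.cells_zero]; exact Finset.mem_singleton_self _

theorem eq_univ_of_mem_cells_zero (G : GoodGrid μ) {Q : Set I} (h : Q ∈ G.cells 0) :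
    Q = Set.univ := by
  rwa [G.cells_zero, Finset.mem_singleton] at h

theorem exists_ancestor (G : GoodGrid μ) {k n : ℕ} (hkn : k ≤ n) {Q : Set I}
    (hQ : Q ∈ G.cells n) : ∃ P ∈ G.cells k, Q ⊆ P := by
  induction n, hkn using Nat.le_induction generalizing Q with
  | base => exact ⟨Q, hQ, subset_rfl⟩
  | succ n _ ih =>
    obtain ⟨R, hR, hQR⟩ := G.nested n Q hQ
    obtain ⟨P, hP, hRP⟩ := ih hR
    exact ⟨P, hP, hQR.trans hRP⟩

variable [IsProbabilityMeasure μ]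

omit [IsProbabilityMeasure μ] in
theorem inter_eq_zero (G : GoodGrid μ) {k : ℕ} {P Q : Set I} (hP : P ∈ G.cells k)
    (hQ : Q ∈ G.cells k) (h : P ≠ Q) : μ.real (P ∩ Q) = 0 := by
  rw [Measure.real, G.aedisjoint_cells k P hP Q hQ h, ENNReal.toReal_zero]

theorem eq_of_subset (G : GoodGrid μ) {k n : ℕ} {P P' Q : Set I} (hP : P ∈ G.cells k)
    (hP' : P' ∈ G.cells k) (hQ : Q ∈ G.cells n) (h : Q ⊆ P) (h' : Q ⊆ P') : P = P' := by
  by_contra hne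
  have h1 := G.inter_eq_zero hP hP' hne
  have h2 : μ.real Q ≤ μ.real (P ∩ P') := measureReal_mono (Set.subset_inter h h')
  linarith [measureReal_cell_pos G n Q hQ]

theorem inter_eq_zero_of_not_subset (G : GoodGrid μ) {k n : ℕ} (hkn : k ≤ n) {P Q : Set I}
    (hP : P ∈ G.cells k) (hQ : Q ∈ G.cells n) (h : ¬ Q ⊆ P) : μ.real (Q ∩ P) = 0 := by
  obtain ⟨P', hP', hQP'⟩ := G.exists_ancestor hkn hQ
  have hne : P' ≠ P := fun h' => h (h' ▸ hQP')
  refine le_antisymm ?_ measureReal_nonneg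
  rw [← G.inter_eq_zero hP' hP hne]
  exact measureReal_mono (Set.inter_subset_inter_left _ hQP')

theorem measureReal_le_pow (G : GoodGrid μ) {k n : ℕ} (hkn : k ≤ n) {P Q : Set I}
    (hP : P ∈ G.cells k) (hQ : Q ∈ G.cells n) (h : Q ⊆ P) :
    μ.real Q ≤ G.upper ^ (n - k) * μ.real P := by
  induction n, hkn using Nat.le_induction generalizing Q with
  | base => rw [Nat.sub_self, pow_zero, one_mul]; exact measureReal_mono h
  | succ n hkn ih =>
    obtain ⟨R, hR, hQR⟩ := G.nested n Q hQ
    have hRP : R ⊆ P := by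
      obtain ⟨P', hP', hRP'⟩ := G.exists_ancestor hkn hR
      rwa [G.eq_of_subset hP hP' hQ h (hQR.trans hRP')]
    refine (G.le_upper_mul hR hQ hQR).trans ?_
    rw [Nat.succ_sub hkn, pow_succ', mul_assoc]
    exact mul_le_mul_of_nonneg_left (ih hR hRP) G.upper_pos.le

theorem rpow_measureReal_le (G : GoodGrid μ) {k n : ℕ} (hkn : k ≤ n) {P Q : Set I}
    (hP : P ∈ G.cells k) (hQ : Q ∈ G.cells n) (h : Q ⊆ P) {s : ℝ} (hs : 0 < s) :
    μ.real Q ^ s ≤ (G.upper ^ s) ^ (n - k) * μ.real P ^ s := by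
  refine (Real.rpow_le_rpow measureReal_nonneg (G.measureReal_le_pow hkn hP hQ h) hs.le).trans ?_
  rw [Real.mul_rpow (pow_nonneg G.upper_pos.le _) measureReal_nonneg,
    ← Real.rpow_natCast, ← Real.rpow_natCast, ← Real.rpow_mul G.upper_pos.le,
    ← Real.rpow_mul G.upper_pos.le, mul_comm s]

omit [IsProbabilityMeasure μ] in
theorem upper_rpow_nonneg (G : GoodGrid μ) (s : ℝ) : 0 ≤ G.upper ^ s :=
  Real.rpow_nonneg G.upper_pos.le _

omit [IsProbabilityMeasure μ] in
theorem upper_rpow_lt_one (G : GoodGrid μ) {s : ℝ} (hs : 0 < s) : G.upper ^ s < 1 :=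
  Real.rpow_lt_one G.upper_pos.le G.upper_lt_one hs

theorem subset_trans_cells (G : GoodGrid μ) {k m n : ℕ} (hkm : k ≤ m) {P Q R : Set I}
    (hP : P ∈ G.cells k) (hR : R ∈ G.cells m) (hQ : Q ∈ G.cells n) (hQR : Q ⊆ R) (hQP : Q ⊆ P) :
    R ⊆ P := by
  obtain ⟨P', hP', hRP'⟩ := G.exists_ancestor hkm hR
  rwa [G.eq_of_subset hP hP' hQ hQP (hQR.trans hRP')]

/-- A cell belongs to one level only. -/
theorem level_unique (G : GoodGrid μ) {k n : ℕ} {Q : Set I} (hk : Q ∈ G.cells k)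
    (hn : Q ∈ G.cells n) : k = n := by
  wlog hlt : k < n generalizing k n
  · rcases lt_trichotomy k n with h | h | h
    · exact this hk hn h
    · exact h
    · exact (this hn hk h).symm
  exfalso
  have h1 := G.measureReal_le_pow hlt.le hk hn subset_rfl
  have h2 := measureReal_cell_pos G k Q hk
  have h3 : G.upper ^ (n - k) < 1 :=
    pow_lt_one₀ G.upper_pos.le G.upper_lt_one (by omega)
  nlinarith

omit [IsProbabilityMeasure μ] in
theorem ae_good (G : GoodGrid μ) : ∀ᵐ t ∂μ, ∀ k, (∃ Q ∈ G.cells k, t ∈ Q) ∧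
    ∀ P ∈ G.cells k, ∀ Q ∈ G.cells k, t ∈ P → t ∈ Q → P = Q := by
  rw [ae_all_iff]
  intro k
  have h : ∀ᵐ t ∂μ, ∀ P ∈ G.cells k, ∀ Q ∈ G.cells k, t ∈ P → t ∈ Q → P = Q := by
    rw [Filter.eventually_all_finset]
    intro P hP
    rw [Filter.eventually_all_finset]
    intro Q hQ
    by_cases hne : P = Q
    · exact Eventually.of_forall fun _ _ _ => hne
    · have := G.aedisjoint_cells k P hP Q hQ hne
      filter_upwards [measure_eq_zero_iff_ae_notMem.1 this] with t ht h1 h2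
      exact absurd ⟨h1, h2⟩ ht
  filter_upwards [G.cover_cells k, h] with t h1 h2
  exact ⟨h1, h2⟩

/-- The cells of level `n` that are contained in `P`. -/
def cellsIn (G : GoodGrid μ) (n : ℕ) (P : Set I) : Finset (Set I) := by
  classical exact (G.cells n).filter (· ⊆ P)

omit [IsProbabilityMeasure μ] in
theorem mem_cellsIn (G : GoodGrid μ) {n : ℕ} {P Q : Set I} :
    Q ∈ G.cellsIn n P ↔ Q ∈ G.cells n ∧ Q ⊆ P := by
  classical exact Finset.mem_filter

omit [IsProbabilityMeasure μ] in
theorem indicator_ae_eq_sum (G : GoodGrid μ) {k n : ℕ} (hkn : k ≤ n) {P : Set I}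
    (hP : P ∈ G.cells k) : ∀ᵐ t ∂μ, P.indicator (fun _ => (1 : ℂ)) t =
      ∑ R ∈ G.cellsIn n P, R.indicator (fun _ => (1 : ℂ)) t := by
  classical
  filter_upwards [G.ae_good] with t ht
  obtain ⟨⟨Q, hQ, htQ⟩, huniq⟩ := ht n
  have h1 : ∀ R ∈ G.cells n, R.indicator (fun _ => (1 : ℂ)) t = if R = Q then 1 else 0 := by
    intro R hR
    by_cases h : R = Q
    · subst h; simp [htQ]
    · have : t ∉ R := fun h' => h (huniq R hR Q hQ h' htQ)
      simp [h, this]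
  rw [Finset.sum_congr rfl fun R hR => h1 R (G.mem_cellsIn.1 hR).1, Finset.sum_ite_eq']
  by_cases h : Q ⊆ P
  · rw [if_pos (G.mem_cellsIn.2 ⟨hQ, h⟩), Set.indicator_of_mem (h htQ)]
  · rw [if_neg fun h' => h (G.mem_cellsIn.1 h').2, Set.indicator_of_notMem]
    intro htP
    obtain ⟨P', hP', hQP'⟩ := G.exists_ancestor hkn hQ
    have := (ht k).2 P hP P' hP' htP (hQP' htQ)
    exact h (this ▸ hQP')

theorem sum_cellsIn (G : GoodGrid μ) {k n : ℕ} (hkn : k ≤ n) {P : Set I}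
    (hP : P ∈ G.cells k) : ∑ R ∈ G.cellsIn n P, μ.real R = μ.real P := by
  have h := integral_congr_ae (G.indicator_ae_eq_sum hkn hP)
  rw [integral_finsetSum] at h
  · simp only [integral_indicator_const (1 : ℂ) (G.measurable_cells k P hP)] at h
    rw [Finset.sum_congr rfl fun R hR => integral_indicator_const (1 : ℂ)
      (G.measurable_cells n R (G.mem_cellsIn.1 hR).1)] at h
    simp only [Complex.real_smul, mul_one] at h
    exact_mod_cast h.symm
  · intro R hR
    exact (integrable_const _).indicator (G.measurable_cells n R (G.mem_cellsIn.1 hR).1)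

theorem sum_measureReal_inter_le (G : GoodGrid μ) {k : ℕ} (A : Set I) (hA : MeasurableSet A)
    (F : Finset (Set I)) (hF : F ⊆ G.cells k) : ∑ R ∈ F, μ.real (A ∩ R) ≤ μ.real A := by
  have h : μ.real (⋃ Q ∈ F, A ∩ Q) = ∑ Q ∈ F, μ.real (A ∩ Q) := by
    simp only [Measure.real]
    rw [measure_biUnion_finset₀, ENNReal.toReal_sum fun _ _ => measure_ne_top _ _]
    · intro Q hQ R hR hQR
      exact (G.aedisjoint_cells k Q (hF hQ) R (hF hR) hQR).mono Set.inter_subset_right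
        Set.inter_subset_right
    · intro Q hQ
      exact (hA.inter (G.measurable_cells k Q (hF hQ))).nullMeasurableSet
  rw [← h]
  exact measureReal_mono (Set.iUnion₂_subset fun _ _ => Set.inter_subset_left)

theorem sum_cells (G : GoodGrid μ) (n : ℕ) : ∑ R ∈ G.cells n, μ.real R = 1 := by
  have h := G.sum_cellsIn (Nat.zero_le n) G.univ_mem_cells
  have h2 : G.cellsIn n Set.univ = G.cells n := by
    ext; simp [G.mem_cellsIn]
  rw [h2] at h
  simpa using h

theorem card_cellsIn_mul_le (G : GoodGrid μ) {k : ℕ} {P : Set I} (hP : P ∈ G.cells k) :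
    ((G.cellsIn (k + 1) P).card : ℝ) * G.lower ≤ 1 := by
  have h : ((G.cellsIn (k + 1) P).card : ℝ) * (G.lower * μ.real P) ≤ 1 * μ.real P := by
    rw [one_mul]
    conv_rhs => rw [← G.sum_cellsIn (Nat.le_succ k) hP]
    rw [← nsmul_eq_mul]
    exact Finset.card_nsmul_le_sum _ _ _ fun R hR =>
      G.lower_mul_le hP (G.mem_cellsIn.1 hR).1 (G.mem_cellsIn.1 hR).2
  rw [← mul_assoc] at h
  exact le_of_mul_le_mul_right h (measureReal_cell_pos G k P hP)

theorem exists_child (G : GoodGrid μ) {k : ℕ} {P : Set I} (hP : P ∈ G.cells k) :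
    ∃ R ∈ G.cells (k + 1), R ⊆ P := by
  by_contra! h
  have h1 : G.cellsIn (k + 1) P = ∅ := by
    ext R; simpa [G.mem_cellsIn] using h R
  have h2 := G.sum_cellsIn (Nat.le_succ k) hP
  rw [h1, Finset.sum_empty] at h2
  exact (measureReal_cell_pos G k P hP).ne h2

/-- Summing over cells of level `k` and their children is summing over cells of level `k + 1`. -/
theorem sum_cells_succ {M : Type*} [AddCommMonoid M] (G : GoodGrid μ) (k : ℕ)
    (f : Set I → M) :
    ∑ Q ∈ G.cells k, ∑ R ∈ G.cellsIn (k + 1) Q, f R = ∑ R ∈ G.cells (k + 1), f R := by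
  classical
  rw [← Finset.sum_biUnion]
  · refine Finset.sum_congr ?_ fun _ _ => rfl
    ext R
    simp only [Finset.mem_biUnion, G.mem_cellsIn]
    constructor
    · rintro ⟨_, _, h, _⟩; exact h
    · intro h
      obtain ⟨P, hP, hRP⟩ := G.nested k R h
      exact ⟨P, hP, h, hRP⟩
  · intro P hP P' hP' hne
    refine Finset.disjoint_left.2 fun R h1 h2 => hne ?_
    rw [G.mem_cellsIn] at h1 h2
    exact G.eq_of_subset hP hP' h1.1 h1.2 h2.2

/-- Every cell is an entry of a point of `Î`. -/
theorem exists_path (G : GoodGrid μ) {n : ℕ} {R : Set I} (hR : R ∈ G.cells n) :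
    ∃ x : G.Path, x.cell n = R := by
  have key : ∀ n (f : ℕ → Set I), (∀ j, f j ∈ G.cells (n + j)) → (∀ j, f (j + 1) ⊆ f j) →
      ∃ x : G.Path, ∀ j, x.cell (n + j) = f j := by
    intro n
    induction n with
    | zero =>
      intro f h1 h2
      exact ⟨⟨f, G.eq_univ_of_mem_cells_zero (h1 0), fun j => by simpa using h1 j, h2⟩,
        fun j => by rw [Nat.zero_add]⟩
    | succ n ih =>
      intro f h1 h2
      obtain ⟨P, hP, hfP⟩ := G.nested n (f 0) (h1 0)
      let g : ℕ → Set I := fun j => Nat.casesOn j P f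
      obtain ⟨x, hx⟩ := ih g
        (fun j => by
          cases j with
          | zero => exact hP
          | succ j => have := h1 j; rwa [show n + 1 + j = n + (j + 1) by ring] at this)
        (fun j => by
          cases j with
          | zero => exact hfP
          | succ j => exact h2 j)
      refine ⟨x, fun j => ?_⟩
      rw [show n + 1 + j = n + (j + 1) by ring]
      exact hx (j + 1)
  have step : ∀ j, ∀ P : {P // P ∈ G.cells (n + j)}, ∃ Q : {Q // Q ∈ G.cells (n + (j + 1))},
      Q.1 ⊆ P.1 := by
    rintro j ⟨P, hP⟩
    obtain ⟨Q, hQ, hQP⟩ := G.exists_child hP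
    exact ⟨⟨Q, hQ⟩, hQP⟩
  choose next hnext using step
  let f : ∀ j, {P // P ∈ G.cells (n + j)} := fun j => Nat.rec ⟨R, hR⟩ next j
  obtain ⟨x, hx⟩ := key n (fun j => (f j).1) (fun j => (f j).2) (fun j => hnext j (f j))
  exact ⟨x, hx 0⟩

end Grid

end GoodGrid

end

noncomputable section

section Lists

variable {α : Type*}

/-- The difference of the weighted averages of `F / w` over the two components of a pair. -/
def pairSum (w : α → ℝ) (p : List α × List α) (F : α → ℂ) : ℂ :=
  (p.1.map F).sum / (((p.1.map w).sum : ℝ) : ℂ) - (p.2.map F).sum / (((p.2.map w).sum : ℝ) : ℂ)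

theorem pairSum_congr {w : α → ℝ} {p : List α × List α} {F F' : α → ℂ}
    (h₁ : ∀ a ∈ p.1, F a = F' a) (h₂ : ∀ a ∈ p.2, F a = F' a) :
    pairSum w p F = pairSum w p F' := by
  rw [pairSum, pairSum, List.map_congr_left h₁, List.map_congr_left h₂]

theorem pairSum_const_mul (w : α → ℝ) (p : List α × List α) (c : ℂ) (F : α → ℂ) :
    pairSum w p (fun a => c * F a) = c * pairSum w p F := by
  simp only [pairSum, List.sum_map_mul_left]
  ring

theorem pairSum_add (w : α → ℝ) (p : List α × List α) (F F' : α → ℂ) :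
    pairSum w p (fun a => F a + F' a) = pairSum w p F + pairSum w p F' := by
  simp only [pairSum, List.sum_map_add]
  ring

theorem pairSum_zero (w : α → ℝ) (p : List α × List α) : pairSum w p (fun _ => 0) = 0 := by
  simp [pairSum]

theorem pairSum_finset_sum {ι : Type*} (w : α → ℝ) (p : List α × List α) (s : Finset ι)
    (F : ι → α → ℂ) :
    pairSum w p (fun a => ∑ i ∈ s, F i a) = ∑ i ∈ s, pairSum w p (F i) := by
  classical
  induction s using Finset.induction_on with
  | empty => simp [pairSum_zero]
  | insert i s hi ih => simp only [Finset.sum_insert hi, pairSum_add, ih]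

theorem pairSum_comm (w : α → ℝ) (p q : List α × List α) (K : α → α → ℂ) :
    pairSum w p (fun a => pairSum w q (K a)) =
      pairSum w q (fun x => pairSum w p fun a => K a x) := by
  have hL : ∀ (l m : List α), (l.map fun a => (m.map (K a)).sum).sum =
      (m.map fun x => (l.map fun a => K a x).sum).sum := by
    intro l m
    induction l with
    | nil => simp
    | cons a l ih => simp only [List.map_cons, List.sum_cons, List.sum_map_add, ih]
  have h1 : ∀ (l : List α) (f g : α → ℂ) (c d : ℂ), (l.map fun a => f a / c - g a / d).sum =
      (l.map f).sum / c - (l.map g).sum / d := by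
    intro l f g c d
    induction l with
    | nil => simp
    | cons a l ih => simp only [List.map_cons, List.sum_cons, ih]; ring
  simp only [pairSum, h1, hL]
  ring

theorem pairSum_weight {w : α → ℝ} {p : List α × List α} (h₁ : (p.1.map w).sum ≠ 0)
    (h₂ : (p.2.map w).sum ≠ 0) : pairSum w p (fun a => (w a : ℂ)) = 0 := by
  have h : ∀ l : List α, (l.map fun a => (w a : ℂ)).sum = (((l.map w).sum : ℝ) : ℂ) := by
    intro l
    induction l with
    | nil => simp
    | cons a l ih => simp [ih]
  rw [pairSum, h, h, div_self (by exact_mod_cast h₁), div_self (by exact_mod_cast h₂), sub_self]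

/-- The value at `a` of the Haar function of the pair `p`. -/
def haarValue (w : α → ℝ) (p : List α × List α) (a : α) : ℂ := by
  classical exact pairSum w p (fun x => if x = a then 1 else 0)

theorem haarValue_eq_zero {w : α → ℝ} {p : List α × List α} {a : α} (h₁ : a ∉ p.1)
    (h₂ : a ∉ p.2) : haarValue w p a = 0 := by
  classical
  rw [haarValue]
  refine Eq.trans ?_ (pairSum_zero w p)
  refine pairSum_congr (fun x hx => if_neg ?_) (fun x hx => if_neg ?_)
  · rintro rfl; exact h₁ hx
  · rintro rfl; exact h₂ hx

theorem sum_map_ite_eq_one {l : List α} [DecidableEq α] (hl : l.Nodup) {a : α} (ha : a ∈ l) :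
    (l.map fun x => if x = a then (1 : ℂ) else 0).sum = 1 := by
  rw [List.sum_map_ite_eq]
  simp [List.count_eq_one_of_mem hl ha]

theorem sum_map_ite_eq_zero {l : List α} [DecidableEq α] {a : α} (ha : a ∉ l) :
    (l.map fun x => if x = a then (1 : ℂ) else 0).sum = 0 := by
  rw [List.sum_map_ite_eq]
  simp [List.count_eq_zero_of_not_mem ha]

theorem haarValue_left {w : α → ℝ} {p : List α × List α} {a : α} (hp : p.1.Nodup)
    (h₁ : a ∈ p.1) (h₂ : a ∉ p.2) : haarValue w p a = 1 / (((p.1.map w).sum : ℝ) : ℂ) := by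
  classical
  rw [haarValue, pairSum]
  rw [sum_map_ite_eq_one hp h₁, sum_map_ite_eq_zero h₂]
  simp

theorem haarValue_right {w : α → ℝ} {p : List α × List α} {a : α} (hp : p.2.Nodup)
    (h₁ : a ∉ p.1) (h₂ : a ∈ p.2) : haarValue w p a = -(1 / (((p.2.map w).sum : ℝ) : ℂ)) := by
  classical
  rw [haarValue, pairSum]
  rw [sum_map_ite_eq_one hp h₂, sum_map_ite_eq_zero h₁]
  simp

theorem pairSum_haarValue_comm (w : α → ℝ) (p q : List α × List α) :
    pairSum w p (fun a => w a * haarValue w q a) =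
      pairSum w q (fun a => w a * haarValue w p a) := by
  classical
  simp only [haarValue, ← pairSum_const_mul]
  rw [pairSum_comm]
  congr 1; funext x; congr 1; funext a
  by_cases h : x = a
  · subst h; simp
  · simp [h, Ne.symm h]

theorem haarPairs_of_length {l : List α} (h : 2 ≤ l.length) :
    haarPairs l = (l.take (l.length / 2), l.drop (l.length / 2)) ::
      (haarPairs (l.take (l.length / 2)) ++ haarPairs (l.drop (l.length / 2))) := by
  rw [haarPairs, dif_pos h]

theorem haarPairs_of_length_lt {l : List α} (h : ¬ 2 ≤ l.length) : haarPairs l = [] := by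
  rw [haarPairs, dif_neg h]

theorem haarPairs_spec (l : List α) : ∀ p ∈ haarPairs l,
    (p.1 ++ p.2).Sublist l ∧ p.1 ≠ [] ∧ p.2 ≠ [] := by
  induction l using haarPairs.induct with
  | case1 l h ih1 ih2 =>
    intro p hp
    rw [haarPairs_of_length h] at hp
    simp only [List.mem_cons, List.mem_append] at hp
    rcases hp with rfl | hp | hp
    · refine ⟨by simp, ?_, ?_⟩
      · rw [← List.length_pos_iff]; simp only [List.length_take]; omega
      · rw [← List.length_pos_iff]; simp only [List.length_drop]; omega
    · exact ⟨(ih1 p hp).1.trans (List.take_sublist _ _), (ih1 p hp).2⟩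
    · exact ⟨(ih2 p hp).1.trans (List.drop_sublist _ _), (ih2 p hp).2⟩
  | case2 l h =>
    intro p hp
    simp [haarPairs_of_length_lt h] at hp

theorem haarPairs_nodup_components {l : List α} (hl : l.Nodup) {p : List α × List α}
    (hp : p ∈ haarPairs l) : p.1.Nodup ∧ p.2.Nodup ∧ ∀ a ∈ p.1, a ∉ p.2 := by
  have h := (haarPairs_spec l p hp).1.nodup hl
  rw [List.nodup_append] at h
  exact ⟨h.1, h.2.1, fun a ha hb => h.2.2 a ha a hb rfl⟩

theorem sum_map_pos {w : α → ℝ} {l : List α} (hw : ∀ a ∈ l, 0 < w a) (hl : l ≠ []) :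
    0 < (l.map w).sum := by
  refine List.sum_pos _ ?_ (by simpa using hl)
  intro x hx
  obtain ⟨a, ha, rfl⟩ := List.mem_map.1 hx
  exact hw a ha

theorem pairSum_haarValue_self {l : List α} (hl : l.Nodup) {w : α → ℝ} (hw : ∀ a ∈ l, 0 < w a)
    {p : List α × List α} (hp : p ∈ haarPairs l) :
    pairSum w p (fun a => w a * haarValue w p a) =
      ((1 / (p.1.map w).sum + 1 / (p.2.map w).sum : ℝ) : ℂ) := by
  obtain ⟨h1, h2, h3⟩ := haarPairs_nodup_components hl hp
  have hm := mem_of_mem_haarPairs l p hp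
  have hs := haarPairs_spec l p hp
  have p1 := sum_map_pos (fun a ha => hw a (hm.1 a ha)) hs.2.1
  have p2 := sum_map_pos (fun a ha => hw a (hm.2 a ha)) hs.2.2
  have h : ∀ l : List α, (l.map fun a => (w a : ℂ)).sum = (((l.map w).sum : ℝ) : ℂ) := by
    intro l
    induction l with
    | nil => simp
    | cons a l ih => simp [ih]
  rw [pairSum, List.map_congr_left (fun a ha => by rw [haarValue_left h1 ha (h3 a ha)]),
    List.map_congr_left (l := p.2)
      (fun a ha => by rw [haarValue_right h2 (fun h' => h3 a h' ha) ha]),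
    List.sum_map_mul_right, List.sum_map_mul_right, h, h]
  have p1' : (((p.1.map w).sum : ℝ) : ℂ) ≠ 0 := by exact_mod_cast p1.ne'
  have p2' : (((p.2.map w).sum : ℝ) : ℂ) ≠ 0 := by exact_mod_cast p2.ne'
  push_cast
  field_simp
  ring

theorem haarPairs_pairwise (l : List α) (hl : l.Nodup) {w : α → ℝ} (hw : ∀ a ∈ l, 0 < w a) :
    (haarPairs l).Pairwise fun p q => pairSum w q (fun a => w a * haarValue w p a) = 0 := by
  induction l using haarPairs.induct with
  | case1 l h ih1 ih2 =>
    rw [haarPairs_of_length h]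
    have hnd : (l.take (l.length / 2)).Nodup ∧ (l.drop (l.length / 2)).Nodup ∧
        ∀ a ∈ l.take (l.length / 2), a ∉ l.drop (l.length / 2) := by
      have := hl
      rw [← List.take_append_drop (l.length / 2) l, List.nodup_append] at this
      exact ⟨this.1, this.2.1, fun a ha hb => this.2.2 a ha a hb rfl⟩
    have hw1 : ∀ a ∈ l.take (l.length / 2), 0 < w a := fun a ha => hw a (List.mem_of_mem_take ha)
    have hw2 : ∀ a ∈ l.drop (l.length / 2), 0 < w a := fun a ha => hw a (List.mem_of_mem_drop ha)
    have hmass : ∀ {l' : List α} {q}, (∀ a ∈ l', 0 < w a) → q ∈ haarPairs l' →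
        (q.1.map w).sum ≠ 0 ∧ (q.2.map w).sum ≠ 0 := by
      intro l' q hw' hq
      have hm := mem_of_mem_haarPairs l' q hq
      have hs := haarPairs_spec l' q hq
      exact ⟨(sum_map_pos (fun a ha => hw' a (hm.1 a ha)) hs.2.1).ne',
        (sum_map_pos (fun a ha => hw' a (hm.2 a ha)) hs.2.2).ne'⟩
    refine List.pairwise_cons.2 ⟨?_, List.pairwise_append.2
      ⟨ih1 hnd.1 hw1, ih2 hnd.2.1 hw2, ?_⟩⟩
    · intro q hq
      rcases List.mem_append.1 hq with hq | hq
      · have hm := mem_of_mem_haarPairs _ q hq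
        have hc := hmass hw1 hq
        have hv : ∀ a ∈ l.take (l.length / 2), (w a : ℂ) * haarValue w
            (l.take (l.length / 2), l.drop (l.length / 2)) a =
            1 / ((((l.take (l.length / 2)).map w).sum : ℝ) : ℂ) * w a := by
          intro a ha
          rw [haarValue_left hnd.1 ha (hnd.2.2 a ha), mul_comm]
        rw [pairSum_congr (fun a ha => hv a (hm.1 a ha)) (fun a ha => hv a (hm.2 a ha)),
          pairSum_const_mul, pairSum_weight hc.1 hc.2, mul_zero]
      · have hm := mem_of_mem_haarPairs _ q hq
        have hc := hmass hw2 hq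
        have hv : ∀ a ∈ l.drop (l.length / 2), (w a : ℂ) * haarValue w
            (l.take (l.length / 2), l.drop (l.length / 2)) a =
            -(1 / ((((l.drop (l.length / 2)).map w).sum : ℝ) : ℂ)) * w a := by
          intro a ha
          rw [haarValue_right hnd.2.1 (fun h' => hnd.2.2 a h' ha) ha, mul_comm]
        rw [pairSum_congr (fun a ha => hv a (hm.1 a ha)) (fun a ha => hv a (hm.2 a ha)),
          pairSum_const_mul, pairSum_weight hc.1 hc.2, mul_zero]
    · intro p hp q hq
      have hmp := mem_of_mem_haarPairs _ p hp
      have hmq := mem_of_mem_haarPairs _ q hq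
      rw [← pairSum_zero w q]
      have hv : ∀ a ∈ l.drop (l.length / 2), (w a : ℂ) * haarValue w p a = 0 := by
        intro a ha
        rw [haarValue_eq_zero (fun h' => hnd.2.2 a (hmp.1 a h') ha)
          (fun h' => hnd.2.2 a (hmp.2 a h') ha), mul_zero]
      exact pairSum_congr (fun a ha => hv a (hmq.1 a ha)) (fun a ha => hv a (hmq.2 a ha))
  | case2 l h => simp [haarPairs_of_length_lt h]

theorem haarPairs_nodup {l : List α} (hl : l.Nodup) : (haarPairs l).Nodup := by
  refine List.Pairwise.imp_of_mem ?_ (haarPairs_pairwise l hl (w := fun _ => 1) (by simp))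
  rintro p q hp - h rfl
  rw [pairSum_haarValue_self hl (by simp) hp] at h
  have hs := haarPairs_spec l p hp
  have p1 := sum_map_pos (w := fun _ : α => (1 : ℝ)) (by simp) hs.2.1
  have p2 := sum_map_pos (w := fun _ : α => (1 : ℝ)) (by simp) hs.2.2
  have h' : (1 / (p.1.map fun _ => (1 : ℝ)).sum + 1 / (p.2.map fun _ => (1 : ℝ)).sum : ℝ) = 0 := by
    exact_mod_cast h
  have : 0 < (1 / (p.1.map fun _ => (1 : ℝ)).sum + 1 / (p.2.map fun _ => (1 : ℝ)).sum : ℝ) := by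
    positivity
  exact this.ne' h'

theorem pairSum_haarValue_of_ne {l : List α} (hl : l.Nodup) {w : α → ℝ} (hw : ∀ a ∈ l, 0 < w a)
    {p q : List α × List α} (hp : p ∈ haarPairs l) (hq : q ∈ haarPairs l) (hne : p ≠ q) :
    pairSum w q (fun a => w a * haarValue w p a) = 0 := by
  have : Std.Symm fun p q : List α × List α =>
      pairSum w q (fun a => w a * haarValue w p a) = 0 :=
    ⟨fun p q h => by rwa [pairSum_haarValue_comm]⟩
  exact (haarPairs_pairwise l hl hw).forall hp hq hne

end Lists

end

noncomputable section

namespace GoodGrid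

section HaarIntegrals

variable {I : Type*} [MeasurableSpace I] {μ : Measure I} {G : GoodGrid μ} {o : G.ChildOrder}

theorem HaarIndex.cell_mem (i : HaarIndex o) : i.cell ∈ G.cells i.1 := i.2.1.2

theorem HaarIndex.pair_mem (i : HaarIndex o) : i.2.2.1 ∈ haarPairs (o.children i.1 i.cell) :=
  i.2.2.2

theorem HaarIndex.nodup_children (i : HaarIndex o) : (o.children i.1 i.cell).Nodup :=
  o.nodup i.1 i.cell i.cell_mem

theorem HaarIndex.mem_left {i : HaarIndex o} {P : Set I} (h : P ∈ i.left) :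
    P ∈ G.cells (i.1 + 1) ∧ P ⊆ i.cell :=
  (o.mem_children i.1 i.cell i.cell_mem P).1 ((mem_of_mem_haarPairs _ _ i.pair_mem).1 P h)

theorem HaarIndex.mem_right {i : HaarIndex o} {P : Set I} (h : P ∈ i.right) :
    P ∈ G.cells (i.1 + 1) ∧ P ⊆ i.cell :=
  (o.mem_children i.1 i.cell i.cell_mem P).1 ((mem_of_mem_haarPairs _ _ i.pair_mem).2 P h)

theorem HaarIndex.nodup_left (i : HaarIndex o) : i.left.Nodup :=
  (haarPairs_nodup_components i.nodup_children i.pair_mem).1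

theorem HaarIndex.nodup_right (i : HaarIndex o) : i.right.Nodup :=
  (haarPairs_nodup_components i.nodup_children i.pair_mem).2.1

/-- The difference of the weighted averages of a function on cells over the two components. -/
def HaarIndex.diff (i : HaarIndex o) (F : Set I → ℂ) : ℂ := pairSum μ.real i.2.2.1 F

theorem HaarIndex.diff_congr {i : HaarIndex o} {F F' : Set I → ℂ}
    (h : ∀ P ∈ G.cells (i.1 + 1), P ⊆ i.cell → F P = F' P) : i.diff F = i.diff F' :=
  pairSum_congr (fun P hP => h P (i.mem_left hP).1 (i.mem_left hP).2)
    (fun P hP => h P (i.mem_right hP).1 (i.mem_right hP).2)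

theorem HaarIndex.diff_eq_zero {i : HaarIndex o} {F : Set I → ℂ}
    (h : ∀ P ∈ G.cells (i.1 + 1), P ⊆ i.cell → F P = 0) : i.diff F = 0 :=
  (i.diff_congr h).trans (pairSum_zero _ _)

theorem integrable_mul_indicator_sum {f : I → ℂ} (hf : Integrable f μ) (S : List (Set I))
    (hS : ∀ P ∈ S, MeasurableSet P) :
    Integrable (fun t => f t * (S.map fun P => P.indicator (fun _ => (1 : ℂ)) t).sum) μ ∧
    ∫ t, f t * (S.map fun P => P.indicator (fun _ => (1 : ℂ)) t).sum ∂μ =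
      (S.map fun P => ∫ t in P, f t ∂μ).sum := by
  induction S with
  | nil => simp
  | cons P S ih =>
    obtain ⟨h1, h2⟩ := ih fun R hR => hS R (by simp [hR])
    have hP : MeasurableSet P := hS P (by simp)
    have hf' : (fun t => f t * P.indicator (fun _ => (1 : ℂ)) t) = P.indicator f := by
      funext t
      by_cases ht : t ∈ P <;> simp [ht]
    have h3 : Integrable (fun t => f t * P.indicator (fun _ => (1 : ℂ)) t) μ := by
      rw [hf']; exact hf.indicator hP
    simp only [List.map_cons, List.sum_cons, mul_add]
    refine ⟨h3.add h1, ?_⟩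
    rw [integral_add h3 h1, h2, hf', integral_indicator hP]

theorem integrable_mul_familyDensity {f : I → ℂ} (hf : Integrable f μ) (S : List (Set I))
    (hS : ∀ P ∈ S, MeasurableSet P) :
    Integrable (fun t => f t * familyDensity μ S t) μ ∧
    ∫ t, f t * familyDensity μ S t ∂μ =
      (S.map fun P => ∫ t in P, f t ∂μ).sum / (((S.map μ.real).sum : ℝ) : ℂ) := by
  obtain ⟨h1, h2⟩ := integrable_mul_indicator_sum hf S hS
  simp only [familyDensity, ← mul_div_assoc]
  exact ⟨h1.div_const _, by rw [integral_div, h2]⟩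

theorem integrable_mul_haar {f : I → ℂ} (hf : Integrable f μ) (i : HaarIndex o) :
    Integrable (fun t => f t * haar i t) μ := by
  simp only [haar, mul_sub]
  exact (integrable_mul_familyDensity hf _ i.measurableSet_left).1.sub
    (integrable_mul_familyDensity hf _ i.measurableSet_right).1

theorem integral_mul_haar {f : I → ℂ} (hf : Integrable f μ) (i : HaarIndex o) :
    ∫ t, f t * haar i t ∂μ = i.diff fun P => ∫ t in P, f t ∂μ := by
  simp only [haar, mul_sub]
  rw [integral_sub (integrable_mul_familyDensity hf _ i.measurableSet_left).1
    (integrable_mul_familyDensity hf _ i.measurableSet_right).1,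
    (integrable_mul_familyDensity hf _ i.measurableSet_left).2,
    (integrable_mul_familyDensity hf _ i.measurableSet_right).2]
  rfl

variable [IsProbabilityMeasure μ]

theorem integrable_haar (i : HaarIndex o) : Integrable (haar i) μ := by
  simpa using integrable_mul_haar (integrable_const (1 : ℂ)) i

theorem setIntegral_haar (i : HaarIndex o) {A : Set I} (hA : MeasurableSet A) :
    ∫ t in A, haar i t ∂μ = i.diff fun P => (μ.real (A ∩ P) : ℂ) := by
  have h : ∫ t in A, haar i t ∂μ = ∫ t, A.indicator (fun _ => (1 : ℂ)) t * haar i t ∂μ := by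
    rw [← integral_indicator hA]
    congr 1; funext t
    by_cases ht : t ∈ A <;> simp [ht]
  rw [h, integral_mul_haar ((integrable_const _).indicator hA)]
  congr 1; funext P
  rw [setIntegral_indicator hA, Set.inter_comm]
  simp

theorem HaarIndex.cell_pos (i : HaarIndex o) : 0 < μ.real i.cell :=
  measureReal_cell_pos G _ _ i.cell_mem

theorem sum_map_real_le {k : ℕ} {S : List (Set I)} (hS : S.Nodup) (hc : ∀ P ∈ S, P ∈ G.cells k)
    {A : Set I} (hA : MeasurableSet A) : (S.map fun P => μ.real (A ∩ P)).sum ≤ μ.real A := by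
  classical
  rw [← List.sum_toFinset _ hS]
  exact G.sum_measureReal_inter_le A hA S.toFinset fun P hP => hc P (by simpa using hP)

omit [IsProbabilityMeasure μ] in
theorem le_sum_map_real {k : ℕ} {Q : Set I} (hQ : Q ∈ G.cells k) {S : List (Set I)}
    (hS : S ≠ []) (hc : ∀ P ∈ S, P ∈ G.cells (k + 1) ∧ P ⊆ Q) :
    G.lower * μ.real Q ≤ (S.map μ.real).sum := by
  obtain ⟨P, S, rfl⟩ := List.exists_cons_of_ne_nil hS
  rw [List.map_cons, List.sum_cons]
  have h0 : 0 ≤ (S.map μ.real).sum := List.sum_nonneg (by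
    intro x hx
    obtain ⟨R, _, rfl⟩ := List.mem_map.1 hx
    exact measureReal_nonneg)
  have := G.lower_mul_le hQ (hc P (by simp)).1 (hc P (by simp)).2
  linarith

omit [IsProbabilityMeasure μ] in
theorem HaarIndex.le_mass_left (i : HaarIndex o) :
    G.lower * μ.real i.cell ≤ (i.left.map μ.real).sum :=
  le_sum_map_real i.cell_mem (haarPairs_spec _ _ i.pair_mem).2.1 fun _ h => i.mem_left h

omit [IsProbabilityMeasure μ] in
theorem HaarIndex.le_mass_right (i : HaarIndex o) :
    G.lower * μ.real i.cell ≤ (i.right.map μ.real).sum :=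
  le_sum_map_real i.cell_mem (haarPairs_spec _ _ i.pair_mem).2.2 fun _ h => i.mem_right h

theorem HaarIndex.lower_mul_pos (i : HaarIndex o) : 0 < G.lower * μ.real i.cell :=
  mul_pos G.lower_pos i.cell_pos

theorem HaarIndex.mass_left_le (i : HaarIndex o) : (i.left.map μ.real).sum ≤ μ.real i.cell := by
  refine le_trans (le_of_eq ?_) (sum_map_real_le i.nodup_left (fun P h => (i.mem_left h).1)
    (G.measurable_cells _ _ i.cell_mem))
  refine congrArg _ (List.map_congr_left fun P h => ?_)
  rw [Set.inter_eq_right.2 (i.mem_left h).2]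

theorem HaarIndex.mass_left_pos (i : HaarIndex o) : 0 < (i.left.map μ.real).sum :=
  i.lower_mul_pos.trans_le i.le_mass_left

theorem HaarIndex.mass_right_pos (i : HaarIndex o) : 0 < (i.right.map μ.real).sum :=
  i.lower_mul_pos.trans_le i.le_mass_right

theorem HaarIndex.diff_const_mul_real (i : HaarIndex o) (c : ℂ) :
    i.diff (fun P => c * μ.real P) = 0 := by
  rw [HaarIndex.diff, pairSum_const_mul,
    pairSum_weight i.mass_left_pos.ne' i.mass_right_pos.ne', mul_zero]

/-- The square of the norm of the Haar function of a pair in `L²`. -/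
def HaarIndex.energy (i : HaarIndex o) : ℝ :=
  1 / (i.left.map μ.real).sum + 1 / (i.right.map μ.real).sum

theorem HaarIndex.energy_pos (i : HaarIndex o) : 0 < i.energy :=
  add_pos (one_div_pos.2 i.mass_left_pos) (one_div_pos.2 i.mass_right_pos)

theorem HaarIndex.one_le_energy (i : HaarIndex o) : 1 ≤ μ.real i.cell * i.energy := by
  have h1 : 1 / μ.real i.cell ≤ 1 / (i.left.map μ.real).sum :=
    one_div_le_one_div_of_le i.mass_left_pos i.mass_left_le
  have h2 : 0 < 1 / (i.right.map μ.real).sum := one_div_pos.2 i.mass_right_pos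
  calc (1 : ℝ) = μ.real i.cell * (1 / μ.real i.cell) := by
        rw [mul_one_div_cancel i.cell_pos.ne']
    _ ≤ _ := mul_le_mul_of_nonneg_left (by rw [HaarIndex.energy]; linarith) i.cell_pos.le

theorem HaarIndex.energy_le (i : HaarIndex o) :
    μ.real i.cell * i.energy ≤ 2 / G.lower := by
  have h1 := one_div_le_one_div_of_le i.lower_mul_pos i.le_mass_left
  have h2 := one_div_le_one_div_of_le i.lower_mul_pos i.le_mass_right
  calc μ.real i.cell * i.energy ≤
      μ.real i.cell * (1 / (G.lower * μ.real i.cell) + 1 / (G.lower * μ.real i.cell)) :=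
        mul_le_mul_of_nonneg_left (by rw [HaarIndex.energy]; linarith) i.cell_pos.le
    _ = 2 / G.lower := by
      have := i.cell_pos.ne'
      have := G.lower_pos.ne'
      field_simp
      norm_num

theorem norm_setIntegral_haar_le (i : HaarIndex o) {A : Set I} (hA : MeasurableSet A) :
    ‖∫ t in A, haar i t ∂μ‖ ≤ μ.real A / (G.lower * μ.real i.cell) := by
  have hc : ∀ l : List (Set I), (l.map fun P => (μ.real (A ∩ P) : ℂ)).sum =
      (((l.map fun P => μ.real (A ∩ P)).sum : ℝ) : ℂ) := by
    intro l
    induction l with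
    | nil => simp
    | cons a l ih => simp [ih]
  have hn : ∀ l : List (Set I), 0 ≤ (l.map fun P => μ.real (A ∩ P)).sum := fun l =>
    List.sum_nonneg (by
      intro x hx
      obtain ⟨R, _, rfl⟩ := List.mem_map.1 hx
      exact measureReal_nonneg)
  have h1 : (i.left.map fun P => μ.real (A ∩ P)).sum / (i.left.map μ.real).sum ≤
      μ.real A / (G.lower * μ.real i.cell) :=
    div_le_div₀ measureReal_nonneg
      (sum_map_real_le i.nodup_left (fun P h => (i.mem_left h).1) hA) i.lower_mul_pos i.le_mass_left
  have h2 : (i.right.map fun P => μ.real (A ∩ P)).sum / (i.right.map μ.real).sum ≤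
      μ.real A / (G.lower * μ.real i.cell) :=
    div_le_div₀ measureReal_nonneg
      (sum_map_real_le i.nodup_right (fun P h => (i.mem_right h).1) hA) i.lower_mul_pos
      i.le_mass_right
  have h3 := div_nonneg (hn i.left) i.mass_left_pos.le
  have h4 := div_nonneg (hn i.right) i.mass_right_pos.le
  rw [setIntegral_haar i hA]
  have : (i.diff fun P => (μ.real (A ∩ P) : ℂ)) =
      (((i.left.map fun P => μ.real (A ∩ P)).sum / (i.left.map μ.real).sum -
        (i.right.map fun P => μ.real (A ∩ P)).sum / (i.right.map μ.real).sum : ℝ) : ℂ) := by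
    push_cast [HaarIndex.diff, pairSum, ← hc]
    rfl
  rw [this, Complex.norm_real, Real.norm_eq_abs, abs_le]
  constructor <;> linarith

theorem setIntegral_haar_of_le {n : ℕ} {P : Set I} (hP : P ∈ G.cells n) (i : HaarIndex o)
    (hn : n ≤ i.1) : ∫ t in P, haar i t ∂μ = 0 := by
  rw [setIntegral_haar i (G.measurable_cells n P hP)]
  by_cases h : i.cell ⊆ P
  · rw [← i.diff_const_mul_real 1]
    refine i.diff_congr fun R _ hR => ?_
    rw [Set.inter_eq_right.2 (hR.trans h), one_mul]
  · refine i.diff_eq_zero fun R _ hR => ?_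
    have h1 := G.inter_eq_zero_of_not_subset hn hP i.cell_mem h
    have h2 : μ.real (P ∩ R) ≤ μ.real (i.cell ∩ P) :=
      measureReal_mono fun t ht => ⟨hR ht.2, ht.1⟩
    rw [h1] at h2
    exact_mod_cast le_antisymm h2 measureReal_nonneg

theorem setIntegral_haar_of_not_subset {n : ℕ} {P : Set I} (hP : P ∈ G.cells n) (i : HaarIndex o)
    (hn : i.1 ≤ n) (h : ¬ P ⊆ i.cell) : ∫ t in P, haar i t ∂μ = 0 := by
  rw [setIntegral_haar i (G.measurable_cells n P hP)]
  refine i.diff_eq_zero fun R _ hR => ?_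
  have h1 := G.inter_eq_zero_of_not_subset hn i.cell_mem hP h
  have h2 : μ.real (P ∩ R) ≤ μ.real (P ∩ i.cell) :=
    measureReal_mono fun t ht => ⟨ht.1, hR ht.2⟩
  rw [h1] at h2
  exact_mod_cast le_antisymm h2 measureReal_nonneg

/-- A Haar function is constant on the cells of the levels above its own. -/
theorem mul_setIntegral_haar {n n' : ℕ} {P P' : Set I} (hP : P ∈ G.cells n)
    (hP' : P' ∈ G.cells n') (hsub : P' ⊆ P) (hnn : n ≤ n') (i : HaarIndex o) (hn : i.1 < n) :
    (μ.real P : ℂ) * ∫ t in P', haar i t ∂μ = μ.real P' * ∫ t in P, haar i t ∂μ := by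
  rw [setIntegral_haar i (G.measurable_cells _ _ hP),
    setIntegral_haar i (G.measurable_cells _ _ hP'), HaarIndex.diff, HaarIndex.diff,
    ← pairSum_const_mul, ← pairSum_const_mul]
  refine i.diff_congr fun R hR _ => ?_
  by_cases h : P ⊆ R
  · rw [Set.inter_eq_left.2 h, Set.inter_eq_left.2 (hsub.trans h), mul_comm]
  · have h' : ¬ P' ⊆ R := fun h' => h (G.subset_trans_cells hn hR hP hP' hsub h')
    rw [G.inter_eq_zero_of_not_subset hn hR hP h,
      G.inter_eq_zero_of_not_subset (Nat.le_trans hn hnn) hR hP' h']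
    simp

theorem setIntegral_haar_of_mem_level (i : HaarIndex o) {P : Set I}
    (hP : P ∈ G.cells (i.1 + 1)) :
    ∫ t in P, haar i t ∂μ = μ.real P * haarValue μ.real i.2.2.1 P := by
  classical
  rw [setIntegral_haar i (G.measurable_cells _ _ hP), haarValue, ← pairSum_const_mul]
  refine i.diff_congr fun R hR _ => ?_
  by_cases h : R = P
  · simp [h]
  · rw [G.inter_eq_zero hP hR (Ne.symm h)]
    simp [h]

theorem diff_setIntegral_haar_self (i : HaarIndex o) :
    (i.diff fun P => ∫ t in P, haar i t ∂μ) = i.energy := by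
  rw [i.diff_congr fun P hP _ => setIntegral_haar_of_mem_level i hP]
  exact pairSum_haarValue_self i.nodup_children (fun P hP => measureReal_cell_pos G (i.1 + 1) P
    ((o.mem_children i.1 i.cell i.cell_mem P).1 hP).1) i.pair_mem

theorem diff_setIntegral_haar_of_ne {i j : HaarIndex o} (hle : i.1 ≤ j.1) (hne : i ≠ j) :
    (j.diff fun P => ∫ t in P, haar i t ∂μ) = 0 := by
  rcases hle.lt_or_eq with hlt | heq
  · have hQ := (measureReal_cell_pos G _ _ j.cell_mem).ne'
    rw [← j.diff_const_mul_real ((∫ t in j.cell, haar i t ∂μ) / μ.real j.cell)]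
    refine j.diff_congr fun P hP hPj => ?_
    have := mul_setIntegral_haar j.cell_mem hP hPj (Nat.le_succ _) i hlt
    rw [div_mul_eq_mul_div, eq_div_iff (by exact_mod_cast hQ), mul_comm, this, mul_comm]
  · obtain ⟨k, ⟨Q, hQ⟩, ⟨p, hp⟩⟩ := i
    obtain ⟨k', ⟨Q', hQ'⟩, ⟨p', hp'⟩⟩ := j
    obtain rfl : k = k' := heq
    by_cases hQQ : Q = Q'
    · subst hQQ
      have hpp : p ≠ p' := by
        rintro rfl
        exact hne rfl
      refine (HaarIndex.diff_congr (i := ⟨k, ⟨⟨Q, hQ'⟩, ⟨p', hp'⟩⟩⟩) fun P hP _ =>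
        setIntegral_haar_of_mem_level (o := o) ⟨k, ⟨⟨Q, hQ⟩, ⟨p, hp⟩⟩⟩ hP).trans ?_
      exact pairSum_haarValue_of_ne (o.nodup k Q hQ) (fun P hP => measureReal_cell_pos G (k + 1) P
        ((o.mem_children k Q hQ P).1 hP).1) hp hp' hpp
    · refine HaarIndex.diff_eq_zero fun P hP hPQ' => ?_
      refine setIntegral_haar_of_not_subset hP _ (Nat.le_succ k) fun hPQ => hQQ ?_
      exact G.eq_of_subset hQ hQ' hP hPQ hPQ'

end HaarIntegrals

end GoodGrid

end

noncomputable section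

namespace GoodGrid

section Levels

variable {I : Type*} [MeasurableSpace I] {μ : Measure I} {G : GoodGrid μ}

/-- The pairs of the levels below `N`. -/
def levels (o : G.ChildOrder) (N : ℕ) : Finset (HaarIndex o) :=
  (Finset.range N).sigma fun _ => Finset.univ

theorem mem_levels {o : G.ChildOrder} {N : ℕ} {i : HaarIndex o} : i ∈ levels o N ↔ i.1 < N := by
  obtain ⟨k, i⟩ := i
  rw [levels]
  exact Finset.mem_sigma.trans (by simp)

theorem sum_levels {M : Type*} [AddCommMonoid M] (o : G.ChildOrder) (N : ℕ)
    (f : HaarIndex o → M) :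
    ∑ i ∈ levels o N, f i = ∑ k ∈ Finset.range N, ∑ i : LevelPair o k, f ⟨k, i⟩ :=
  Finset.sum_sigma _ _ _

theorem levels_zero (o : G.ChildOrder) : levels o 0 = ∅ :=
  Finset.eq_empty_of_forall_notMem fun _ h => Nat.not_lt_zero _ (mem_levels.1 h)

theorem tendsto_levels (o : G.ChildOrder) : Tendsto (levels o) atTop atTop := by
  refine tendsto_atTop_finset_of_monotone ?_ fun i => ⟨i.1 + 1, mem_levels.2 (Nat.lt_succ_self _)⟩
  intro N M h i hi
  exact mem_levels.2 ((mem_levels.1 hi).trans_le h)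

theorem exists_subset_levels {o : G.ChildOrder} (F : Finset (HaarIndex o)) :
    ∃ N, F ⊆ levels o N :=
  ((tendsto_levels o).eventually (eventually_ge_atTop F)).exists

end Levels

section Coefficients

variable {I : Type*} [MeasurableSpace I] {μ : Measure I} {G : GoodGrid μ} {o : G.ChildOrder}
  {s : ℝ} {hs : 0 < s} [IsProbabilityMeasure μ]

/-- The factor `|Q|^{1+s}` of a pair. -/
def HaarIndex.weight (s : ℝ) (i : HaarIndex o) : ℝ := μ.real i.cell ^ (1 + s)

theorem HaarIndex.weight_pos (s : ℝ) (i : HaarIndex o) : 0 < i.weight s :=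
  Real.rpow_pos_of_pos i.cell_pos _

theorem HaarIndex.weight_eq (s : ℝ) (i : HaarIndex o) :
    i.weight s = μ.real i.cell * μ.real i.cell ^ s := by
  rw [HaarIndex.weight, Real.rpow_add i.cell_pos, Real.rpow_one]

omit [IsProbabilityMeasure μ] in
theorem haarPartialSum_eq (o : G.ChildOrder) (s : ℝ) (c₀ : ℂ) (c : HaarIndex o → ℂ) (N : ℕ)
    (t : I) : haarPartialSum o s c₀ c N t =
      c₀ + ∑ i ∈ levels o N, (i.weight s : ℂ) * c i * haar i t := by
  rw [sum_levels]; rfl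

theorem integrable_haarPartialSum (o : G.ChildOrder) (s : ℝ) (c₀ : ℂ) (c : HaarIndex o → ℂ)
    (N : ℕ) : Integrable (haarPartialSum o s c₀ c N) μ := by
  have : haarPartialSum o s c₀ c N = fun t => c₀ + ∑ i ∈ levels o N,
      (i.weight s : ℂ) * c i * haar i t := funext fun t => haarPartialSum_eq o s c₀ c N t
  rw [this]
  exact (integrable_const _).add
    (integrable_finsetSum _ fun i _ => (integrable_haar i).const_mul _)

theorem setIntegral_haarPartialSum (o : G.ChildOrder) (s : ℝ) (c₀ : ℂ) (c : HaarIndex o → ℂ)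
    (N : ℕ) (A : Set I) : ∫ t in A, haarPartialSum o s c₀ c N t ∂μ =
      c₀ * μ.real A + ∑ i ∈ levels o N, (i.weight s : ℂ) * c i * ∫ t in A, haar i t ∂μ := by
  simp only [haarPartialSum_eq]
  rw [integral_add (integrable_const _).integrableOn
    (integrable_finsetSum _ fun i _ => (integrable_haar i).const_mul _).integrableOn,
    integral_finsetSum _ fun i _ => ((integrable_haar i).const_mul _).integrableOn]
  simp only [integral_const_mul]
  simp [mul_comm]

theorem tendsto_setIntegral {ψ : Lp ℂ ∞ μ} {f : ℕ → I → ℂ} (hf : ∀ N, Integrable (f N) μ)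
    (h : Tendsto (fun N => eLpNorm (fun t => ψ t - f N t) ∞ μ) atTop (𝓝 0)) (A : Set I) :
    Tendsto (fun N => ∫ t in A, f N t ∂μ) atTop (𝓝 (∫ t in A, ψ t ∂μ)) := by
  have hψ : Integrable ψ μ := (Lp.memLp ψ).integrable le_top
  refine tendsto_setIntegral_of_L1' _ hψ.1 (Eventually.of_forall hf) ?_ A
  refine tendsto_of_tendsto_of_tendsto_of_le_of_le tendsto_const_nhds h (fun _ => zero_le)
    fun N => ?_
  rw [eLpNorm_sub_comm]
  exact eLpNorm_le_eLpNorm_of_exponent_le le_top (hψ.1.sub (hf N).1)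

theorem IsHaarRep.setIntegral_cell {c₀ : ℂ} {c : HaarIndex o → ℂ} {ψ : Lp ℂ ∞ μ}
    (h : IsHaarRep o s c₀ c ψ) {n : ℕ} {P : Set I} (hP : P ∈ G.cells n) :
    ∫ t in P, ψ t ∂μ = c₀ * μ.real P +
      ∑ i ∈ levels o n, (i.weight s : ℂ) * c i * ∫ t in P, haar i t ∂μ := by
  refine tendsto_nhds_unique (tendsto_setIntegral (integrable_haarPartialSum o s c₀ c) h.2 P) ?_
  refine tendsto_const_nhds.congr' ?_
  filter_upwards [eventually_ge_atTop n] with N hN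
  rw [setIntegral_haarPartialSum]
  congr 1
  refine Finset.sum_subset (fun i hi => mem_levels.2 ((mem_levels.1 hi).trans_le hN))
    fun i _ hi => ?_
  rw [setIntegral_haar_of_le hP i (not_lt.1 fun h' => hi (mem_levels.2 h')), mul_zero]

theorem IsHaarRep.eq_integral {c₀ : ℂ} {c : HaarIndex o → ℂ} {ψ : Lp ℂ ∞ μ}
    (h : IsHaarRep o s c₀ c ψ) : c₀ = ∫ t in Set.univ, ψ t ∂μ := by
  rw [h.setIntegral_cell G.univ_mem_cells, levels_zero]
  simp

theorem IsHaarRep.diff_setIntegral {c₀ : ℂ} {c : HaarIndex o → ℂ} {ψ : Lp ℂ ∞ μ}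
    (h : IsHaarRep o s c₀ c ψ) (j : HaarIndex o) :
    (j.diff fun P => ∫ t in P, ψ t ∂μ) = (j.weight s * j.energy : ℝ) * c j := by
  classical
  rw [j.diff_congr fun P hP _ => h.setIntegral_cell hP, HaarIndex.diff, pairSum_add,
    ← HaarIndex.diff, j.diff_const_mul_real, zero_add, pairSum_finset_sum,
    Finset.sum_eq_single j]
  · rw [pairSum_const_mul]
    have := diff_setIntegral_haar_self j
    rw [HaarIndex.diff] at this
    rw [this]
    push_cast
    ring
  · intro i hi hne
    rw [pairSum_const_mul]
    have := diff_setIntegral_haar_of_ne (Nat.lt_succ_iff.1 (mem_levels.1 hi)) hne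
    rw [HaarIndex.diff] at this
    rw [this, mul_zero]
  · intro h
    exact absurd (mem_levels.2 (Nat.lt_succ_self _)) h

namespace BesovInf

theorem setIntegralFunctional_apply (A : Set I) (ψ : BesovInf o hs) :
    setIntegralFunctional o hs A ψ = ∫ t in A, toLp o hs ψ t ∂μ := rfl

/-- The coefficient of the constant function. -/
def constCoeff (o : G.ChildOrder) {s : ℝ} (hs : 0 < s) : StrongDual ℂ (BesovInf o hs) :=
  setIntegralFunctional o hs Set.univ

/-- The coefficient of a Haar function. -/
def coeff (hs : 0 < s) (i : HaarIndex o) : StrongDual ℂ (BesovInf o hs) :=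
  ((i.weight s * i.energy : ℝ) : ℂ)⁻¹ •
    ((((i.left.map μ.real).sum : ℝ) : ℂ)⁻¹ • (i.left.map (setIntegralFunctional o hs)).sum -
     (((i.right.map μ.real).sum : ℝ) : ℂ)⁻¹ • (i.right.map (setIntegralFunctional o hs)).sum)

theorem weight_mul_energy_pos (i : HaarIndex o) : 0 < i.weight s * i.energy :=
  mul_pos (i.weight_pos s) i.energy_pos

theorem coeff_apply (i : HaarIndex o) (ψ : BesovInf o hs) :
    coeff hs i ψ = ((i.weight s * i.energy : ℝ) : ℂ)⁻¹ *
      i.diff fun P => ∫ t in P, toLp o hs ψ t ∂μ := by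
  have h : ∀ l : List (Set I), (l.map (setIntegralFunctional o hs)).sum ψ =
      (l.map fun P => ∫ t in P, toLp o hs ψ t ∂μ).sum := by
    intro l
    induction l with
    | nil => simp
    | cons P l ih =>
      simp only [List.map_cons, List.sum_cons, ← ih]
      rfl
  simp only [coeff, HaarIndex.diff, pairSum]
  rw [_root_.smul_apply, _root_.sub_apply,
    _root_.smul_apply, _root_.smul_apply, h, h]
  simp only [smul_eq_mul, div_eq_inv_mul]
  rfl

theorem coeff_eq {ψ : BesovInf o hs} {c₀ : ℂ} {c : HaarIndex o → ℂ}
    (h : IsHaarRep o s c₀ c (toLp o hs ψ)) : constCoeff o hs ψ = c₀ ∧ ∀ i, coeff hs i ψ = c i := by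
  refine ⟨h.eq_integral.symm, fun i => ?_⟩
  have := (weight_mul_energy_pos (s := s) i).ne'
  rw [coeff_apply, h.diff_setIntegral, inv_mul_cancel_left₀ (by exact_mod_cast this)]

theorem isHaarRep_coeff (ψ : BesovInf o hs) :
    IsHaarRep o s (constCoeff o hs ψ) (fun i => coeff hs i ψ) (toLp o hs ψ) := by
  obtain ⟨c₀, c, h⟩ := exists_rep ψ
  obtain ⟨h1, h2⟩ := coeff_eq h
  rw [h1, funext h2]
  exact h

theorem norm_eq (ψ : BesovInf o hs) : ‖ψ‖ = ‖constCoeff o hs ψ‖ + ⨆ i, ‖coeff hs i ψ‖ := by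
  refine le_antisymm (norm_le (isHaarRep_coeff ψ)) (le_norm fun c₀ c h => ?_)
  obtain ⟨h1, h2⟩ := coeff_eq h
  rw [h1, funext fun i => congrArg _ (h2 i)]

theorem norm_constCoeff_le (ψ : BesovInf o hs) : ‖constCoeff o hs ψ‖ ≤ ‖ψ‖ := by
  rw [norm_eq]
  exact le_add_of_nonneg_right (Real.iSup_nonneg fun _ => norm_nonneg _)

theorem norm_coeff_le (i : HaarIndex o) (ψ : BesovInf o hs) : ‖coeff hs i ψ‖ ≤ ‖ψ‖ := by
  rw [norm_eq]
  exact (le_ciSup (isHaarRep_coeff ψ).1 i).trans (le_add_of_nonneg_left (norm_nonneg _))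

theorem norm_le_add {ψ : BesovInf o hs} {A B : ℝ} (hB : 0 ≤ B) (h₀ : ‖constCoeff o hs ψ‖ ≤ A)
    (h : ∀ i, ‖coeff hs i ψ‖ ≤ B) : ‖ψ‖ ≤ A + B := by
  rw [norm_eq]
  exact add_le_add h₀ (Real.iSup_le h hB)

/-- An element of `L^∞` with a Haar series, as an element of `B^s_{∞,∞}`. -/
def mk (ψ : Lp ℂ ∞ μ) (h : ∃ c₀ c, IsHaarRep o s c₀ c ψ) : BesovInf o hs := ⟨ψ, h⟩

theorem memLp_indicator_sum (S : List (Set I)) (hS : ∀ P ∈ S, MeasurableSet P) :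
    MemLp (fun t => (S.map fun P => P.indicator (fun _ => (1 : ℂ)) t).sum) ∞ μ := by
  induction S with
  | nil => simp
  | cons P S ih =>
    simp only [List.map_cons, List.sum_cons]
    exact ((memLp_const (1 : ℂ)).indicator (hS P (by simp))).add
      (ih fun R hR => hS R (by simp [hR]))

theorem memLp_haar (i : HaarIndex o) : MemLp (haar i) ∞ μ := by
  have h : ∀ S : List (Set I), (∀ P ∈ S, MeasurableSet P) → MemLp (familyDensity μ S) ∞ μ := by
    intro S hS
    have := (memLp_indicator_sum (μ := μ) S hS).mul_const ((((S.map μ.real).sum : ℝ) : ℂ)⁻¹)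
    simp only [← div_eq_mul_inv] at this
    exact this
  exact (h _ i.measurableSet_left).sub (h _ i.measurableSet_right)

theorem memLp_haarPartialSum (s : ℝ) (c₀ : ℂ) (c : HaarIndex o → ℂ) (N : ℕ) :
    MemLp (haarPartialSum o s c₀ c N) ∞ μ := by
  have : haarPartialSum o s c₀ c N = fun t => c₀ + ∑ i ∈ levels o N,
      (i.weight s : ℂ) * c i * haar i t := funext fun t => haarPartialSum_eq o s c₀ c N t
  rw [this]
  have h1 : MemLp (fun _ : I => c₀) ∞ μ := memLp_const _
  have h2 : MemLp (fun t => ∑ i ∈ levels o N, (i.weight s : ℂ) * c i * haar i t) ∞ μ :=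
    memLp_finsetSum _ fun i _ => (memLp_haar i).const_mul _
  exact h1.add h2

theorem isHaarRep_of_finite {c : HaarIndex o → ℂ} {N : ℕ} (hc : ∀ i, c i ≠ 0 → i.1 < N)
    (s : ℝ) (c₀ : ℂ) :
    IsHaarRep o s c₀ c ((memLp_haarPartialSum s c₀ c N).toLp _) := by
  refine ⟨?_, ?_⟩
  · refine ⟨∑ i ∈ levels o N, ‖c i‖, ?_⟩
    rintro _ ⟨i, rfl⟩
    by_cases h : c i = 0
    · simp only [h, norm_zero]
      exact Finset.sum_nonneg fun _ _ => norm_nonneg _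
    · exact Finset.single_le_sum (f := fun i => ‖c i‖) (fun _ _ => norm_nonneg _)
        (mem_levels.2 (hc i h))
  · refine tendsto_const_nhds.congr' ?_
    filter_upwards [eventually_ge_atTop N] with M hM
    symm
    refine (eLpNorm_congr_ae (g := fun _ => (0 : ℂ)) ?_).trans eLpNorm_zero'
    filter_upwards [(memLp_haarPartialSum (μ := μ) s c₀ c N).coeFn_toLp] with t ht
    rw [ht, haarPartialSum_eq, haarPartialSum_eq, sub_eq_zero]
    congr 1
    refine Finset.sum_subset (fun i hi => mem_levels.2 ((mem_levels.1 hi).trans_le hM))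
      fun i _ hi => ?_
    have : c i = 0 := by_contra fun h' => hi (mem_levels.2 (hc i h'))
    rw [this, mul_zero, zero_mul]

/-- The constant function `1`. -/
def one (o : G.ChildOrder) (hs : 0 < s) : BesovInf o hs :=
  mk _ ⟨1, fun _ => 0, isHaarRep_of_finite (N := 0) (fun _ h => absurd rfl h) s 1⟩

open Classical in
theorem isHaarRep_single (s : ℝ) (i : HaarIndex o) : IsHaarRep o s 0 (Pi.single i 1)
    ((memLp_haarPartialSum (μ := μ) s 0 (Pi.single i 1) (i.1 + 1)).toLp _) := by
  refine isHaarRep_of_finite (fun j h => ?_) s 0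
  have : j = i := by_contra fun h' => h (Pi.single_eq_of_ne h' _)
  rw [this]
  exact Nat.lt_succ_self _

open Classical in
/-- The function `|Q|^{1+s} φ_{(S₁,S₂)}`. -/
def basis (hs : 0 < s) (i : HaarIndex o) : BesovInf o hs := mk _ ⟨0, _, isHaarRep_single s i⟩

theorem isHaarRep_one : IsHaarRep o s 1 (fun _ => 0) (toLp o hs (one o hs)) :=
  isHaarRep_of_finite (N := 0) (fun _ h => absurd rfl h) s 1

open Classical in
theorem isHaarRep_basis (i : HaarIndex o) :
    IsHaarRep o s 0 (Pi.single i 1) (toLp o hs (basis hs i)) := isHaarRep_single s i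

theorem constCoeff_one : constCoeff o hs (one o hs) = 1 := (coeff_eq isHaarRep_one).1

theorem coeff_one (i : HaarIndex o) : coeff hs i (one o hs) = 0 := (coeff_eq isHaarRep_one).2 i

theorem constCoeff_basis (i : HaarIndex o) : constCoeff o hs (basis hs i) = 0 := by
  classical exact (coeff_eq (isHaarRep_basis i)).1

open Classical in
theorem coeff_basis (i j : HaarIndex o) :
    coeff hs j (basis hs i) = if i = j then 1 else 0 := by
  rw [(coeff_eq (isHaarRep_basis i)).2 j]
  by_cases h : i = j
  · subst h
    rw [if_pos rfl, Pi.single_eq_same]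
  · rw [if_neg h, Pi.single_eq_of_ne (Ne.symm h)]

theorem one_mem_testFunctions : one o hs ∈ testFunctions o hs :=
  ⟨1, fun _ => 0, isHaarRep_one, by simp⟩

theorem basis_mem_testFunctions (i : HaarIndex o) : basis hs i ∈ testFunctions o hs := by
  classical
  exact ⟨0, Pi.single i 1, isHaarRep_basis i, (Set.finite_singleton i).subset
    Pi.support_single_subset⟩

theorem coeFn_one : toLp o hs (one o hs) =ᵐ[μ] fun _ => 1 := by
  refine ((memLp_haarPartialSum (μ := μ) (o := o) s 1 (fun _ => 0) 0).coeFn_toLp).trans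
    (Eventually.of_forall fun t => ?_)
  simp [haarPartialSum]

theorem coeFn_basis (i : HaarIndex o) :
    toLp o hs (basis hs i) =ᵐ[μ] fun t => (i.weight s : ℂ) * haar i t := by
  classical
  refine ((memLp_haarPartialSum (μ := μ) s 0 (Pi.single i 1) (i.1 + 1)).coeFn_toLp).trans
    (Eventually.of_forall fun t => ?_)
  rw [haarPartialSum_eq, Finset.sum_eq_single i]
  · simp
  · intro j _ hj
    rw [Pi.single_eq_of_ne hj]; simp
  · intro h
    exact absurd (mem_levels.2 (Nat.lt_succ_self _)) h

/-- The partial sum of the levels below `N` of the Haar series. -/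
def trunc (N : ℕ) (ψ : BesovInf o hs) : BesovInf o hs :=
  constCoeff o hs ψ • one o hs + ∑ i ∈ levels o N, coeff hs i ψ • basis hs i

theorem constCoeff_trunc (N : ℕ) (ψ : BesovInf o hs) :
    constCoeff o hs (trunc N ψ) = constCoeff o hs ψ := by
  simp [trunc, constCoeff_one, constCoeff_basis]

theorem coeff_trunc (N : ℕ) (ψ : BesovInf o hs) (j : HaarIndex o) :
    coeff hs j (trunc N ψ) = if j.1 < N then coeff hs j ψ else 0 := by
  classical
  simp [trunc, coeff_one, coeff_basis, mem_levels]

theorem norm_trunc_le (N : ℕ) (ψ : BesovInf o hs) : ‖trunc N ψ‖ ≤ ‖ψ‖ := by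
  rw [norm_eq ψ]
  refine norm_le_add (Real.iSup_nonneg fun _ => norm_nonneg _) (by rw [constCoeff_trunc])
    fun i => ?_
  rw [coeff_trunc]
  split_ifs
  · exact le_ciSup (isHaarRep_coeff ψ).1 i
  · rw [norm_zero]
    exact Real.iSup_nonneg fun _ => norm_nonneg _

theorem coeFn_trunc (N : ℕ) (ψ : BesovInf o hs) : toLp o hs (trunc N ψ) =ᵐ[μ]
    haarPartialSum o s (constCoeff o hs ψ) (fun i => coeff hs i ψ) N := by
  have h2 : toLp o hs (trunc N ψ) = constCoeff o hs ψ • toLp o hs (one o hs) +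
      ∑ i ∈ levels o N, coeff hs i ψ • toLp o hs (basis hs i) := by
    simp [trunc]
  have h3 : ∀ᵐ t ∂μ, ∀ i ∈ levels o N, (coeff hs i ψ • toLp o hs (basis hs i) : Lp ℂ ∞ μ) t =
      coeff hs i ψ * ((i.weight s : ℂ) * haar i t) := by
    rw [Filter.eventually_all_finset]
    intro i _
    filter_upwards [Lp.coeFn_smul (coeff hs i ψ) (toLp o hs (basis hs i)),
      coeFn_basis (hs := hs) i] with t h1 h2
    rw [h1, Pi.smul_apply, h2, smul_eq_mul]
  have h4 := Lp.coeFn_add (constCoeff o hs ψ • toLp o hs (one o hs))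
    (∑ i ∈ levels o N, coeff hs i ψ • toLp o hs (basis hs i))
  have h5 := Lp.coeFn_finsetSum (levels o N) fun i => coeff hs i ψ • toLp o hs (basis hs i)
  rw [h2]
  filter_upwards [h3, h4, h5, Lp.coeFn_smul (constCoeff o hs ψ) (toLp o hs (one o hs)),
    coeFn_one (o := o) (hs := hs)] with t h3 h4 h5 h6 h7
  rw [h4, Pi.add_apply, h5, h6, Pi.smul_apply, h7, haarPartialSum_eq, smul_eq_mul, mul_one]
  congr 1
  rw [Finset.sum_apply]
  refine Finset.sum_congr rfl fun i hi => ?_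
  rw [h3 i hi]
  ring

theorem tendsto_setIntegralFunctional_trunc (A : Set I) (ψ : BesovInf o hs) :
    Tendsto (fun N => setIntegralFunctional o hs A (trunc N ψ)) atTop
      (𝓝 (setIntegralFunctional o hs A ψ)) := by
  simp only [setIntegralFunctional_apply]
  refine (tendsto_setIntegral (integrable_haarPartialSum o s _ _) (isHaarRep_coeff ψ).2 A).congr
    fun N => ?_
  exact integral_congr_ae (ae_restrict_of_ae (coeFn_trunc N ψ).symm)

end BesovInf

end Coefficients

end GoodGrid

end

noncomputable section

namespace GoodGrid

section Duality

variable {I : Type*} [MeasurableSpace I] {μ : Measure I} {G : GoodGrid μ} {o : G.ChildOrder}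
  {s : ℝ} {hs : 0 < s} [IsProbabilityMeasure μ]

open BesovInf

theorem exists_phase (z : ℂ) : ∃ ε : ℂ, ‖ε‖ ≤ 1 ∧ ε * z = ‖z‖ := by
  rcases eq_or_ne z 0 with rfl | hz
  · exact ⟨0, by simp, by simp⟩
  · have h : ‖z‖ ≠ 0 := norm_ne_zero_iff.2 hz
    refine ⟨‖z‖ / z, ?_, div_mul_cancel₀ _ hz⟩
    rw [norm_div, Complex.norm_real, norm_norm, div_self h]

theorem sum_norm_basis_le (φ : StrongDual ℂ (BesovInf o hs)) (F : Finset (HaarIndex o)) :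
    ∑ i ∈ F, ‖φ (basis hs i)‖ ≤ ‖φ‖ := by
  classical
  choose ε hε hε' using fun i => exists_phase (φ (basis hs i))
  have h1 : φ (∑ i ∈ F, ε i • basis hs i) = ((∑ i ∈ F, ‖φ (basis hs i)‖ : ℝ) : ℂ) := by
    simp only [map_sum, map_smul, smul_eq_mul, hε', Complex.ofReal_sum]
  have h2 : ‖∑ i ∈ F, ε i • basis hs i‖ ≤ 0 + 1 := by
    refine norm_le_add zero_le_one ?_ fun j => ?_
    · simp [constCoeff_basis]
    · simp only [map_sum, map_smul, coeff_basis, smul_eq_mul, mul_ite, mul_one, mul_zero,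
        Finset.sum_ite_eq']
      split_ifs
      · exact hε j
      · simp
  have h3 := φ.le_opNorm (∑ i ∈ F, ε i • basis hs i)
  rw [h1, Complex.norm_real, Real.norm_of_nonneg (Finset.sum_nonneg fun _ _ => norm_nonneg _)] at h3
  nlinarith [norm_nonneg φ]

theorem summable_norm_basis (φ : StrongDual ℂ (BesovInf o hs)) :
    Summable fun i => ‖φ (basis hs i)‖ :=
  summable_of_sum_le (fun _ => norm_nonneg _) (sum_norm_basis_le φ)

theorem norm_one_le : ‖one o hs‖ ≤ 1 := by
  refine (norm_le_add le_rfl (A := 1) ?_ fun i => ?_).trans (by simp)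
  · simp [constCoeff_one]
  · simp [coeff_one]

theorem norm_apply_one_le (φ : StrongDual ℂ (BesovInf o hs)) : ‖φ (one o hs)‖ ≤ ‖φ‖ := by
  have := φ.le_opNorm (one o hs)
  nlinarith [norm_nonneg φ, norm_one_le (o := o) (hs := hs)]

theorem apply_trunc (φ : StrongDual ℂ (BesovInf o hs)) (N : ℕ) (ψ : BesovInf o hs) :
    φ (trunc N ψ) = constCoeff o hs ψ * φ (one o hs) +
      ∑ i ∈ levels o N, coeff hs i ψ * φ (basis hs i) := by
  simp [trunc]

theorem integral_toLp_mul_haar (ψ : BesovInf o hs) (i : HaarIndex o) :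
    ∫ t, toLp o hs ψ t * haar i t ∂μ = (i.weight s * i.energy : ℝ) * coeff hs i ψ := by
  rw [integral_mul_haar ((Lp.memLp (toLp o hs ψ)).integrable le_top), coeff_apply,
    mul_inv_cancel_left₀ (by exact_mod_cast (weight_mul_energy_pos i).ne')]

theorem besovSeries_eq (d₀ : ℂ) (d : HaarIndex o → ℂ) (N : ℕ) (ψ : BesovInf o hs) :
    d₀ * ∫ t, toLp o hs ψ t ∂μ + ∑ k ∈ Finset.range N, ∑ i : LevelPair o k,
        d ⟨k, i⟩ * ((μ.real (HaarIndex.cell ⟨k, i⟩) ^ (-s) : ℝ) : ℂ) *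
          ∫ t, toLp o hs ψ t * haar ⟨k, i⟩ t ∂μ =
      d₀ * constCoeff o hs ψ + ∑ i ∈ levels o N,
        d i * (μ.real i.cell * i.energy : ℝ) * coeff hs i ψ := by
  have hterm : ∀ i : HaarIndex o, d i * ((μ.real i.cell ^ (-s) : ℝ) : ℂ) *
      ∫ t, toLp o hs ψ t * haar i t ∂μ =
      d i * (μ.real i.cell * i.energy : ℝ) * coeff hs i ψ := by
    intro i
    rw [integral_toLp_mul_haar, HaarIndex.weight_eq, Real.rpow_neg measureReal_nonneg]
    have h : ((μ.real i.cell ^ s : ℝ) : ℂ) ≠ 0 := by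
      exact_mod_cast (Real.rpow_pos_of_pos i.cell_pos s).ne'
    push_cast
    field_simp
  rw [sum_levels]
  congr 1
  · rw [constCoeff, setIntegralFunctional_apply, setIntegral_univ]
  · exact Finset.sum_congr rfl fun k _ => Finset.sum_congr rfl fun i _ => hterm ⟨k, i⟩

theorem IsBesovRep.apply_basis {d₀ : ℂ} {d : HaarIndex o → ℂ}
    {φ : StrongDual ℂ (BesovInf o hs)} (h : IsBesovRep d₀ d φ) (i : HaarIndex o) :
    φ (basis hs i) = d i * (μ.real i.cell * i.energy : ℝ) := by
  classical
  refine tendsto_nhds_unique (h.2 (basis hs i)) (tendsto_const_nhds.congr' ?_)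
  filter_upwards [eventually_gt_atTop i.1] with N hN
  rw [besovSeries_eq]
  simp [constCoeff_basis, coeff_basis, mem_levels.2 hN]

theorem IsBesovRep.apply_one {d₀ : ℂ} {d : HaarIndex o → ℂ}
    {φ : StrongDual ℂ (BesovInf o hs)} (h : IsBesovRep d₀ d φ) : φ (one o hs) = d₀ := by
  refine tendsto_nhds_unique (h.2 (one o hs)) (tendsto_const_nhds.congr fun N => ?_)
  rw [besovSeries_eq]
  simp [constCoeff_one, coeff_one]

theorem IsBesovRep.tendsto_trunc {d₀ : ℂ} {d : HaarIndex o → ℂ}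
    {φ : StrongDual ℂ (BesovInf o hs)} (h : IsBesovRep d₀ d φ) (ψ : BesovInf o hs) :
    Tendsto (fun N => φ (trunc N ψ)) atTop (𝓝 (φ ψ)) := by
  refine (h.2 ψ).congr fun N => ?_
  rw [besovSeries_eq, apply_trunc, h.apply_one, mul_comm]
  congr 1
  refine Finset.sum_congr rfl fun i _ => ?_
  rw [h.apply_basis, mul_comm]

/-- The coefficients of a functional are given by its values on the basis. -/
theorem isBesovRep_of_tendsto {φ : StrongDual ℂ (BesovInf o hs)}
    (h : ∀ ψ, Tendsto (fun N => φ (trunc N ψ)) atTop (𝓝 (φ ψ))) :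
    IsBesovRep (φ (one o hs))
      (fun i => φ (basis hs i) / ((μ.real i.cell * i.energy : ℝ) : ℂ)) φ := by
  refine ⟨?_, fun ψ => (h ψ).congr fun N => ?_⟩
  · refine (summable_norm_basis φ).of_nonneg_of_le (fun _ => norm_nonneg _) fun i => ?_
    have h1 := i.one_le_energy
    rw [norm_div, Complex.norm_real, Real.norm_of_nonneg (by linarith)]
    exact div_le_self (norm_nonneg _) h1
  · refine Eq.trans ?_ (besovSeries_eq (φ (one o hs))
      (fun i => φ (basis hs i) / ((μ.real i.cell * i.energy : ℝ) : ℂ)) N ψ).symm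
    rw [apply_trunc, mul_comm]
    congr 1
    refine Finset.sum_congr rfl fun i _ => ?_
    have h1 : ((μ.real i.cell * i.energy : ℝ) : ℂ) ≠ 0 := by
      have := i.one_le_energy
      exact_mod_cast (by linarith : 0 < μ.real i.cell * i.energy).ne'
    have h2 : ∀ a b c : ℂ, c ≠ 0 → a * b = b / c * c * a := fun a b c hc => by
      rw [div_mul_cancel₀ b hc, mul_comm]
    exact h2 _ _ _ h1

theorem mem_besovOne_iff {φ : StrongDual ℂ (BesovInf o hs)} :
    φ ∈ besovOne o hs ↔ ∀ ψ, Tendsto (fun N => φ (trunc N ψ)) atTop (𝓝 (φ ψ)) :=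
  ⟨fun ⟨_, _, h⟩ ψ => h.tendsto_trunc ψ, fun h => ⟨_, _, isBesovRep_of_tendsto h⟩⟩

/-- The space `B^{-s}_{1,1}` as a subspace of the dual of `B^s_{∞,∞}`. -/
def besovOneSubmodule (o : G.ChildOrder) {s : ℝ} (hs : 0 < s) :
    Submodule ℂ (StrongDual ℂ (BesovInf o hs)) where
  carrier := besovOne o hs
  zero_mem' := mem_besovOne_iff.2 fun ψ => by simp
  add_mem' := fun {φ χ} hφ hχ => mem_besovOne_iff.2 fun ψ =>
    (mem_besovOne_iff.1 hφ ψ).add (mem_besovOne_iff.1 hχ ψ)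
  smul_mem' := fun a φ hφ => mem_besovOne_iff.2 fun ψ => (mem_besovOne_iff.1 hφ ψ).const_mul a

theorem isClosed_besovOne : IsClosed (besovOne o hs) := by
  refine isClosed_of_closure_subset fun φ hφ => mem_besovOne_iff.2 fun ψ => ?_
  rw [Metric.tendsto_atTop]
  intro ε hε
  have hδ : 0 < ε / (3 * (‖ψ‖ + 1)) := by positivity
  obtain ⟨χ, hχ, hd⟩ := Metric.mem_closure_iff.1 hφ _ hδ
  obtain ⟨N₀, hN⟩ := Metric.tendsto_atTop.1 (mem_besovOne_iff.1 hχ ψ) (ε / 3) (by positivity)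
  refine ⟨N₀, fun N hNN => ?_⟩
  have key : ∀ ξ : BesovInf o hs, ‖ξ‖ ≤ ‖ψ‖ → ‖φ ξ - χ ξ‖ < ε / 3 := by
    intro ξ hξ
    rw [dist_eq_norm] at hd
    calc ‖φ ξ - χ ξ‖ = ‖(φ - χ) ξ‖ := rfl
      _ ≤ ‖φ - χ‖ * ‖ξ‖ := (φ - χ).le_opNorm ξ
      _ ≤ ‖φ - χ‖ * (‖ψ‖ + 1) :=
        mul_le_mul_of_nonneg_left (by linarith) (norm_nonneg _)
      _ < ε / (3 * (‖ψ‖ + 1)) * (‖ψ‖ + 1) := mul_lt_mul_of_pos_right hd (by positivity)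
      _ = ε / 3 := by field_simp
  have h1 := key _ (norm_trunc_le N ψ)
  have h2 := key ψ le_rfl
  have h3 := hN N hNN
  rw [dist_eq_norm] at h3 ⊢
  calc ‖φ (trunc N ψ) - φ ψ‖ = ‖(φ (trunc N ψ) - χ (trunc N ψ)) +
        (χ (trunc N ψ) - χ ψ) - (φ ψ - χ ψ)‖ := by congr 1; ring
    _ ≤ ‖φ (trunc N ψ) - χ (trunc N ψ)‖ + ‖χ (trunc N ψ) - χ ψ‖ + ‖φ ψ - χ ψ‖ :=
      (norm_sub_le _ _).trans (add_le_add_left (norm_add_le _ _) _)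
    _ < ε := by linarith

theorem setIntegralFunctional_mem_besovOne (A : Set I) :
    setIntegralFunctional o hs A ∈ besovOne o hs :=
  mem_besovOne_iff.2 (tendsto_setIntegralFunctional_trunc A)

theorem besovOne_ext {φ χ : StrongDual ℂ (BesovInf o hs)} (hφ : φ ∈ besovOne o hs)
    (hχ : χ ∈ besovOne o hs) (h₀ : φ (one o hs) = χ (one o hs))
    (h : ∀ i, φ (basis hs i) = χ (basis hs i)) : φ = χ := by
  ext ψ
  refine tendsto_nhds_unique (mem_besovOne_iff.1 hφ ψ)
    ((mem_besovOne_iff.1 hχ ψ).congr fun N => ?_)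
  simp only [apply_trunc, h₀, h]

theorem injOn_toDistribution : Set.InjOn toDistribution (besovOne o hs) := by
  intro φ hφ χ hχ h
  refine besovOne_ext hφ hχ ?_ fun i => ?_
  · exact LinearMap.congr_fun h ⟨_, one_mem_testFunctions⟩
  · exact LinearMap.congr_fun h ⟨_, basis_mem_testFunctions i⟩

theorem besovOneNorm_nonneg (φ : StrongDual ℂ (BesovInf o hs)) : 0 ≤ besovOneNorm φ := by
  refine Real.sInf_nonneg ?_
  rintro _ ⟨d₀, d, _, rfl⟩
  exact add_nonneg (norm_nonneg _) (tsum_nonneg fun _ => norm_nonneg _)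

theorem besovOneNorm_le {φ : StrongDual ℂ (BesovInf o hs)} (hφ : φ ∈ besovOne o hs) :
    besovOneNorm φ ≤ 2 * ‖φ‖ := by
  have h := isBesovRep_of_tendsto (mem_besovOne_iff.1 hφ)
  have h1 : besovOneNorm φ ≤ ‖φ (one o hs)‖ +
      ∑' i, ‖φ (basis hs i) / ((μ.real i.cell * i.energy : ℝ) : ℂ)‖ := by
    refine csInf_le ⟨0, ?_⟩ ⟨_, _, h, rfl⟩
    rintro _ ⟨d₀, d, _, rfl⟩
    exact add_nonneg (norm_nonneg _) (tsum_nonneg fun _ => norm_nonneg _)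
  have h2 : ∑' i, ‖φ (basis hs i) / ((μ.real i.cell * i.energy : ℝ) : ℂ)‖ ≤ ‖φ‖ := by
    refine h.1.tsum_le_of_sum_le fun F => le_trans (Finset.sum_le_sum fun i _ => ?_)
      (sum_norm_basis_le φ F)
    have h1 := i.one_le_energy
    rw [norm_div, Complex.norm_real, Real.norm_of_nonneg (by linarith)]
    exact div_le_self (norm_nonneg _) h1
  linarith [norm_apply_one_le φ]

/-- An upper bound for the norm of the dual by coefficients. -/
theorem norm_apply_le {φ : StrongDual ℂ (BesovInf o hs)} (hφ : φ ∈ besovOne o hs)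
    (ψ : BesovInf o hs) :
    ‖φ ψ‖ ≤ (‖φ (one o hs)‖ + ∑' i, ‖φ (basis hs i)‖) * ‖ψ‖ := by
  refine le_of_tendsto (mem_besovOne_iff.1 hφ ψ).norm (Eventually.of_forall fun N => ?_)
  rw [apply_trunc, add_mul]
  refine (norm_add_le _ _).trans (add_le_add ?_ ?_)
  · rw [norm_mul, mul_comm]
    exact mul_le_mul_of_nonneg_left (norm_constCoeff_le ψ) (norm_nonneg _)
  · refine (norm_sum_le _ _).trans ?_
    refine le_trans (b := (∑ i ∈ levels o N, ‖φ (basis hs i)‖) * ‖ψ‖) ?_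
      (mul_le_mul_of_nonneg_right
        ((summable_norm_basis φ).sum_le_tsum _ fun _ _ => norm_nonneg _) (norm_nonneg _))
    rw [Finset.sum_mul]
    refine Finset.sum_le_sum fun i _ => ?_
    rw [norm_mul, mul_comm]
    exact mul_le_mul_of_nonneg_left (norm_coeff_le i ψ) (norm_nonneg _)

theorem norm_le_besovOneNorm {φ : StrongDual ℂ (BesovInf o hs)} (hφ : φ ∈ besovOne o hs) :
    ‖φ‖ ≤ (1 + 2 / G.lower) * besovOneNorm φ := by
  have hL : 0 < 2 / G.lower := div_pos two_pos G.lower_pos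
  rw [← div_le_iff₀' (by linarith)]
  obtain ⟨d₀, d, hd⟩ := hφ
  refine le_csInf ⟨_, d₀, d, hd, rfl⟩ ?_
  rintro _ ⟨d₀, d, hd, rfl⟩
  rw [div_le_iff₀' (by linarith)]
  have h1 : ∑' i, ‖φ (basis hs i)‖ ≤ (2 / G.lower) * ∑' i, ‖d i‖ := by
    rw [← tsum_mul_left]
    refine (summable_norm_basis φ).tsum_le_tsum (fun i => ?_) (hd.1.mul_left _)
    have h1 := i.one_le_energy
    rw [hd.apply_basis, norm_mul, Complex.norm_real, Real.norm_of_nonneg (by linarith), mul_comm]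
    exact mul_le_mul_of_nonneg_right i.energy_le (norm_nonneg _)
  have h2 : 0 ≤ ∑' i, ‖d i‖ := tsum_nonneg fun _ => norm_nonneg _
  refine φ.opNorm_le_bound (by positivity) fun ψ =>
    (norm_apply_le ⟨d₀, d, hd⟩ ψ).trans (mul_le_mul_of_nonneg_right ?_ (norm_nonneg _))
  rw [hd.apply_one]
  nlinarith [norm_nonneg d₀]

end Duality

end GoodGrid

end

noncomputable section

namespace GoodGrid

section Indicators

variable {I : Type*} [MeasurableSpace I] {μ : Measure I} {G : GoodGrid μ} {o : G.ChildOrder}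
  {s : ℝ} {hs : 0 < s} [IsProbabilityMeasure μ]

open BesovInf

/-- `f` is almost everywhere equal to a test function. -/
def IsTestFunction (o : G.ChildOrder) {s : ℝ} (hs : 0 < s) (f : I → ℂ) : Prop :=
  ∃ ψ ∈ testFunctions o hs, toLp o hs ψ =ᵐ[μ] f

omit [IsProbabilityMeasure μ] in
theorem IsTestFunction.congr {f g : I → ℂ} (hf : IsTestFunction o hs f) (h : f =ᵐ[μ] g) :
    IsTestFunction o hs g := by
  obtain ⟨ψ, hψ, hψ'⟩ := hf
  exact ⟨ψ, hψ, hψ'.trans h⟩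

omit [IsProbabilityMeasure μ] in
theorem IsTestFunction.add {f g : I → ℂ} (hf : IsTestFunction o hs f)
    (hg : IsTestFunction o hs g) : IsTestFunction o hs (fun t => f t + g t) := by
  obtain ⟨ψ, hψ, hψ'⟩ := hf
  obtain ⟨χ, hχ, hχ'⟩ := hg
  refine ⟨ψ + χ, add_mem hψ hχ, ?_⟩
  rw [map_add]
  filter_upwards [Lp.coeFn_add (toLp o hs ψ) (toLp o hs χ), hψ', hχ'] with t h1 h2 h3
  rw [h1, Pi.add_apply, h2, h3]

omit [IsProbabilityMeasure μ] in
theorem IsTestFunction.const_mul {f : I → ℂ} (hf : IsTestFunction o hs f) (c : ℂ) :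
    IsTestFunction o hs (fun t => c * f t) := by
  obtain ⟨ψ, hψ, hψ'⟩ := hf
  refine ⟨c • ψ, Submodule.smul_mem _ c hψ, ?_⟩
  rw [map_smul]
  filter_upwards [Lp.coeFn_smul c (toLp o hs ψ), hψ'] with t h1 h2
  rw [h1, Pi.smul_apply, h2, smul_eq_mul]

theorem isTestFunction_haar (hs : 0 < s) (i : HaarIndex o) : IsTestFunction o hs (haar i) := by
  have h : IsTestFunction o hs fun t => (i.weight s : ℂ) * haar i t :=
    ⟨basis hs i, basis_mem_testFunctions i, coeFn_basis i⟩
  refine (h.const_mul (i.weight s : ℂ)⁻¹).congr (Eventually.of_forall fun t => ?_)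
  have := (i.weight_pos s).ne'
  exact inv_mul_cancel_left₀ (by exact_mod_cast this) _

omit [IsProbabilityMeasure μ] in
theorem isTestFunction_of_haarPairs (l : List (Set I)) (hl : ∀ P ∈ l, 0 < μ.real P)
    (hp : ∀ p ∈ haarPairs l,
      IsTestFunction o hs fun t => familyDensity μ p.1 t - familyDensity μ p.2 t)
    (h : IsTestFunction o hs fun t => (l.map fun P => P.indicator (fun _ => (1 : ℂ)) t).sum) :
    ∀ R ∈ l, IsTestFunction o hs (R.indicator fun _ => (1 : ℂ)) := by
  induction l using haarPairs.induct with
  | case1 l hlen ih1 ih2 =>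
    rw [haarPairs_of_length hlen] at hp
    have hl1 : ∀ P ∈ l.take (l.length / 2), 0 < μ.real P :=
      fun P hP => hl P (List.mem_of_mem_take hP)
    have hl2 : ∀ P ∈ l.drop (l.length / 2), 0 < μ.real P :=
      fun P hP => hl P (List.mem_of_mem_drop hP)
    have hne : l.take (l.length / 2) ≠ [] ∧ l.drop (l.length / 2) ≠ [] := by
      refine ⟨?_, ?_⟩ <;> rw [← List.length_pos_iff]
      · simp only [List.length_take]; omega
      · simp only [List.length_drop]; omega
    have w1 := sum_map_pos hl1 hne.1
    have w2 := sum_map_pos hl2 hne.2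
    have hhead := hp _ List.mem_cons_self
    have hsplit : ∀ t, (l.map fun P => P.indicator (fun _ => (1 : ℂ)) t).sum =
        ((l.take (l.length / 2)).map fun P => P.indicator (fun _ => (1 : ℂ)) t).sum +
        ((l.drop (l.length / 2)).map fun P => P.indicator (fun _ => (1 : ℂ)) t).sum := by
      intro t
      conv_lhs => rw [← List.take_append_drop (l.length / 2) l]
      rw [List.map_append, List.sum_append]
    simp only [familyDensity] at hhead
    generalize ((l.take (l.length / 2)).map fun P => μ.real P).sum = W₁ at hhead w1
    generalize ((l.drop (l.length / 2)).map fun P => μ.real P).sum = W₂ at hhead w2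
    have e1 : (W₁ : ℂ) ≠ 0 := by exact_mod_cast w1.ne'
    have e2 : (W₂ : ℂ) ≠ 0 := by exact_mod_cast w2.ne'
    have e3 : (W₁ : ℂ) + W₂ ≠ 0 := by exact_mod_cast (add_pos w1 w2).ne'
    have h1 : IsTestFunction o hs fun t =>
        ((l.take (l.length / 2)).map fun P => P.indicator (fun _ => (1 : ℂ)) t).sum := by
      refine ((h.const_mul ((W₁ : ℂ) / (W₁ + W₂))).add
        (hhead.const_mul ((W₁ : ℂ) * W₂ / (W₁ + W₂)))).congr (Eventually.of_forall fun t => ?_)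
      simp only [hsplit]
      field_simp
      ring
    have h2 : IsTestFunction o hs fun t =>
        ((l.drop (l.length / 2)).map fun P => P.indicator (fun _ => (1 : ℂ)) t).sum := by
      refine (h.add (h1.const_mul (-1))).congr (Eventually.of_forall fun t => ?_)
      simp only [hsplit]
      ring
    intro R hR
    rw [← List.take_append_drop (l.length / 2) l, List.mem_append] at hR
    rcases hR with hR | hR
    · exact ih1 hl1 (fun p hp' => hp p (by simp [hp'])) h1 R hR
    · exact ih2 hl2 (fun p hp' => hp p (by simp [hp'])) h2 R hR
  | case2 l hlen =>
    intro R hR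
    have : l = [R] := by
      match l, hlen, hR with
      | [P], _, hR => rw [List.mem_singleton.1 hR]
      | P :: P' :: l, hlen, _ => simp at hlen
    rw [this] at h
    exact h.congr (Eventually.of_forall fun t => by simp)

omit [IsProbabilityMeasure μ] in
theorem mem_children_iff (o : G.ChildOrder) {k : ℕ} {Q : Set I} (hQ : Q ∈ G.cells k) {R : Set I} :
    R ∈ o.children k Q ↔ R ∈ G.cellsIn (k + 1) Q := by
  rw [o.mem_children k Q hQ, G.mem_cellsIn]

omit [IsProbabilityMeasure μ] in
theorem sum_map_children {M : Type*} [AddCommMonoid M] (o : G.ChildOrder) {k : ℕ} {Q : Set I}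
    (hQ : Q ∈ G.cells k) (f : Set I → M) :
    ((o.children k Q).map f).sum = ∑ R ∈ G.cellsIn (k + 1) Q, f R := by
  classical
  rw [← List.sum_toFinset _ (o.nodup k Q hQ)]
  refine Finset.sum_congr ?_ fun _ _ => rfl
  ext R
  rw [List.mem_toFinset, mem_children_iff o hQ]

theorem isTestFunction_indicator (o : G.ChildOrder) (hs : 0 < s) {n : ℕ} {P : Set I}
    (hP : P ∈ G.cells n) : IsTestFunction o hs (P.indicator fun _ => (1 : ℂ)) := by
  induction n generalizing P with
  | zero =>
    rw [G.eq_univ_of_mem_cells_zero hP, Set.indicator_univ]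
    exact ⟨one o hs, one_mem_testFunctions, coeFn_one⟩
  | succ n ih =>
    obtain ⟨Q, hQ, hPQ⟩ := G.nested n P hP
    refine isTestFunction_of_haarPairs (o.children n Q) (fun R hR => measureReal_cell_pos G (n + 1)
      R ((o.mem_children n Q hQ R).1 hR).1) (fun p hp => ?_) ?_ P
      ((o.mem_children n Q hQ P).2 ⟨hP, hPQ⟩)
    · exact isTestFunction_haar hs (o := o) ⟨n, ⟨⟨Q, hQ⟩, ⟨p, hp⟩⟩⟩
    · refine (ih hQ).congr ?_
      filter_upwards [G.indicator_ae_eq_sum (Nat.le_succ n) hQ] with t ht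
      rw [ht, sum_map_children o hQ]

open Classical in
/-- The indicator function of a cell, as an element of `B^s_{∞,∞}`. -/
def cellIndicator (o : G.ChildOrder) {s : ℝ} (hs : 0 < s) (P : Set I) : BesovInf o hs :=
  if h : IsTestFunction o hs (P.indicator fun _ => (1 : ℂ)) then h.choose else 0

theorem coeFn_cellIndicator (o : G.ChildOrder) (hs : 0 < s) {n : ℕ} {P : Set I}
    (hP : P ∈ G.cells n) :
    toLp o hs (cellIndicator o hs P) =ᵐ[μ] P.indicator fun _ => (1 : ℂ) := by
  have h := isTestFunction_indicator o hs hP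
  rw [cellIndicator, dif_pos h]
  exact h.choose_spec.2

omit [IsProbabilityMeasure μ] in
theorem ext_ae {ψ χ : BesovInf o hs} (h : toLp o hs ψ =ᵐ[μ] toLp o hs χ) : ψ = χ :=
  toLp_injective (Lp.ext h)

theorem cellIndicator_univ : cellIndicator o hs Set.univ = one o hs := by
  refine ext_ae ((coeFn_cellIndicator o hs G.univ_mem_cells).trans ?_)
  rw [Set.indicator_univ]
  exact coeFn_one.symm

theorem cellIndicator_eq_sum {k n : ℕ} (hkn : k ≤ n) {P : Set I} (hP : P ∈ G.cells k) :
    cellIndicator o hs P = ∑ R ∈ G.cellsIn n P, cellIndicator o hs R := by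
  refine ext_ae ((coeFn_cellIndicator o hs hP).trans ?_)
  have h1 : ∀ᵐ t ∂μ, ∀ R ∈ G.cellsIn n P, toLp o hs (cellIndicator o hs R) t =
      R.indicator (fun _ => (1 : ℂ)) t := by
    rw [Filter.eventually_all_finset]
    exact fun R hR => coeFn_cellIndicator o hs (G.mem_cellsIn.1 hR).1
  rw [map_sum]
  filter_upwards [h1, G.indicator_ae_eq_sum hkn hP,
    Lp.coeFn_finsetSum (G.cellsIn n P) fun R => toLp o hs (cellIndicator o hs R)] with t h1 h2 h3
  rw [h2, h3, Finset.sum_apply]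
  exact Finset.sum_congr rfl fun R hR => (h1 R hR).symm

theorem constCoeff_cellIndicator {n : ℕ} {P : Set I} (hP : P ∈ G.cells n) :
    constCoeff o hs (cellIndicator o hs P) = μ.real P := by
  rw [constCoeff, setIntegralFunctional_apply, setIntegral_univ,
    integral_congr_ae (coeFn_cellIndicator o hs hP),
    integral_indicator_const _ (G.measurable_cells n P hP)]
  simp

theorem coeff_cellIndicator {n : ℕ} {P : Set I} (hP : P ∈ G.cells n) (i : HaarIndex o) :
    coeff hs i (cellIndicator o hs P) =
      ((i.weight s * i.energy : ℝ) : ℂ)⁻¹ * ∫ t in P, haar i t ∂μ := by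
  have h := integral_toLp_mul_haar (cellIndicator o hs P) i
  have h1 : ∫ t, toLp o hs (cellIndicator o hs P) t * haar i t ∂μ = ∫ t in P, haar i t ∂μ := by
    rw [← integral_indicator (G.measurable_cells n P hP)]
    refine integral_congr_ae ?_
    filter_upwards [coeFn_cellIndicator o hs hP] with t ht
    rw [ht]
    by_cases htP : t ∈ P <;> simp [htP]
  have := (weight_mul_energy_pos (s := s) i).ne'
  rw [← h1, h, inv_mul_cancel_left₀ (by exact_mod_cast this)]

theorem basis_eq (i : HaarIndex o) : basis hs i = (i.weight s : ℂ) •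
    ((((i.left.map μ.real).sum : ℝ) : ℂ)⁻¹ • (i.left.map (cellIndicator o hs)).sum -
     (((i.right.map μ.real).sum : ℝ) : ℂ)⁻¹ • (i.right.map (cellIndicator o hs)).sum) := by
  have hl : ∀ l : List (Set I), (∀ P ∈ l, P ∈ G.cells (i.1 + 1)) →
      toLp o hs (l.map (cellIndicator o hs)).sum =ᵐ[μ]
        fun t => (l.map fun P => P.indicator (fun _ => (1 : ℂ)) t).sum := by
    intro l hl
    induction l with
    | nil =>
      simp only [List.map_nil, List.sum_nil, map_zero]
      exact Lp.coeFn_zero ℂ ∞ μ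
    | cons P l ih =>
      simp only [List.map_cons, List.sum_cons, map_add]
      filter_upwards [Lp.coeFn_add (toLp o hs (cellIndicator o hs P))
        (toLp o hs (l.map (cellIndicator o hs)).sum), ih fun R hR => hl R (by simp [hR]),
        coeFn_cellIndicator o hs (hl P (by simp))] with t h1 h2 h3
      rw [h1, Pi.add_apply, h2, h3]
  refine ext_ae ((coeFn_basis i).trans ?_)
  simp only [map_smul, map_sub]
  filter_upwards [hl i.left fun P hP => (i.mem_left hP).1,
    hl i.right fun P hP => (i.mem_right hP).1,
    Lp.coeFn_smul (i.weight s : ℂ) ((((i.left.map μ.real).sum : ℝ) : ℂ)⁻¹ •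
      toLp o hs (i.left.map (cellIndicator o hs)).sum - (((i.right.map μ.real).sum : ℝ) : ℂ)⁻¹ •
      toLp o hs (i.right.map (cellIndicator o hs)).sum),
    Lp.coeFn_sub ((((i.left.map μ.real).sum : ℝ) : ℂ)⁻¹ •
      toLp o hs (i.left.map (cellIndicator o hs)).sum) ((((i.right.map μ.real).sum : ℝ) : ℂ)⁻¹ •
      toLp o hs (i.right.map (cellIndicator o hs)).sum),
    Lp.coeFn_smul (((i.left.map μ.real).sum : ℝ) : ℂ)⁻¹
      (toLp o hs (i.left.map (cellIndicator o hs)).sum),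
    Lp.coeFn_smul (((i.right.map μ.real).sum : ℝ) : ℂ)⁻¹
      (toLp o hs (i.right.map (cellIndicator o hs)).sum)] with t h1 h2 h3 h4 h5 h6
  rw [h3, Pi.smul_apply, h4, Pi.sub_apply, h5, h6, Pi.smul_apply, Pi.smul_apply, h1, h2]
  simp only [smul_eq_mul, haar, familyDensity, div_eq_inv_mul]

/-- An element of `B^{-s}_{1,1}` is determined by its values on the indicators of cells. -/
theorem besovOne_ext_cells {φ χ : StrongDual ℂ (BesovInf o hs)} (hφ : φ ∈ besovOne o hs)
    (hχ : χ ∈ besovOne o hs)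
    (h : ∀ n, ∀ P ∈ G.cells n, φ (cellIndicator o hs P) = χ (cellIndicator o hs P)) : φ = χ := by
  refine besovOne_ext hφ hχ ?_ fun i => ?_
  · rw [← cellIndicator_univ]
    exact h 0 _ G.univ_mem_cells
  · have hl : ∀ l : List (Set I), (∀ P ∈ l, P ∈ G.cells (i.1 + 1)) →
        φ (l.map (cellIndicator o hs)).sum = χ (l.map (cellIndicator o hs)).sum := by
      intro l hl
      induction l with
      | nil => simp
      | cons P l ih =>
        simp only [List.map_cons, List.sum_cons, map_add]
        rw [ih fun R hR => hl R (by simp [hR]), h _ P (hl P (by simp))]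
    rw [basis_eq]
    simp only [map_smul, map_sub]
    rw [hl i.left fun P hP => (i.mem_left hP).1, hl i.right fun P hP => (i.mem_right hP).1]

end Indicators

section Estimates

variable {I : Type*} [MeasurableSpace I] {μ : Measure I} {G : GoodGrid μ} {o : G.ChildOrder}
  {s : ℝ} {hs : 0 < s} [IsProbabilityMeasure μ]

open BesovInf

theorem sum_shifted_geometric_le {r : ℝ} (h0 : 0 ≤ r) (h1 : r < 1) (n N : ℕ) :
    ∑ k ∈ Finset.range N, (if n ≤ k then r ^ (k - n) else 0) ≤ (1 - r)⁻¹ := by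
  rw [← Finset.sum_filter]
  have h2 : ∑ k ∈ (Finset.range N).filter (n ≤ ·), r ^ (k - n) =
      ∑ j ∈ Finset.range (N - n), r ^ j := by
    refine Finset.sum_bij' (fun k _ => k - n) (fun j _ => j + n) ?_ ?_ ?_ ?_ ?_
    · intro k hk
      simp only [Finset.mem_filter, Finset.mem_range] at hk ⊢
      omega
    · intro j hj
      simp only [Finset.mem_filter, Finset.mem_range] at hj ⊢
      omega
    · intro k hk
      simp only [Finset.mem_filter, Finset.mem_range] at hk
      omega
    · intro j hj
      omega
    · intro k hk; rfl
  rw [h2, ← tsum_geometric_of_lt_one h0 h1]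
  exact (summable_geometric_of_lt_one h0 h1).sum_le_tsum _ fun _ _ => pow_nonneg h0 _

theorem card_pairs_le (o : G.ChildOrder) {k : ℕ} (Q : {Q : Set I // Q ∈ G.cells k}) :
    (Fintype.card {p : List (Set I) × List (Set I) // p ∈ haarPairs (o.children k Q)} : ℝ) ≤
      G.lower⁻¹ := by
  classical
  obtain ⟨Q, hQ⟩ := Q
  have h1 : Fintype.card {p : List (Set I) × List (Set I) // p ∈ haarPairs (o.children k Q)}
      ≤ (G.cellsIn (k + 1) Q).card := by
    rw [Fintype.card_of_subtype (haarPairs (o.children k Q)).toFinset (by simp)]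
    refine (List.toFinset_card_le _).trans ((length_haarPairs_le _).trans
      ((Nat.sub_le _ _).trans (le_of_eq ?_)))
    rw [← List.toFinset_card_of_nodup (o.nodup k Q hQ)]
    congr 1
    ext R
    rw [List.mem_toFinset, mem_children_iff o hQ]
  refine (Nat.cast_le.2 h1).trans ?_
  rw [← one_div, le_div_iff₀ G.lower_pos]
  exact G.card_cellsIn_mul_le hQ

theorem sum_levelPair_le (o : G.ChildOrder) (k : ℕ) {f : Set I → ℝ} (hf : ∀ Q, 0 ≤ f Q) :
    ∑ i : LevelPair o k, f (HaarIndex.cell ⟨k, i⟩) ≤ G.lower⁻¹ * ∑ Q ∈ G.cells k, f Q := by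
  have h : ∑ i : LevelPair o k, f (HaarIndex.cell ⟨k, i⟩) =
      ∑ Q : {Q : Set I // Q ∈ G.cells k}, ∑ _p :
        {p : List (Set I) × List (Set I) // p ∈ haarPairs (o.children k Q)}, f Q.1 :=
    Fintype.sum_sigma (fun i : (Σ Q : {Q : Set I // Q ∈ G.cells k},
      {p : List (Set I) × List (Set I) // p ∈ haarPairs (o.children k Q)}) => f i.1.1)
  rw [h, ← Finset.sum_coe_sort (G.cells k), Finset.mul_sum]
  refine Finset.sum_le_sum fun Q _ => ?_
  rw [Finset.sum_const, nsmul_eq_mul, Finset.card_univ]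
  exact mul_le_mul_of_nonneg_right (card_pairs_le o Q) (hf _)

/-- The average over a cell, as a functional. -/
def average (o : G.ChildOrder) {s : ℝ} (hs : 0 < s) (P : Set I) : StrongDual ℂ (BesovInf o hs) :=
  (((μ.real P)⁻¹ : ℝ) : ℂ) • setIntegralFunctional o hs P

/-- The constant in the comparison of averages over nested cells. -/
def averageConst (G : GoodGrid μ) (s : ℝ) : ℝ :=
  G.lower⁻¹ * G.lower⁻¹ * (1 - G.upper ^ s)⁻¹

omit [IsProbabilityMeasure μ] in
theorem averageConst_nonneg (G : GoodGrid μ) (hs : 0 < s) : 0 ≤ averageConst G s := by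
  have := G.upper_rpow_lt_one hs
  have h2 := G.lower_pos
  have h3 : 0 < (1 - G.upper ^ s)⁻¹ := inv_pos.2 (by linarith)
  rw [averageConst]
  positivity

theorem average_apply {n : ℕ} {P : Set I} (hP : P ∈ G.cells n) (ψ : BesovInf o hs) :
    average o hs P ψ = constCoeff o hs ψ + ∑ i ∈ levels o n, (i.weight s : ℂ) * coeff hs i ψ *
      ((∫ t in P, haar i t ∂μ) / μ.real P) := by
  have h := (measureReal_cell_pos G n P hP).ne'
  have h' : (μ.real P : ℂ) ≠ 0 := by exact_mod_cast h
  have h1 : average o hs P ψ = (((μ.real P)⁻¹ : ℝ) : ℂ) * ∫ t in P, toLp o hs ψ t ∂μ := rfl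
  rw [h1, (isHaarRep_coeff ψ).setIntegral_cell hP, mul_add, Finset.mul_sum]
  push_cast
  congr 1
  · field_simp
  · refine Finset.sum_congr rfl fun i _ => ?_
    field_simp

theorem norm_average_sub_le {n N : ℕ} (hnN : n ≤ N) {P Q : Set I} (hP : P ∈ G.cells N)
    (hQ : Q ∈ G.cells n) (hPQ : P ⊆ Q) :
    ‖average o hs P - average o hs Q‖ ≤ averageConst G s * μ.real Q ^ s := by
  classical
  have hr0 := G.upper_rpow_nonneg s
  have hr1 := G.upper_rpow_lt_one hs
  have hQs : 0 ≤ μ.real Q ^ s := Real.rpow_nonneg measureReal_nonneg _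
  refine ContinuousLinearMap.opNorm_le_bound _
    (mul_nonneg (averageConst_nonneg G hs) hQs) fun ψ => ?_
  have hPp := measureReal_cell_pos G N P hP
  have hQp := measureReal_cell_pos G n Q hQ
  have hPc : (μ.real P : ℂ) ≠ 0 := by exact_mod_cast hPp.ne'
  have hQc : (μ.real Q : ℂ) ≠ 0 := by exact_mod_cast hQp.ne'
  have h1 : (average o hs P - average o hs Q) ψ = ∑ i ∈ levels o N, if n ≤ i.1 then
      (i.weight s : ℂ) * coeff hs i ψ * ((∫ t in P, haar i t ∂μ) / μ.real P) else 0 := by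
    have h2 : ∑ i ∈ levels o n, (i.weight s : ℂ) * coeff hs i ψ *
        ((∫ t in Q, haar i t ∂μ) / μ.real Q) = ∑ i ∈ levels o N, if n ≤ i.1 then 0 else
        (i.weight s : ℂ) * coeff hs i ψ * ((∫ t in P, haar i t ∂μ) / μ.real P) := by
      rw [← Finset.sum_subset (s₁ := levels o n)
        (fun i hi => mem_levels.2 ((mem_levels.1 hi).trans_le hnN)) (fun i _ hi =>
          if_pos (not_lt.1 fun h => hi (mem_levels.2 h)))]
      refine Finset.sum_congr rfl fun i hi => ?_
      have hi' := mem_levels.1 hi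
      rw [if_neg (not_le.2 hi')]
      congr 1
      have := mul_setIntegral_haar hQ hP hPQ hnN i hi'
      field_simp
      linear_combination -this
    rw [_root_.sub_apply, average_apply hP, average_apply hQ, h2, add_sub_add_left_eq_sub,
      ← Finset.sum_sub_distrib]
    refine Finset.sum_congr rfl fun i _ => ?_
    split_ifs <;> simp
  have h3 : ∀ i ∈ levels o N, ‖(if n ≤ i.1 then
      (i.weight s : ℂ) * coeff hs i ψ * ((∫ t in P, haar i t ∂μ) / μ.real P) else 0 : ℂ)‖ ≤
      (G.lower⁻¹ * ‖ψ‖) * (if n ≤ i.1 ∧ P ⊆ i.cell then μ.real i.cell ^ s else 0) := by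
    intro i hi
    have hi' := mem_levels.1 hi
    have hcs : 0 ≤ μ.real i.cell ^ s := Real.rpow_nonneg measureReal_nonneg _
    by_cases hn : n ≤ i.1
    · by_cases hsub : P ⊆ i.cell
      · rw [if_pos hn, if_pos ⟨hn, hsub⟩, norm_mul, norm_mul, norm_div, Complex.norm_real,
          Complex.norm_real, Real.norm_of_nonneg (i.weight_pos s).le, Real.norm_of_nonneg hPp.le]
        have h4 : ‖∫ t in P, haar i t ∂μ‖ / μ.real P ≤ 1 / (G.lower * μ.real i.cell) := by
          rw [div_le_iff₀ hPp, one_div_mul_eq_div]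
          exact norm_setIntegral_haar_le i (G.measurable_cells N P hP)
        calc i.weight s * ‖coeff hs i ψ‖ * (‖∫ t in P, haar i t ∂μ‖ / μ.real P)
            ≤ i.weight s * ‖ψ‖ * (1 / (G.lower * μ.real i.cell)) :=
              mul_le_mul (mul_le_mul_of_nonneg_left (norm_coeff_le i ψ) (i.weight_pos s).le) h4
                (by positivity) (mul_nonneg (i.weight_pos s).le (norm_nonneg _))
          _ = _ := by
            rw [i.weight_eq]
            have h5 := i.cell_pos.ne'
            have h6 := G.lower_pos.ne'
            field_simp
      · rw [setIntegral_haar_of_not_subset hP i hi'.le hsub, zero_div, mul_zero, ite_self,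
          norm_zero, if_neg (fun h => hsub h.2), mul_zero]
    · rw [if_neg hn, if_neg (fun h => hn h.1), norm_zero, mul_zero]
  have h4 : ∀ k ∈ Finset.range N, ∑ i : LevelPair o k, (if n ≤ k ∧
      P ⊆ HaarIndex.cell ⟨k, i⟩ then μ.real (HaarIndex.cell ⟨k, i⟩) ^ s else 0) ≤
      G.lower⁻¹ * μ.real Q ^ s * (if n ≤ k then (G.upper ^ s) ^ (k - n) else 0) := by
    intro k hk
    have hkN := Finset.mem_range.1 hk
    refine (sum_levelPair_le o k (f := fun R => if n ≤ k ∧ P ⊆ R then μ.real R ^ s else 0)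
      (fun R => ?_)).trans ?_
    · split_ifs
      · exact Real.rpow_nonneg measureReal_nonneg _
      · exact le_rfl
    · rw [mul_assoc]
      refine mul_le_mul_of_nonneg_left ?_ (inv_nonneg.2 G.lower_pos.le)
      by_cases hn : n ≤ k
      · obtain ⟨R, hR, hPR⟩ := G.exists_ancestor hkN.le hP
        rw [Finset.sum_eq_single R, if_pos ⟨hn, hPR⟩, if_pos hn, mul_comm]
        · exact G.rpow_measureReal_le hn hQ hR (G.subset_trans_cells hn hQ hR hP hPR hPQ) hs
        · intro R' hR' hne
          rw [if_neg]
          rintro ⟨_, h⟩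
          exact hne (G.eq_of_subset hR' hR hP h hPR)
        · intro h; exact absurd hR h
      · simp [hn]
  rw [h1]
  refine (norm_sum_le _ _).trans ((Finset.sum_le_sum h3).trans ?_)
  rw [← Finset.mul_sum, sum_levels]
  have h5 := (Finset.sum_le_sum h4).trans (le_of_eq (Finset.mul_sum _ _ _).symm)
  have h6 := sum_shifted_geometric_le hr0 hr1 n N
  have h7 : 0 ≤ G.lower⁻¹ := inv_nonneg.2 G.lower_pos.le
  refine (mul_le_mul_of_nonneg_left (h5.trans (mul_le_mul_of_nonneg_left h6
    (mul_nonneg h7 hQs))) (mul_nonneg h7 (norm_nonneg ψ))).trans (le_of_eq ?_)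
  rw [averageConst]
  ring

/-- The values of a functional on the indicators of cells have finite cost. -/
theorem sum_norm_cellIndicator_le (φ : StrongDual ℂ (BesovInf o hs)) (N : ℕ) :
    ∑ k ∈ Finset.range N, ∑ R ∈ G.cells k, μ.real R ^ s * ‖φ (cellIndicator o hs R)‖ ≤
      ((1 + G.lower⁻¹) * (1 - G.upper ^ s)⁻¹) * ‖φ‖ := by
  classical
  have hr0 := G.upper_rpow_nonneg s
  have hr1 := G.upper_rpow_lt_one hs
  have hL : 0 ≤ G.lower⁻¹ := inv_nonneg.2 G.lower_pos.le
  have hr : 0 < (1 - G.upper ^ s)⁻¹ := inv_pos.2 (by linarith)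
  have hR0 : ∀ R : Set I, 0 ≤ μ.real R ^ s := fun R => Real.rpow_nonneg measureReal_nonneg _
  choose ε hε hε' using fun R : Set I => exists_phase (φ (cellIndicator o hs R))
  set ψ : BesovInf o hs := ∑ k ∈ Finset.range N, ∑ R ∈ G.cells k,
    (((μ.real R ^ s : ℝ) : ℂ) * ε R) • cellIndicator o hs R with hψ
  have h1 : φ ψ = ((∑ k ∈ Finset.range N, ∑ R ∈ G.cells k,
      μ.real R ^ s * ‖φ (cellIndicator o hs R)‖ : ℝ) : ℂ) := by
    simp only [hψ, map_sum, map_smul, smul_eq_mul, mul_assoc, hε', Complex.ofReal_sum,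
      Complex.ofReal_mul]
  have hcoef : ∀ (c : StrongDual ℂ (BesovInf o hs)) (f : ℕ → ℝ),
      (∀ k ∈ Finset.range N,
        ∑ R ∈ G.cells k, μ.real R ^ s * ‖c (cellIndicator o hs R)‖ ≤ f k) →
      ‖c ψ‖ ≤ ∑ k ∈ Finset.range N, f k := by
    intro c f hf
    rw [hψ, map_sum]
    refine (norm_sum_le _ _).trans (Finset.sum_le_sum fun k hk => ?_)
    rw [map_sum]
    refine (norm_sum_le _ _).trans (le_trans (Finset.sum_le_sum fun R _ => ?_) (hf k hk))
    rw [map_smul, smul_eq_mul, norm_mul, norm_mul, Complex.norm_real,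
      Real.norm_of_nonneg (hR0 R)]
    exact mul_le_mul_of_nonneg_right (mul_le_of_le_one_right (hR0 R) (hε R)) (norm_nonneg _)
  have h2 : ‖constCoeff o hs ψ‖ ≤ (1 - G.upper ^ s)⁻¹ := by
    refine (hcoef _ (fun k => if 0 ≤ k then (G.upper ^ s) ^ (k - 0) else 0) ?_).trans
      (sum_shifted_geometric_le hr0 hr1 0 N)
    intro k _
    rw [if_pos (Nat.zero_le k)]
    have : ∀ R ∈ G.cells k, μ.real R ^ s * ‖constCoeff o hs (cellIndicator o hs R)‖ ≤
        (G.upper ^ s) ^ (k - 0) * μ.real R := by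
      intro R hR
      rw [constCoeff_cellIndicator hR, Complex.norm_real, Real.norm_of_nonneg measureReal_nonneg]
      refine mul_le_mul_of_nonneg_right ?_ measureReal_nonneg
      have := G.rpow_measureReal_le (Nat.zero_le k) G.univ_mem_cells hR (Set.subset_univ R) hs
      simpa using this
    refine (Finset.sum_le_sum this).trans (le_of_eq ?_)
    rw [← Finset.mul_sum, G.sum_cells, mul_one]
  have h3 : ∀ j, ‖coeff hs j ψ‖ ≤ G.lower⁻¹ * (1 - G.upper ^ s)⁻¹ := by
    intro j
    refine (hcoef _ (fun k => G.lower⁻¹ * if j.1 ≤ k then (G.upper ^ s) ^ (k - j.1) else 0)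
      ?_).trans ?_
    · intro k _
      have hterm : ∀ R ∈ G.cells k, μ.real R ^ s * ‖coeff hs j (cellIndicator o hs R)‖ ≤
          if R ⊆ j.cell then (G.lower⁻¹ * if j.1 ≤ k then (G.upper ^ s) ^ (k - j.1) else 0) *
            (μ.real R / μ.real j.cell) else 0 := by
        intro R hR
        rw [coeff_cellIndicator hR]
        rcases le_or_gt k j.1 with hkj | hkj
        · rw [setIntegral_haar_of_le hR j hkj, mul_zero, norm_zero, mul_zero]
          have h8 : 0 ≤ (G.lower⁻¹ * if j.1 ≤ k then (G.upper ^ s) ^ (k - j.1) else 0) := by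
            split_ifs
            · positivity
            · simp
          refine ite_nonneg ?_ le_rfl
          exact mul_nonneg h8 (div_nonneg measureReal_nonneg measureReal_nonneg)
        · by_cases hsub : R ⊆ j.cell
          · rw [if_pos hsub, if_pos hkj.le, norm_mul, norm_inv, Complex.norm_real,
              Real.norm_of_nonneg (weight_mul_energy_pos j).le]
            have hjs : 0 < μ.real j.cell ^ s := Real.rpow_pos_of_pos j.cell_pos s
            have h4 : (j.weight s * j.energy)⁻¹ ≤ (μ.real j.cell ^ s)⁻¹ := by
              refine inv_anti₀ hjs ?_
              rw [j.weight_eq]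
              have := mul_le_mul_of_nonneg_left j.one_le_energy hjs.le
              linarith
            have h5 := norm_setIntegral_haar_le j (G.measurable_cells k R hR)
            have h6 := G.rpow_measureReal_le hkj.le j.cell_mem hR hsub hs
            have h7 : (j.weight s * j.energy)⁻¹ * ‖∫ t in R, haar j t ∂μ‖ ≤
                (μ.real j.cell ^ s)⁻¹ * (μ.real R / (G.lower * μ.real j.cell)) :=
              mul_le_mul h4 h5 (norm_nonneg _) (inv_nonneg.2 hjs.le)
            refine (mul_le_mul h6 h7 (mul_nonneg (inv_nonneg.2 (weight_mul_energy_pos j).le)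
              (norm_nonneg _)) (mul_nonneg (pow_nonneg hr0 _) hjs.le)).trans (le_of_eq ?_)
            have h8 := j.cell_pos.ne'
            have h9 := G.lower_pos.ne'
            field_simp
          · rw [setIntegral_haar_of_not_subset hR j hkj.le hsub, mul_zero, norm_zero, mul_zero,
              if_neg hsub]
      refine (Finset.sum_le_sum hterm).trans ?_
      rw [← Finset.sum_filter, ← Finset.mul_sum, ← Finset.sum_div]
      by_cases hjk : j.1 ≤ k
      · have : ∑ R ∈ (G.cells k).filter (· ⊆ j.cell), μ.real R = μ.real j.cell := by
          rw [← G.sum_cellsIn hjk j.cell_mem]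
          refine Finset.sum_congr ?_ fun _ _ => rfl
          ext R
          rw [Finset.mem_filter, G.mem_cellsIn]
        rw [this, div_self j.cell_pos.ne', mul_one]
      · simp [hjk]
    · rw [← Finset.mul_sum]
      exact mul_le_mul_of_nonneg_left (sum_shifted_geometric_le hr0 hr1 _ _) hL
  have h4 := norm_le_add (mul_nonneg hL hr.le) h2 h3
  have h5 := φ.le_opNorm ψ
  rw [h1, Complex.norm_real, Real.norm_of_nonneg (Finset.sum_nonneg fun k _ =>
    Finset.sum_nonneg fun R _ => mul_nonneg (hR0 R) (norm_nonneg _))] at h5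
  refine h5.trans ?_
  rw [mul_comm]
  refine mul_le_mul_of_nonneg_right (h4.trans (le_of_eq ?_)) (norm_nonneg _)
  ring

end Estimates

end GoodGrid

end

noncomputable section

namespace GoodGrid

section Diracs

variable {I : Type*} [MeasurableSpace I] {μ : Measure I} {G : GoodGrid μ} {o : G.ChildOrder}
  {s : ℝ} {hs : 0 < s}

open BesovInf

theorem Path.cell_subset (x : G.Path) {n N : ℕ} (h : n ≤ N) : x.cell N ⊆ x.cell n := by
  induction N, h using Nat.le_induction with
  | base => exact subset_rfl
  | succ N _ ih => exact (x.cell_succ_subset N).trans ih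

variable [IsProbabilityMeasure μ]

theorem Path.cell_eq (x : G.Path) {n N : ℕ} (h : n ≤ N) {P : Set I} (hP : P ∈ G.cells n)
    (hsub : x.cell N ⊆ P) : x.cell n = P :=
  G.eq_of_subset (x.cell_mem n) hP (x.cell_mem N) (x.cell_subset h) hsub

theorem Path.inFamily_iff (x : G.Path) {n : ℕ} {S : List (Set I)} (hS : ∀ P ∈ S, P ∈ G.cells n) :
    x.InFamily S ↔ x.cell n ∈ S := by
  constructor
  · rintro ⟨j, hj⟩
    rwa [← G.level_unique (x.cell_mem j) (hS _ hj)]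
  · exact fun h => ⟨n, h⟩

theorem Path.rpow_cell_le (x : G.Path) (hs : 0 < s) (n : ℕ) :
    μ.real (x.cell n) ^ s ≤ (G.upper ^ s) ^ n := by
  simpa using G.rpow_measureReal_le (Nat.zero_le n) G.univ_mem_cells (x.cell_mem n)
    (Set.subset_univ _) hs

theorem Path.tendsto_rpow_cell (x : G.Path) (hs : 0 < s) (C : ℝ) :
    Tendsto (fun n => C * μ.real (x.cell n) ^ s) atTop (𝓝 0) := by
  have h1 : Tendsto (fun n => μ.real (x.cell n) ^ s) atTop (𝓝 0) :=
    squeeze_zero (fun n => Real.rpow_nonneg measureReal_nonneg _) (x.rpow_cell_le hs)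
      (tendsto_pow_atTop_nhds_zero_of_lt_one (G.upper_rpow_nonneg s) (G.upper_rpow_lt_one hs))
  simpa using h1.const_mul C

theorem tendsto_cellAverage (x : G.Path) :
    Tendsto (cellAverage o hs x) atTop (𝓝 (dirac o hs x)) := by
  refine CauchySeq.tendsto_limUnder ?_
  refine cauchySeq_of_le_tendsto_0' (fun n => averageConst G s * μ.real (x.cell n) ^ s)
    (fun n N h => ?_) (x.tendsto_rpow_cell hs _)
  rw [dist_comm, dist_eq_norm]
  exact norm_average_sub_le h (x.cell_mem N) (x.cell_mem n) (x.cell_subset h)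

theorem norm_dirac_sub_average_le (x : G.Path) (n : ℕ) :
    ‖dirac o hs x - average o hs (x.cell n)‖ ≤ averageConst G s * μ.real (x.cell n) ^ s := by
  refine le_of_tendsto ((tendsto_cellAverage x).sub_const _).norm ?_
  filter_upwards [eventually_ge_atTop n] with N h
  exact norm_average_sub_le h (x.cell_mem N) (x.cell_mem n) (x.cell_subset h)

theorem average_mem_besovOne (P : Set I) : average o hs P ∈ besovOne o hs :=
  (besovOneSubmodule o hs).smul_mem _ (setIntegralFunctional_mem_besovOne P)

theorem dirac_mem_besovOne (x : G.Path) : dirac o hs x ∈ besovOne o hs :=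
  isClosed_besovOne.mem_of_tendsto (tendsto_cellAverage x)
    (Eventually.of_forall fun _ => average_mem_besovOne _)

theorem tendsto_besovOneNorm_cellAverage_sub (x : G.Path) :
    Tendsto (fun j => besovOneNorm (cellAverage o hs x j - dirac o hs x)) atTop (𝓝 0) := by
  have h := ((tendsto_iff_norm_sub_tendsto_zero.1 (tendsto_cellAverage (o := o) (hs := hs) x))
    ).const_mul 2
  rw [mul_zero] at h
  refine squeeze_zero (fun _ => besovOneNorm_nonneg _) (fun j => besovOneNorm_le ?_) h
  exact (besovOneSubmodule o hs).sub_mem (average_mem_besovOne _) (dirac_mem_besovOne x)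

theorem setIntegralFunctional_cellIndicator (A : Set I) {n : ℕ} {P : Set I}
    (hP : P ∈ G.cells n) :
    setIntegralFunctional o hs A (cellIndicator o hs P) = μ.real (A ∩ P) := by
  rw [setIntegralFunctional_apply,
    integral_congr_ae (ae_restrict_of_ae (coeFn_cellIndicator o hs hP)),
    setIntegral_indicator (G.measurable_cells n P hP)]
  simp

open Classical in
theorem dirac_cellIndicator (x : G.Path) {n : ℕ} {P : Set I} (hP : P ∈ G.cells n) :
    dirac o hs x (cellIndicator o hs P) = if x.cell n = P then 1 else 0 := by
  have h1 : Tendsto (fun j => cellAverage o hs x j (cellIndicator o hs P)) atTop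
      (𝓝 (dirac o hs x (cellIndicator o hs P))) :=
    ((ContinuousLinearMap.apply ℂ ℂ (cellIndicator o hs P)).continuous.tendsto _).comp
      (tendsto_cellAverage x)
  refine tendsto_nhds_unique h1 (tendsto_const_nhds.congr' ?_)
  filter_upwards [eventually_ge_atTop n] with j hj
  have h2 : cellAverage o hs x j (cellIndicator o hs P) =
      (((μ.real (x.cell j))⁻¹ : ℝ) : ℂ) * μ.real (x.cell j ∩ P) := by
    rw [← setIntegralFunctional_cellIndicator (x.cell j) hP]
    rfl
  rw [h2]
  by_cases h : x.cell n = P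
  · have h3 := (measureReal_cell_pos G j _ (x.cell_mem j)).ne'
    rw [if_pos h, Set.inter_eq_left.2 (h ▸ x.cell_subset hj), ← Complex.ofReal_mul,
      inv_mul_cancel₀ h3, Complex.ofReal_one]
  · rw [if_neg h, G.inter_eq_zero_of_not_subset hj hP (x.cell_mem j)
      fun h' => h (x.cell_eq hj hP h')]
    simp

theorem norm_dirac_le (x : G.Path) : ‖dirac o hs x‖ ≤ 1 + averageConst G s := by
  have h1 := norm_dirac_sub_average_le (o := o) (hs := hs) x 0
  rw [x.cell_zero] at h1
  have h2 : ‖average o hs (Set.univ : Set I)‖ ≤ 1 := by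
    refine ContinuousLinearMap.opNorm_le_bound _ zero_le_one fun ψ => ?_
    have : average o hs Set.univ ψ = constCoeff o hs ψ := by
      rw [average, _root_.smul_apply, constCoeff]
      simp
    rw [this, one_mul]
    exact norm_constCoeff_le ψ
  have h3 : ‖dirac o hs x‖ ≤ ‖dirac o hs x - average o hs Set.univ‖ +
      ‖average o hs (Set.univ : Set I)‖ := norm_le_norm_sub_add _ _
  rw [probReal_univ, Real.one_rpow, mul_one] at h1
  linarith

/-! ### Particle systems -/

theorem sum_mem_of_hasSum {ι E : Type*} [NormedAddCommGroup E] [NormedSpace ℂ E]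
    {S : Submodule ℂ E} (hS : IsClosed (S : Set E)) {f : ι → E} (hf : ∀ i, f i ∈ S) {a : E}
    (h : HasSum f a) : a ∈ S :=
  hS.mem_of_tendsto h (Eventually.of_forall fun _ => S.sum_mem fun i _ => hf i)

theorem particleSystems_eq (o : G.ChildOrder) (hs : 0 < s) : particleSystems o hs =
    ((Submodule.span ℂ (Set.range (dirac o hs))).topologicalClosure :
      Set (StrongDual ℂ (BesovInf o hs))) := by
  have h : ∀ γ : StrongDual ℂ (BesovInf o hs),
      IsFiniteConfiguration γ ↔ γ ∈ Submodule.span ℂ (Set.range (dirac o hs)) := by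
    intro γ
    constructor
    · rintro ⟨n, m, x, rfl⟩
      exact Submodule.sum_mem _ fun i _ =>
        Submodule.smul_mem _ _ (Submodule.subset_span ⟨x i, rfl⟩)
    · intro hγ
      rw [Submodule.mem_span_set'] at hγ
      obtain ⟨n, m, g, rfl⟩ := hγ
      choose x hx using fun i => (g i).2
      exact ⟨n, m, x, Finset.sum_congr rfl fun i _ => by rw [hx]⟩
  ext γ
  rw [Submodule.topologicalClosure_coe, mem_closure_iff_seq_limit]
  simp only [particleSystems, Set.mem_ofPred_eq, h, SetLike.mem_coe]

theorem setIntegralFunctional_eq_sum {k n : ℕ} (hkn : k ≤ n) {P : Set I} (hP : P ∈ G.cells k) :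
    setIntegralFunctional o hs P = ∑ R ∈ G.cellsIn n P, setIntegralFunctional o hs R := by
  ext ψ
  have hi : Integrable (toLp o hs ψ) μ := (Lp.memLp (toLp o hs ψ)).integrable le_top
  have hind : ∀ (A : Set I) t, A.indicator (toLp o hs ψ) t =
      A.indicator (fun _ => (1 : ℂ)) t * toLp o hs ψ t := by
    intro A t
    by_cases h : t ∈ A <;> simp [h]
  have hR := fun R (h : R ∈ G.cellsIn n P) => G.measurable_cells n R (G.mem_cellsIn.1 h).1
  rw [_root_.sum_apply]
  simp only [setIntegralFunctional_apply]
  rw [← integral_indicator (G.measurable_cells k P hP),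
    Finset.sum_congr rfl fun R h => (integral_indicator (f := toLp o hs ψ) (hR R h)).symm,
    ← integral_finsetSum _ fun R h => hi.indicator (hR R h)]
  refine integral_congr_ae ?_
  filter_upwards [G.indicator_ae_eq_sum hkn hP] with t ht
  simp only [hind]
  rw [ht, Finset.sum_mul]

theorem setIntegralFunctional_mem_closure_span {k : ℕ} {P : Set I} (hP : P ∈ G.cells k) :
    setIntegralFunctional o hs P ∈
      (Submodule.span ℂ (Set.range (dirac o hs))).topologicalClosure := by
  have hpath : ∀ R : Set I, ∃ x : G.Path, ∀ n, R ∈ G.cells n → x.cell n = R := by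
    intro R
    by_cases h : ∃ n, R ∈ G.cells n
    · obtain ⟨n, hn⟩ := h
      obtain ⟨x, hx⟩ := G.exists_path hn
      refine ⟨x, fun m hm => ?_⟩
      rw [← G.level_unique hn hm]
      exact hx
    · obtain ⟨x, _⟩ := G.exists_path G.univ_mem_cells
      exact ⟨x, fun n hn => absurd ⟨n, hn⟩ h⟩
  choose x hx using hpath
  set D := Submodule.span ℂ (Set.range (dirac o hs))
  have hr0 := G.upper_rpow_nonneg s
  refine D.isClosed_topologicalClosure.mem_of_tendsto (b := atTop)
    (f := fun n => ∑ R ∈ G.cellsIn n P, (μ.real R : ℂ) • dirac o hs (x R)) ?_ ?_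
  · rw [tendsto_iff_norm_sub_tendsto_zero]
    have h0 : Tendsto (fun n => averageConst G s * (G.upper ^ s) ^ n) atTop (𝓝 0) := by
      simpa using (tendsto_pow_atTop_nhds_zero_of_lt_one hr0
        (G.upper_rpow_lt_one hs)).const_mul (averageConst G s)
    refine squeeze_zero' (Eventually.of_forall fun _ => norm_nonneg _) ?_ h0
    filter_upwards [eventually_ge_atTop k] with n hn
    rw [setIntegralFunctional_eq_sum hn hP, ← Finset.sum_sub_distrib]
    have hterm : ∀ R ∈ G.cellsIn n P, ‖(μ.real R : ℂ) • dirac o hs (x R) -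
        setIntegralFunctional o hs R‖ ≤ (averageConst G s * (G.upper ^ s) ^ n) * μ.real R := by
      intro R hR
      have hRn := (G.mem_cellsIn.1 hR).1
      have hpos := measureReal_cell_pos G n R hRn
      have h1 : setIntegralFunctional o hs R = (μ.real R : ℂ) • average o hs R := by
        rw [average, smul_smul, ← Complex.ofReal_mul, mul_inv_cancel₀ hpos.ne',
          Complex.ofReal_one, one_smul]
      have h2 : (μ.real R : ℂ) • dirac o hs (x R) - (μ.real R : ℂ) • average o hs R =
          (μ.real R : ℂ) • (dirac o hs (x R) - average o hs R) := (smul_sub _ _ _).symm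
      rw [h1, h2, norm_smul, Complex.norm_real, Real.norm_of_nonneg hpos.le, mul_comm]
      refine mul_le_mul_of_nonneg_right ?_ hpos.le
      have h4 := norm_dirac_sub_average_le (o := o) (hs := hs) (x R) n
      rw [hx R n hRn] at h4
      refine h4.trans (mul_le_mul_of_nonneg_left ?_ (averageConst_nonneg G hs))
      have h3 := (x R).rpow_cell_le hs n
      rwa [hx R n hRn] at h3
    refine (norm_sum_le _ _).trans ((Finset.sum_le_sum hterm).trans ?_)
    rw [← Finset.mul_sum, G.sum_cellsIn hn hP]
    exact mul_le_of_le_one_right (mul_nonneg (averageConst_nonneg G hs) (pow_nonneg hr0 n))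
      measureReal_le_one
  · exact Eventually.of_forall fun n => D.le_topologicalClosure (Submodule.sum_mem _ fun R _ =>
      Submodule.smul_mem _ _ (Submodule.subset_span ⟨x R, rfl⟩))

theorem coeff_mem_of_cells (S : Submodule ℂ (StrongDual ℂ (BesovInf o hs)))
    (h : ∀ n, ∀ P ∈ G.cells n, setIntegralFunctional o hs P ∈ S) (i : HaarIndex o) :
    coeff hs i ∈ S := by
  have hl : ∀ l : List (Set I), (∀ P ∈ l, P ∈ G.cells (i.1 + 1)) →
      (l.map (setIntegralFunctional o hs)).sum ∈ S := by
    intro l hl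
    refine list_sum_mem fun φ hφ => ?_
    obtain ⟨P, hP, rfl⟩ := List.mem_map.1 hφ
    exact h _ P (hl P hP)
  exact S.smul_mem _ (S.sub_mem (S.smul_mem _ (hl _ fun P hP => (i.mem_left hP).1))
    (S.smul_mem _ (hl _ fun P hP => (i.mem_right hP).1)))

/-- A closed subspace that contains the functionals given by cells contains `B^{-s}_{1,1}`. -/
theorem besovOne_subset_of_cells (S : Submodule ℂ (StrongDual ℂ (BesovInf o hs)))
    (hS : IsClosed (S : Set (StrongDual ℂ (BesovInf o hs))))
    (h : ∀ n, ∀ P ∈ G.cells n, setIntegralFunctional o hs P ∈ S) :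
    besovOne o hs ⊆ S := by
  classical
  intro φ hφ
  have hsum : Summable fun i => φ (basis hs i) • coeff hs i := by
    refine Summable.of_norm_bounded (summable_norm_basis φ) fun i => ?_
    rw [norm_smul]
    refine mul_le_of_le_one_right (norm_nonneg _)
      (ContinuousLinearMap.opNorm_le_bound _ zero_le_one fun ψ => ?_)
    rw [one_mul]
    exact norm_coeff_le i ψ
  have hmem : ∀ T : Submodule ℂ (StrongDual ℂ (BesovInf o hs)),
      IsClosed (T : Set (StrongDual ℂ (BesovInf o hs))) →
      (∀ n, ∀ P ∈ G.cells n, setIntegralFunctional o hs P ∈ T) →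
      φ (one o hs) • constCoeff o hs + ∑' i, φ (basis hs i) • coeff hs i ∈ T := by
    intro T hT hc
    refine T.add_mem (T.smul_mem _ (hc 0 _ G.univ_mem_cells)) ?_
    exact sum_mem_of_hasSum hT (fun i => T.smul_mem _ (coeff_mem_of_cells T hc i)) hsum.hasSum
  have happly : ∀ ψ, (φ (one o hs) • constCoeff o hs + ∑' i, φ (basis hs i) • coeff hs i) ψ =
      φ (one o hs) * constCoeff o hs ψ + ∑' i, φ (basis hs i) * coeff hs i ψ := by
    intro ψ
    have := (ContinuousLinearMap.apply ℂ ℂ ψ).map_tsum hsum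
    rw [_root_.add_apply]
    congr 1
  have heq : φ = φ (one o hs) • constCoeff o hs + ∑' i, φ (basis hs i) • coeff hs i := by
    refine besovOne_ext hφ (hmem (besovOneSubmodule o hs) isClosed_besovOne
      fun _ P _ => setIntegralFunctional_mem_besovOne P) ?_ fun j => ?_
    · rw [happly]
      simp [constCoeff_one, coeff_one]
    · rw [happly, tsum_eq_single j]
      · simp [constCoeff_basis, coeff_basis]
      · intro i hi
        rw [coeff_basis, if_neg (Ne.symm hi), mul_zero]
  rw [heq]
  exact hmem S hS h

theorem besovOne_eq_particleSystems (o : G.ChildOrder) (hs : 0 < s) :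
    besovOne o hs = particleSystems o hs := by
  rw [particleSystems_eq]
  refine Set.Subset.antisymm ?_ ?_
  · exact besovOne_subset_of_cells _ (Submodule.isClosed_topologicalClosure _)
      fun n P hP => setIntegralFunctional_mem_closure_span hP
  · refine Submodule.topologicalClosure_minimal (t := besovOneSubmodule o hs) _ ?_
      isClosed_besovOne
    rw [Submodule.span_le]
    rintro _ ⟨x, rfl⟩
    exact dirac_mem_besovOne x

end Diracs

end GoodGrid

end

noncomputable section

theorem exists_haarPairs_singleton {α : Type*} (l : List α) (hl : 2 ≤ l.length) :
    ∀ a ∈ l, ∃ p ∈ haarPairs l, p.1 = [a] ∨ p.2 = [a] := by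
  induction l using haarPairs.induct with
  | case1 l h ih1 ih2 =>
    intro a ha
    rw [haarPairs_of_length h]
    rw [← List.take_append_drop (l.length / 2) l, List.mem_append] at ha
    have hsingle : ∀ m : List α, a ∈ m → ¬ 2 ≤ m.length → m = [a] := by
      intro m hm hlen
      match m, hlen, hm with
      | [b], _, hm => rw [List.mem_singleton.1 hm]
      | b :: b' :: m, hlen, _ => simp at hlen
    rcases ha with ha | ha
    · by_cases h' : 2 ≤ (l.take (l.length / 2)).length
      · obtain ⟨p, hp, hpa⟩ := ih1 h' a ha
        exact ⟨p, by simp [hp], hpa⟩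
      · exact ⟨_, List.mem_cons_self, Or.inl (hsingle _ ha h')⟩
    · by_cases h' : 2 ≤ (l.drop (l.length / 2)).length
      · obtain ⟨p, hp, hpa⟩ := ih2 h' a ha
        exact ⟨p, by simp [hp], hpa⟩
      · exact ⟨_, List.mem_cons_self, Or.inr (hsingle _ ha h')⟩
  | case2 l h => exact absurd hl h

namespace GoodGrid

section Dipoles

variable {I : Type*} [MeasurableSpace I] {μ : Measure I} {G : GoodGrid μ} {o : G.ChildOrder}
  {s : ℝ} {hs : 0 < s}

open BesovInf

theorem left_mem_nodes {k : ℕ} {Q : Set I} (hQ : Q ∈ G.cells k) {p : List (Set I) × List (Set I)}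
    (hp : p ∈ haarPairs (o.children k Q)) : p.1 ∈ nodes o :=
  Or.inr ⟨⟨k, ⟨⟨Q, hQ⟩, ⟨p, hp⟩⟩⟩, Or.inl rfl⟩

theorem right_mem_nodes {k : ℕ} {Q : Set I} (hQ : Q ∈ G.cells k)
    {p : List (Set I) × List (Set I)} (hp : p ∈ haarPairs (o.children k Q)) : p.2 ∈ nodes o :=
  Or.inr ⟨⟨k, ⟨⟨Q, hQ⟩, ⟨p, hp⟩⟩⟩, Or.inr rfl⟩

theorem sum_haarPairs {M : Type*} [AddCommMonoid M] (o : G.ChildOrder) (k : ℕ)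
    (g : HaarIndex o → M) (g' : Set I → List (Set I) × List (Set I) → M)
    (hg : ∀ (Q : {Q : Set I // Q ∈ G.cells k})
      (p : {p : List (Set I) × List (Set I) // p ∈ haarPairs (o.children k Q)}),
      g ⟨k, ⟨Q, p⟩⟩ = g' Q.1 p.1) :
    ∑ i : LevelPair o k, g ⟨k, i⟩ =
      ∑ Q ∈ G.cells k, ((haarPairs (o.children k Q)).map (g' Q)).sum := by
  classical
  have h : ∑ i : LevelPair o k, g ⟨k, i⟩ =
      ∑ Q : {Q : Set I // Q ∈ G.cells k}, ∑ p :
        {p : List (Set I) × List (Set I) // p ∈ haarPairs (o.children k Q)}, g ⟨k, ⟨Q, p⟩⟩ :=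
    Fintype.sum_sigma (fun i : (Σ Q : {Q : Set I // Q ∈ G.cells k},
      {p : List (Set I) × List (Set I) // p ∈ haarPairs (o.children k Q)}) => g ⟨k, i⟩)
  rw [h, ← Finset.sum_coe_sort (G.cells k)]
  refine Finset.sum_congr rfl fun Q _ => ?_
  rw [Finset.sum_congr rfl fun p _ => hg Q p,
    ← List.sum_toFinset _ (haarPairs_nodup (o.nodup k Q.1 Q.2)),
    Finset.sum_subtype (p := (· ∈ haarPairs (o.children k Q.1)))]
  simp

variable [IsProbabilityMeasure μ]

theorem two_le_length_children (o : G.ChildOrder) {k : ℕ} {Q : Set I} (hQ : Q ∈ G.cells k) :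
    2 ≤ (o.children k Q).length := by
  by_contra hlt
  have h1 := sum_map_children o hQ μ.real
  rw [G.sum_cellsIn (Nat.le_succ k) hQ] at h1
  have hpos := measureReal_cell_pos G k Q hQ
  have hm := o.mem_children k Q hQ
  match hl : o.children k Q, hlt with
  | [], _ =>
    rw [hl] at h1
    simp at h1
    linarith
  | [R], _ =>
    rw [hl] at h1 hm
    have hR := (hm R).1 (by simp)
    have h2 := G.le_upper_mul hQ hR.1 hR.2
    simp at h1
    nlinarith [G.upper_lt_one]
  | R :: R' :: l, hlt => simp at hlt

theorem singleton_mem_nodes (o : G.ChildOrder) {k : ℕ} {Q : Set I} (hQ : Q ∈ G.cells k) :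
    [Q] ∈ nodes o := by
  cases k with
  | zero => exact Or.inl (by rw [G.eq_univ_of_mem_cells_zero hQ])
  | succ k =>
    obtain ⟨P, hP, hQP⟩ := G.nested k Q hQ
    obtain ⟨p, hp, h | h⟩ := exists_haarPairs_singleton _ (two_le_length_children o hP) Q
      ((o.mem_children k P hP Q).2 ⟨hQ, hQP⟩)
    · rw [← h]; exact left_mem_nodes hP hp
    · rw [← h]; exact right_mem_nodes hP hp

namespace DipoleBasis

variable (b : DipoleBasis o)

theorem point_singleton_cell {k : ℕ} {Q : Set I} (hQ : Q ∈ G.cells k) :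
    (b.point [Q]).cell k = Q := by
  have h := b.point_mem [Q] (singleton_mem_nodes o hQ)
  rw [Path.inFamily_iff _ (n := k) (by simpa using hQ)] at h
  simpa using h

theorem point_cell_of_mem_nodes {i : HaarIndex o} {S : List (Set I)}
    (hS : ∀ P ∈ S, P ∈ G.cells (i.1 + 1) ∧ P ⊆ i.cell) (hn : S ∈ nodes o) :
    (b.point S).cell i.1 = i.cell := by
  have h := b.point_mem S hn
  rw [Path.inFamily_iff _ fun P hP => (hS P hP).1] at h
  exact (b.point S).cell_eq (Nat.le_succ _) i.cell_mem (hS _ h).2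

theorem norm_dipole_le (hs : 0 < s) (i : HaarIndex o) :
    ‖b.dipole hs i‖ ≤ 2 * averageConst G s * μ.real i.cell ^ s := by
  have h1 := norm_dirac_sub_average_le (o := o) (hs := hs) (b.point i.left) i.1
  have h2 := norm_dirac_sub_average_le (o := o) (hs := hs) (b.point i.right) i.1
  rw [b.point_cell_of_mem_nodes (fun _ h => i.mem_left h) (left_mem_nodes i.cell_mem i.pair_mem)]
    at h1
  rw [b.point_cell_of_mem_nodes (fun _ h => i.mem_right h)
    (right_mem_nodes i.cell_mem i.pair_mem)] at h2
  have h3 : b.dipole hs i = (dirac o hs (b.point i.left) - average o hs i.cell) -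
      (dirac o hs (b.point i.right) - average o hs i.cell) := by
    rw [dipole]; abel
  rw [h3]
  refine (norm_sub_le _ _).trans ?_
  linarith

theorem partialSum_eq (m₀ : ℂ) (m : HaarIndex o → ℂ) (N : ℕ) :
    b.partialSum hs m₀ m N = m₀ • b.root hs + ∑ i ∈ levels o N, m i • b.dipole hs i := by
  rw [partialSum, sum_levels]

/-- A dipole series of finite cost converges in the norm of the dual, to an element of
`B^{-s}_{1,1}` whose norm is controlled by the cost. -/
theorem exists_tendsto_partialSum (hs : 0 < s) (m₀ : ℂ) {m : HaarIndex o → ℂ}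
    (hm : b.HasFiniteCost s m) : ∃ φ ∈ besovOne o hs,
      Tendsto (b.partialSum hs m₀ m) atTop (𝓝 φ) ∧
      ‖φ‖ ≤ (1 + 2 * averageConst G s) *
        (‖m₀‖ + ∑' i : HaarIndex o, μ.real i.cell ^ s * ‖m i‖) := by
  have hC := averageConst_nonneg G hs
  have hbound : ∀ i, ‖m i • b.dipole hs i‖ ≤
      2 * averageConst G s * (μ.real i.cell ^ s * ‖m i‖) := by
    intro i
    rw [norm_smul]
    calc ‖m i‖ * ‖b.dipole hs i‖ ≤ ‖m i‖ * (2 * averageConst G s * μ.real i.cell ^ s) :=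
          mul_le_mul_of_nonneg_left (b.norm_dipole_le hs i) (norm_nonneg _)
      _ = _ := by ring
  have hm' : Summable fun i => 2 * averageConst G s * (μ.real (HaarIndex.cell i) ^ s * ‖m i‖) :=
    Summable.mul_left _ hm
  have hsum : Summable fun i => m i • b.dipole hs i := Summable.of_norm_bounded hm' hbound
  have hroot : b.root hs ∈ besovOneSubmodule o hs := dirac_mem_besovOne _
  have hdip : ∀ i, b.dipole hs i ∈ besovOneSubmodule o hs := fun i =>
    (besovOneSubmodule o hs).sub_mem (dirac_mem_besovOne _) (dirac_mem_besovOne _)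
  refine ⟨m₀ • b.root hs + ∑' i, m i • b.dipole hs i, ?_, ?_, ?_⟩
  · exact (besovOneSubmodule o hs).add_mem ((besovOneSubmodule o hs).smul_mem _ hroot)
      (sum_mem_of_hasSum isClosed_besovOne
        (fun i => (besovOneSubmodule o hs).smul_mem _ (hdip i)) hsum.hasSum)
  · refine ((hsum.hasSum.comp (tendsto_levels o)).const_add (m₀ • b.root hs)).congr fun N => ?_
    exact (b.partialSum_eq m₀ m N).symm
  · refine (norm_add_le _ _).trans ?_
    have h1 : ‖m₀ • b.root hs‖ ≤ ‖m₀‖ * (1 + averageConst G s) := by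
      rw [norm_smul]
      exact mul_le_mul_of_nonneg_left (norm_dirac_le _) (norm_nonneg _)
    have h2 : ‖∑' i, m i • b.dipole hs i‖ ≤
        2 * averageConst G s * ∑' i : HaarIndex o, μ.real i.cell ^ s * ‖m i‖ := by
      rw [← tsum_mul_left]
      exact tsum_of_norm_bounded hm'.hasSum hbound
    have h3 : 0 ≤ ∑' i : HaarIndex o, μ.real i.cell ^ s * ‖m i‖ :=
      tsum_nonneg fun i => mul_nonneg (Real.rpow_nonneg measureReal_nonneg _) (norm_nonneg _)
    nlinarith [norm_nonneg m₀, mul_nonneg hC (norm_nonneg m₀)]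

open Classical in
/-- The point of the union of a family of children of a cell `Q`. -/
def familyPoint (k : ℕ) (Q : Set I) (l : List (Set I)) : G.Path :=
  if l = o.children k Q then b.point [Q] else b.point l

/-- The value of a functional on the indicator of a family of cells. -/
def familyValue (φ : StrongDual ℂ (BesovInf o hs)) (l : List (Set I)) : ℂ :=
  (l.map fun P => φ (cellIndicator o hs P)).sum

open Classical in
/-- The coefficient of the dipole of a pair of families of children of `Q` in the dipole series
of a functional. -/
def pairCoeff (φ : StrongDual ℂ (BesovInf o hs)) (k : ℕ) (Q : Set I)
    (p : List (Set I) × List (Set I)) : ℂ :=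
  if (b.familyPoint k Q (p.1 ++ p.2)).InFamily p.1 then -familyValue φ p.2 else familyValue φ p.1

/-- The coefficients of the dipole series of a functional. -/
def dipoleCoeff (φ : StrongDual ℂ (BesovInf o hs)) (i : HaarIndex o) : ℂ :=
  b.pairCoeff φ i.1 i.cell i.2.2.1

omit [IsProbabilityMeasure μ] in
theorem familyPoint_of_length_lt {k : ℕ} {Q : Set I} {l : List (Set I)}
    (h : l.length < (o.children k Q).length) : b.familyPoint k Q l = b.point l := by
  rw [familyPoint, if_neg]
  rintro rfl
  exact h.false

theorem familyValue_append (φ : StrongDual ℂ (BesovInf o hs)) (l l' : List (Set I)) :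
    familyValue φ (l ++ l') = familyValue φ l + familyValue φ l' := by
  rw [familyValue, List.map_append, List.sum_append]; rfl

/-- Splitting a family of children, the masses at the points of the families are
redistributed by the dipoles. -/
theorem familyValue_smul_add (φ : StrongDual ℂ (BesovInf o hs)) {k : ℕ} {Q : Set I}
    (hQ : Q ∈ G.cells k) (l : List (Set I)) (hlen : l.length ≤ (o.children k Q).length)
    (hsub : ∀ p ∈ haarPairs l, p ∈ haarPairs (o.children k Q))
    (hmem : (b.familyPoint k Q l).InFamily l)
    (heq : ∀ S ∈ nodes o, (⋃ P ∈ S, P) ⊆ (⋃ P ∈ l, P) →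
      (b.familyPoint k Q l).InFamily S → b.point S = b.familyPoint k Q l) :
    familyValue φ l • dirac o hs (b.familyPoint k Q l) + ((haarPairs l).map fun p =>
      b.pairCoeff φ k Q p • (dirac o hs (b.point p.1) - dirac o hs (b.point p.2))).sum =
    (l.map fun R => φ (cellIndicator o hs R) • dirac o hs (b.point [R])).sum := by
  induction l using haarPairs.induct with
  | case1 l h ih1 ih2 =>
    rw [haarPairs_of_length h] at hsub ⊢
    set l₁ := l.take (l.length / 2) with hl₁
    set l₂ := l.drop (l.length / 2) with hl₂
    have hl : l₁ ++ l₂ = l := List.take_append_drop _ _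
    have hlen₁ : l₁.length < (o.children k Q).length := by
      rw [hl₁, List.length_take]; omega
    have hlen₂ : l₂.length < (o.children k Q).length := by
      rw [hl₂, List.length_drop]; omega
    have hhead := hsub _ List.mem_cons_self
    have hn₁ : l₁ ∈ nodes o := left_mem_nodes hQ hhead
    have hn₂ : l₂ ∈ nodes o := right_mem_nodes hQ hhead
    have hpt₁ := b.familyPoint_of_length_lt hlen₁
    have hpt₂ := b.familyPoint_of_length_lt hlen₂
    have e1 := ih1 hlen₁.le (fun p hp => hsub p (by simp [hp]))
      (by rw [hpt₁]; exact b.point_mem _ hn₁)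
      (fun S hS h1 h2 => by rw [hpt₁] at h2 ⊢; exact b.point_eq S hS _ hn₁ h1 h2)
    have e2 := ih2 hlen₂.le (fun p hp => hsub p (by simp [hp]))
      (by rw [hpt₂]; exact b.point_mem _ hn₂)
      (fun S hS h1 h2 => by rw [hpt₂] at h2 ⊢; exact b.point_eq S hS _ hn₂ h1 h2)
    rw [hpt₁] at e1
    rw [hpt₂] at e2
    have hu₁ : (⋃ P ∈ l₁, P) ⊆ ⋃ P ∈ l, P :=
      Set.biUnion_subset_biUnion_left fun P hP => List.mem_of_mem_take hP
    have hu₂ : (⋃ P ∈ l₂, P) ⊆ ⋃ P ∈ l, P :=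
      Set.biUnion_subset_biUnion_left fun P hP => List.mem_of_mem_drop hP
    have key : familyValue φ l • dirac o hs (b.familyPoint k Q l) +
        b.pairCoeff φ k Q (l₁, l₂) • (dirac o hs (b.point l₁) - dirac o hs (b.point l₂)) =
        familyValue φ l₁ • dirac o hs (b.point l₁) +
          familyValue φ l₂ • dirac o hs (b.point l₂) := by
      have hv : familyValue φ l = familyValue φ l₁ + familyValue φ l₂ := by
        rw [← familyValue_append, hl]
      rw [hv, pairCoeff]
      have hpt : b.familyPoint k Q (l₁ ++ l₂) = b.familyPoint k Q l := by rw [hl]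
      by_cases h1 : (b.familyPoint k Q l).InFamily l₁
      · rw [if_pos (by rw [hpt]; exact h1), heq l₁ hn₁ hu₁ h1]
        module
      · have h2 : (b.familyPoint k Q l).InFamily l₂ := by
          obtain ⟨j, hj⟩ := hmem
          have hj' : (b.familyPoint k Q l).cell j ∈ l₁ ++ l₂ := by rw [hl]; exact hj
          rcases List.mem_append.1 hj' with hj | hj
          · exact absurd ⟨j, hj⟩ h1
          · exact ⟨j, hj⟩
        rw [if_neg (by rw [hpt]; exact h1), heq l₂ hn₂ hu₂ h2]
        module
    rw [List.map_cons, List.sum_cons, List.map_append, List.sum_append, ← add_assoc, key]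
    conv_rhs => rw [← hl]
    rw [List.map_append, List.sum_append, ← e1, ← e2]
    abel
  | case2 l h =>
    match l, h, hmem with
    | [], _, ⟨j, hj⟩ => simp at hj
    | [R], h, _ =>
      have h2 := two_le_length_children o hQ
      rw [b.familyPoint_of_length_lt (l := [R]) (by rw [List.length_singleton]; omega),
        haarPairs_of_length_lt h]
      simp [familyValue]
    | R :: R' :: l, h, _ => simp at h

theorem sum_dipoleCoeff_smul (φ : StrongDual ℂ (BesovInf o hs)) {k : ℕ} {Q : Set I}
    (hQ : Q ∈ G.cells k) :
    φ (cellIndicator o hs Q) • dirac o hs (b.point [Q]) +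
      ((haarPairs (o.children k Q)).map fun p =>
        b.pairCoeff φ k Q p • (dirac o hs (b.point p.1) - dirac o hs (b.point p.2))).sum =
    ∑ R ∈ G.cellsIn (k + 1) Q, φ (cellIndicator o hs R) • dirac o hs (b.point [R]) := by
  have hpt : b.familyPoint k Q (o.children k Q) = b.point [Q] := by
    rw [familyPoint, if_pos rfl]
  have hv : familyValue φ (o.children k Q) = φ (cellIndicator o hs Q) := by
    rw [familyValue, sum_map_children o hQ, cellIndicator_eq_sum (Nat.le_succ k) hQ, map_sum]
  have h := b.familyValue_smul_add φ hQ (o.children k Q) le_rfl (fun _ hp => hp) ?_ ?_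
  · rwa [hpt, hv, sum_map_children o hQ] at h
  · rw [hpt]
    refine ⟨k + 1, (o.mem_children k Q hQ _).2 ⟨(b.point [Q]).cell_mem _, ?_⟩⟩
    conv_rhs => rw [← b.point_singleton_cell hQ]
    exact (b.point [Q]).cell_succ_subset k
  · intro S hS hSl hin
    rw [hpt] at hin ⊢
    refine b.point_eq S hS [Q] (singleton_mem_nodes o hQ) (hSl.trans ?_) hin
    refine Set.iUnion₂_subset fun P hP => ?_
    simpa using ((o.mem_children k Q hQ P).1 hP).2

/-- The partial sums of the dipole series of a functional are supported on the points of cells. -/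
theorem partialSum_dipoleCoeff (φ : StrongDual ℂ (BesovInf o hs)) (N : ℕ) :
    b.partialSum hs (φ (one o hs)) (b.dipoleCoeff φ) N =
      ∑ R ∈ G.cells N, φ (cellIndicator o hs R) • dirac o hs (b.point [R]) := by
  induction N with
  | zero =>
    rw [G.cells_zero, Finset.sum_singleton, cellIndicator_univ]
    simp [partialSum, root]
  | succ N ih =>
    have h1 : b.partialSum hs (φ (one o hs)) (b.dipoleCoeff φ) (N + 1) =
        b.partialSum hs (φ (one o hs)) (b.dipoleCoeff φ) N +
        ∑ i : LevelPair o N, b.dipoleCoeff φ ⟨N, i⟩ • b.dipole hs ⟨N, i⟩ := by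
      rw [partialSum, partialSum, Finset.sum_range_succ, add_assoc]
    rw [h1, ih, sum_haarPairs o N (fun i => b.dipoleCoeff φ i • b.dipole hs i)
      (fun Q p => b.pairCoeff φ N Q p • (dirac o hs (b.point p.1) - dirac o hs (b.point p.2)))
      (fun Q p => rfl), ← Finset.sum_add_distrib, ← G.sum_cells_succ N]
    exact Finset.sum_congr rfl fun Q hQ => b.sum_dipoleCoeff_smul φ hQ

theorem norm_dipoleCoeff_le (φ : StrongDual ℂ (BesovInf o hs)) (i : HaarIndex o) :
    ‖b.dipoleCoeff φ i‖ ≤ ∑ R ∈ G.cellsIn (i.1 + 1) i.cell, ‖φ (cellIndicator o hs R)‖ := by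
  classical
  have hl : ∀ l : List (Set I), l.Nodup → (∀ P ∈ l, P ∈ G.cells (i.1 + 1) ∧ P ⊆ i.cell) →
      ‖familyValue φ l‖ ≤ ∑ R ∈ G.cellsIn (i.1 + 1) i.cell, ‖φ (cellIndicator o hs R)‖ := by
    intro l hnd hl
    rw [familyValue, ← List.sum_toFinset _ hnd]
    refine (norm_sum_le _ _).trans (Finset.sum_le_sum_of_subset_of_nonneg ?_
      fun _ _ _ => norm_nonneg _)
    intro P hP
    exact G.mem_cellsIn.2 (hl P (by simpa using hP))
  rw [dipoleCoeff, pairCoeff]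
  split_ifs
  · rw [norm_neg]
    exact hl _ i.nodup_right fun _ h => i.mem_right h
  · exact hl _ i.nodup_left fun _ h => i.mem_left h

/-- The constant in the bound of the cost of the dipole series of a functional. -/
def costConst (G : GoodGrid μ) (s : ℝ) : ℝ :=
  G.lower⁻¹ * (G.lower⁻¹ ^ s * ((1 + G.lower⁻¹) * (1 - G.upper ^ s)⁻¹))

omit [IsProbabilityMeasure μ] in
theorem costConst_nonneg (hs : 0 < s) : 0 ≤ costConst G s := by
  have h1 : 0 ≤ G.lower⁻¹ := inv_nonneg.2 G.lower_pos.le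
  have h2 : 0 ≤ (1 - G.upper ^ s)⁻¹ := inv_nonneg.2 (by linarith [G.upper_rpow_lt_one hs])
  rw [costConst]
  positivity

theorem sum_cost_dipoleCoeff_le (φ : StrongDual ℂ (BesovInf o hs)) (F : Finset (HaarIndex o)) :
    ∑ i ∈ F, μ.real i.cell ^ s * ‖b.dipoleCoeff φ i‖ ≤ costConst G s * ‖φ‖ := by
  have hL : 0 ≤ G.lower⁻¹ := inv_nonneg.2 G.lower_pos.le
  have hR0 : ∀ R : Set I, 0 ≤ μ.real R ^ s := fun R => Real.rpow_nonneg measureReal_nonneg _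
  obtain ⟨N, hN⟩ := exists_subset_levels F
  refine (Finset.sum_le_sum_of_subset_of_nonneg hN
    fun i _ _ => mul_nonneg (hR0 _) (norm_nonneg _)).trans ?_
  rw [sum_levels]
  have hlevel : ∀ k ∈ Finset.range N, ∑ i : LevelPair o k,
      μ.real (HaarIndex.cell ⟨k, i⟩) ^ s * ‖b.dipoleCoeff φ ⟨k, i⟩‖ ≤
      G.lower⁻¹ * (G.lower⁻¹ ^ s *
        ∑ R ∈ G.cells (k + 1), μ.real R ^ s * ‖φ (cellIndicator o hs R)‖) := by
    intro k _
    refine (Finset.sum_le_sum fun i _ => mul_le_mul_of_nonneg_left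
      (b.norm_dipoleCoeff_le φ ⟨k, i⟩) (hR0 _)).trans ?_
    refine (sum_levelPair_le o k (f := fun Q => μ.real Q ^ s *
      ∑ R ∈ G.cellsIn (k + 1) Q, ‖φ (cellIndicator o hs R)‖) fun Q => mul_nonneg (hR0 _)
        (Finset.sum_nonneg fun _ _ => norm_nonneg _)).trans ?_
    refine mul_le_mul_of_nonneg_left ?_ hL
    rw [← G.sum_cells_succ k, Finset.mul_sum]
    refine Finset.sum_le_sum fun Q hQ => ?_
    rw [Finset.mul_sum, Finset.mul_sum]
    refine Finset.sum_le_sum fun R hR => ?_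
    rw [← mul_assoc]
    refine mul_le_mul_of_nonneg_right ?_ (norm_nonneg _)
    have hR' := G.mem_cellsIn.1 hR
    rw [← Real.mul_rpow hL measureReal_nonneg]
    refine Real.rpow_le_rpow measureReal_nonneg ?_ hs.le
    rw [inv_mul_eq_div, le_div_iff₀' G.lower_pos]
    exact G.lower_mul_le hQ hR'.1 hR'.2
  refine (Finset.sum_le_sum hlevel).trans ?_
  rw [← Finset.mul_sum, ← Finset.mul_sum, costConst]
  have h1 : ∑ k ∈ Finset.range N,
      ∑ R ∈ G.cells (k + 1), μ.real R ^ s * ‖φ (cellIndicator o hs R)‖ ≤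
      ((1 + G.lower⁻¹) * (1 - G.upper ^ s)⁻¹) * ‖φ‖ := by
    refine le_trans ?_ (sum_norm_cellIndicator_le φ (N + 1))
    rw [Finset.sum_range_succ']
    exact le_add_of_nonneg_right (Finset.sum_nonneg fun R _ =>
      mul_nonneg (hR0 _) (norm_nonneg _))
  have h2 := mul_le_mul_of_nonneg_left (mul_le_mul_of_nonneg_left h1
    (Real.rpow_nonneg hL s)) hL
  refine h2.trans (le_of_eq ?_)
  ring

theorem hasFiniteCost_dipoleCoeff (φ : StrongDual ℂ (BesovInf o hs)) :
    b.HasFiniteCost s (b.dipoleCoeff φ) :=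
  summable_of_sum_le
    (fun _ => mul_nonneg (Real.rpow_nonneg measureReal_nonneg _) (norm_nonneg _))
    (b.sum_cost_dipoleCoeff_le φ)

theorem tendsto_apply {E : Type*} [NormedAddCommGroup E] [NormedSpace ℂ E]
    {f : ℕ → StrongDual ℂ E} {φ : StrongDual ℂ E} (h : Tendsto f atTop (𝓝 φ)) (ψ : E) :
    Tendsto (fun n => f n ψ) atTop (𝓝 (φ ψ)) :=
  ((ContinuousLinearMap.apply ℂ ℂ ψ).continuous.tendsto φ).comp h

theorem tendsto_partialSum_dipoleCoeff {φ : StrongDual ℂ (BesovInf o hs)}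
    (hφ : φ ∈ besovOne o hs) :
    Tendsto (b.partialSum hs (φ (one o hs)) (b.dipoleCoeff φ)) atTop (𝓝 φ) := by
  classical
  obtain ⟨χ, hχ, hlim, -⟩ := b.exists_tendsto_partialSum hs (φ (one o hs))
    (b.hasFiniteCost_dipoleCoeff φ)
  suffices h : χ = φ by rwa [h] at hlim
  refine besovOne_ext_cells hχ hφ fun n P hP => ?_
  refine tendsto_nhds_unique (tendsto_apply hlim _) (tendsto_const_nhds.congr' ?_)
  filter_upwards [eventually_ge_atTop n] with N hN
  rw [b.partialSum_dipoleCoeff, _root_.sum_apply, cellIndicator_eq_sum hN hP, map_sum,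
    ← cellIndicator_eq_sum hN hP, cellsIn, Finset.sum_filter]
  refine Finset.sum_congr rfl fun R hR => ?_
  rw [_root_.smul_apply, dirac_cellIndicator _ hP, smul_eq_mul]
  have hRc := b.point_singleton_cell hR
  by_cases h : R ⊆ P
  · rw [if_pos h, if_pos ((b.point [R]).cell_eq hN hP (by rwa [hRc])), mul_one]
  · rw [if_neg h, if_neg, mul_zero]
    rintro rfl
    refine h ?_
    conv_lhs => rw [← hRc]
    exact (b.point [R]).cell_subset hN

theorem isConfiguration_dipoleCoeff {φ : StrongDual ℂ (BesovInf o hs)}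
    (hφ : φ ∈ besovOne o hs) :
    b.IsConfiguration (φ (one o hs)) (b.dipoleCoeff φ) (toDistribution φ) := fun ψ =>
  tendsto_apply (b.tendsto_partialSum_dipoleCoeff hφ) ψ

theorem eq_toDistribution {φ : StrongDual ℂ (BesovInf o hs)} {m₀ : ℂ} {m : HaarIndex o → ℂ}
    {γ : Distribution o hs} (hγ : b.IsConfiguration m₀ m γ)
    (h : Tendsto (b.partialSum hs m₀ m) atTop (𝓝 φ)) : toDistribution φ = γ := by
  ext ψ
  exact tendsto_nhds_unique (tendsto_apply h ψ) (hγ ψ)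

theorem image_besovOne (hs : 0 < s) :
    toDistribution '' besovOne o hs = b.configurations hs := by
  ext γ
  constructor
  · rintro ⟨φ, hφ, rfl⟩
    exact ⟨_, _, b.isConfiguration_dipoleCoeff hφ, b.hasFiniteCost_dipoleCoeff φ⟩
  · rintro ⟨m₀, m, hγ, hm⟩
    obtain ⟨φ, hφ, hlim, -⟩ := b.exists_tendsto_partialSum hs m₀ hm
    exact ⟨φ, hφ, b.eq_toDistribution hγ hlim⟩

theorem tendsto_partialSum {φ : StrongDual ℂ (BesovInf o hs)} (hφ : φ ∈ besovOne o hs) {m₀ : ℂ}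
    {m : HaarIndex o → ℂ} (hc : b.IsConfiguration m₀ m (toDistribution φ))
    (hm : b.HasFiniteCost s m) :
    Tendsto (b.partialSum hs m₀ m) atTop (𝓝 φ) ∧ ‖φ‖ ≤ (1 + 2 * averageConst G s) *
        (‖m₀‖ + ∑' i : HaarIndex o, μ.real i.cell ^ s * ‖m i‖) := by
  obtain ⟨χ, hχ, hlim, hle⟩ := b.exists_tendsto_partialSum hs m₀ hm
  have h : χ = φ := injOn_toDistribution hχ hφ (b.eq_toDistribution hc hlim)
  rw [← h]
  exact ⟨hlim, hle⟩

theorem norm_le_configurationNorm {φ : StrongDual ℂ (BesovInf o hs)} (hφ : φ ∈ besovOne o hs) :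
    ‖φ‖ ≤ (1 + 2 * averageConst G s) * b.configurationNorm (toDistribution φ) := by
  have hC := averageConst_nonneg G hs
  rw [← div_le_iff₀' (by linarith)]
  refine le_csInf ⟨_, _, _, b.isConfiguration_dipoleCoeff hφ, b.hasFiniteCost_dipoleCoeff φ,
    rfl⟩ ?_
  rintro _ ⟨m₀, m, hc, hm, rfl⟩
  rw [div_le_iff₀' (by linarith)]
  exact (b.tendsto_partialSum hφ hc hm).2

theorem configurationNorm_le {φ : StrongDual ℂ (BesovInf o hs)} (hφ : φ ∈ besovOne o hs) :
    b.configurationNorm (toDistribution φ) ≤ (1 + costConst G s) * ‖φ‖ := by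
  have h1 : b.configurationNorm (toDistribution φ) ≤ ‖φ (one o hs)‖ +
      ∑' i : HaarIndex o, μ.real i.cell ^ s * ‖b.dipoleCoeff φ i‖ := by
    refine csInf_le ⟨0, ?_⟩ ⟨_, _, b.isConfiguration_dipoleCoeff hφ,
      b.hasFiniteCost_dipoleCoeff φ, rfl⟩
    rintro _ ⟨m₀, m, _, _, rfl⟩
    exact add_nonneg (norm_nonneg _) (tsum_nonneg fun _ =>
      mul_nonneg (Real.rpow_nonneg measureReal_nonneg _) (norm_nonneg _))
  have h2 : ∑' i : HaarIndex o, μ.real i.cell ^ s * ‖b.dipoleCoeff φ i‖ ≤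
      costConst G s * ‖φ‖ :=
    Summable.tsum_le_of_sum_le (b.hasFiniteCost_dipoleCoeff φ) (b.sum_cost_dipoleCoeff_le φ)
  linarith [norm_apply_one_le φ]

end DipoleBasis

end Dipoles

end GoodGrid

end

/-- The space `B^{-s}_{1,1}` is the space of `s`-particle systems and, as a space of
distributions, the space of dipole configurations of finite cost of every dipole basis; the norms
are equivalent uniformly in the dipole basis. -/
theorem theorem4 {I : Type*} [MeasurableSpace I] (μ : Measure I) [IsProbabilityMeasure μ]
    (G : GoodGrid μ) (o : G.ChildOrder) (s : ℝ) (hs : 0 < s) :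
    -- Dirac masses are well defined, as limits in the norm of `B^{-s}_{1,1}`
    (∀ x : G.Path, GoodGrid.dirac o hs x ∈ GoodGrid.besovOne o hs ∧
      (∀ j, GoodGrid.cellAverage o hs x j ∈ GoodGrid.besovOne o hs) ∧
      Tendsto (fun j => GoodGrid.besovOneNorm
        (GoodGrid.cellAverage o hs x j - GoodGrid.dirac o hs x)) atTop (𝓝 0)) ∧
    -- `B^{-s}_{1,1} = PS^s`
    GoodGrid.besovOne o hs = GoodGrid.particleSystems o hs ∧
    -- elements of `B^{-s}_{1,1}` are determined by their values on test functions, and, as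
    -- distributions, they form the space `DC^s`
    Set.InjOn GoodGrid.toDistribution (GoodGrid.besovOne o hs) ∧
    (∀ b : GoodGrid.DipoleBasis o,
      GoodGrid.toDistribution '' GoodGrid.besovOne o hs = b.configurations hs) ∧
    -- the dipole series of an element also converges to it in the norm of the dual
    (∀ b : GoodGrid.DipoleBasis o, ∀ φ ∈ GoodGrid.besovOne o hs, ∀ m₀ m,
      b.IsConfiguration m₀ m (GoodGrid.toDistribution φ) → b.HasFiniteCost s m →
        Tendsto (b.partialSum hs m₀ m) atTop (𝓝 φ)) ∧
    -- the norms are equivalent, with a constant that does not depend on the dipole basis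
    ∃ C : ℝ, 0 < C ∧ ∀ b : GoodGrid.DipoleBasis o, ∀ φ ∈ GoodGrid.besovOne o hs,
      1 / C * b.configurationNorm (GoodGrid.toDistribution φ) ≤ GoodGrid.besovOneNorm φ ∧
      GoodGrid.besovOneNorm φ ≤ C * b.configurationNorm (GoodGrid.toDistribution φ) := by
  have hA := GoodGrid.averageConst_nonneg G hs
  have hK := GoodGrid.DipoleBasis.costConst_nonneg (G := G) hs
  have hL : 0 < 2 / G.lower := div_pos two_pos G.lower_pos
  refine ⟨fun x => ⟨GoodGrid.dirac_mem_besovOne x,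
      fun j => GoodGrid.average_mem_besovOne (x.cell j),
      GoodGrid.tendsto_besovOneNorm_cellAverage_sub x⟩,
    GoodGrid.besovOne_eq_particleSystems o hs, GoodGrid.injOn_toDistribution,
    fun b => b.image_besovOne hs, fun b φ hφ m₀ m hc hm => (b.tendsto_partialSum hφ hc hm).1,
    (1 + GoodGrid.DipoleBasis.costConst G s) * (1 + 2 / G.lower) +
      2 * (1 + 2 * GoodGrid.averageConst G s), by positivity, fun b φ hφ => ⟨?_, ?_⟩⟩
  · have h1 := b.configurationNorm_le hφ
    have h2 := mul_le_mul_of_nonneg_left (GoodGrid.norm_le_besovOneNorm hφ)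
      (by linarith : 0 ≤ 1 + GoodGrid.DipoleBasis.costConst G s)
    have h3 := mul_nonneg (by linarith : 0 ≤ 2 * (1 + 2 * GoodGrid.averageConst G s))
      (GoodGrid.besovOneNorm_nonneg φ)
    rw [one_div, inv_mul_le_iff₀ (by positivity)]
    linarith
  · have h1 := GoodGrid.besovOneNorm_le hφ
    have h2 := b.norm_le_configurationNorm hφ
    have h3 : 0 ≤ b.configurationNorm (GoodGrid.toDistribution φ) := by
      have := (norm_nonneg φ).trans h2
      exact nonneg_of_mul_nonneg_right this (by linarith)
    have h4 := mul_nonneg (by positivity : 0 ≤ (1 + GoodGrid.DipoleBasis.costConst G s) *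
      (1 + 2 / G.lower)) h3
    linarith
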